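/- Let $k$ be a field. "Bigraded" means graded by a cohomological degree and an inner degree, both in $\mathbb Z$; signs depend only on the cohomological degree, and differentials have bidegree $(1,0)$. Let $A$ and $B$ be bigraded associative unital dg algebras over $k$ (for instance bigraded algebras with zero differential), and let $K$ be a bigraded dg $B$-$A$-bimodule. Let $\mathrm{cat}(A,B,K)$ be the bigraded dg category with two objects $a,b$ and $\mathrm{Mor}(a,a)=A$, $\mathrm{Mor}(b,b)=B$, $\mathrm{Mor}(b,a)=K$, $\mathrm{Mor}(a,b)=0$, where $\mathrm{Mor}(Y,X)$ denotes the morphisms from $X$ to $Y$; the compositions are the products of $A$ and $B$ and their actions on $K$. For a bigraded dg category $\mathcal A$ let $$\mathrm{Hoch}^{n,j}(\mathcal A)=\prod_{p\ge 0}\ \prod_{X_0,\dots,X_p}\mathrm{Hom}_k^{\,n-p,\,j}\bigl(\mathcal A(X_0,X_1)\otimes\cdots\otimes\mathcal A(X_{p-1},X_p),\ \mathcal A(X_0,X_p)\bigr)$$ (again $\mathcal A(Y,X)$ is the complex of morphisms from $X$ to $Y$, $\mathrm{Hom}_k^{m,j}$ is the space of $k$-linear maps of bidegree $(m,j)$,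 and the $p=0$ factor is the bidegree $(n,j)$ part of $\prod_X\mathcal A(X,X)$), with the sum of the internal and the Hochschild differential. The graded Hochschild complex is the direct sum of its bigraded components: $\mathrm{Hoch}^{n}_{\mathrm{gr}}(\mathcal A)=\bigoplus_{j}\mathrm{Hoch}^{n,j}(\mathcal A)$. A bigraded dg algebra is regarded as a dg category with one object. Let $$p_A\colon\mathrm{Hoch}_{\mathrm{gr}}(\mathrm{cat}(A,B,K))\to\mathrm{Hoch}_{\mathrm{gr}}(A),\qquad p_B\colon\mathrm{Hoch}_{\mathrm{gr}}(\mathrm{cat}(A,B,K))\to\mathrm{Hoch}_{\mathrm{gr}}(B)$$ be the projections that restrict cochains to the object $a$, respectively $b$. Suppose that $(A,B,K)$ satisfies the graded Keller condition: the natural maps $$B\to\mathrm{RHom}_{\mathrm{grmod}\text{-}A}(K,K),\qquad A^{\mathrm{opp}}\to\mathrm{RHom}_{B\text{-}\mathrm{grmod}}(K,K)$$ given by the left action of $B$ and the right action of $A$ on $K$ are quasi-isomorphisms in every inner degree. Here the derived functors are taken in the categories of bigraded right dg $A$-modules and bigraded left dg $B$-modules, so $\mathrm{RHom}(K,K)$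 is the bigraded complex $\mathrm{Hom}(P,K)$ for a K-projective resolution $P\to K$ of bigraded dg modules. Then $p_A$ and $p_B$ are quasi-isomorphisms of complexes. -/

import Mathlib

open CategoryTheory

noncomputable section

namespace GradedKeller

universe u

/-! ### Bigraded complexes -/

/-- A bigraded complex of `k`-vector spaces: `M` is the direct sum of the pieces `piece i j`
(`i` is the cohomological degree, `j` the inner degree) and `d` is a differential of bidegree
`(1, 0)`. -/
class BigradedComplex (k M : Type u) [Field k] [AddCommGroup M] [Module k M] where
  piece : ℤ → ℤ → Submodule k M
  internal : DirectSum.IsInternal (fun e : ℤ × ℤ => piece e.1 e.2)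
  d : M →ₗ[k] M
  d_mem : ∀ {i j : ℤ} {x : M}, x ∈ piece i j → d x ∈ piece (i + 1) j
  d_d : ∀ x : M, d (d x) = 0

section Complex

variable (k : Type u) [Field k] {M : Type u} [AddCommGroup M] [Module k M] [BigradedComplex k M]

/-- The bihomogeneous elements of bidegree `(i, j)`. -/
def pc (M : Type u) [AddCommGroup M] [Module k M] [BigradedComplex k M] (i j : ℤ) :
    Submodule k M :=
  BigradedComplex.piece i j

/-- The differential. -/
def dd : M →ₗ[k] M := BigradedComplex.d

/-- The direct sum decomposition of a bigraded complex. -/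
def decomp (M : Type u) [AddCommGroup M] [Module k M] [BigradedComplex k M] :
    (DirectSum (ℤ × ℤ) fun e => pc k M e.1 e.2) ≃ₗ[k] M :=
  LinearEquiv.ofBijective (DirectSum.coeLinearMap fun e : ℤ × ℤ => pc k M e.1 e.2)
    (BigradedComplex.internal (k := k) (M := M))

/-- The sign operator: `sg k n x = (-1) ^ (n * i) x` for `x` of cohomological degree `i`. -/
def sg (n : ℤ) : M →ₗ[k] M :=
  (decomp k M).toLinearMap ∘ₗ
    (DirectSum.lmap fun e : ℤ × ℤ =>
      ((n * e.1).negOnePow : ℤ) • (LinearMap.id : pc k M e.1 e.2 →ₗ[k] pc k M e.1 e.2)) ∘ₗ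
    (decomp k M).symm.toLinearMap

theorem dd_mem {i j : ℤ} {x : M} (h : x ∈ pc k M i j) : dd k x ∈ pc k M (i + 1) j :=
  BigradedComplex.d_mem h

theorem dd_dd (x : M) : dd k (dd k x) = 0 := BigradedComplex.d_d x

theorem sg_of_mem (n : ℤ) {i j : ℤ} {x : M} (h : x ∈ pc k M i j) :
    sg k n x = ((n * i).negOnePow : ℤ) • x := by
  have h0 : ∀ y : pc k M i j, decomp k M
      (DirectSum.lof k (ℤ × ℤ) (fun e : ℤ × ℤ => pc k M e.1 e.2) (i, j) y) = y := fun y =>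
    DirectSum.coeLinearMap_lof (fun e : ℤ × ℤ => pc k M e.1 e.2) (i, j) y
  have h1 : (decomp k M).symm x
      = DirectSum.lof k (ℤ × ℤ) (fun e : ℤ × ℤ => pc k M e.1 e.2) (i, j) ⟨x, h⟩ := by
    rw [LinearEquiv.symm_apply_eq, h0]
  simp only [sg, LinearMap.comp_apply, LinearEquiv.coe_coe]
  rw [h1, DirectSum.lmap_lof, h0]
  rfl

/-- Linear maps that agree on bihomogeneous elements are equal. -/
theorem ext_pc {N : Type u} [AddCommGroup N] [Module k N] {f g : M →ₗ[k] N}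
    (h : ∀ i j x, x ∈ pc k M i j → f x = g x) : f = g := by
  ext x
  have hx : x ∈ ⨆ e : ℤ × ℤ, pc k M e.1 e.2 := by
    rw [show (⨆ e : ℤ × ℤ, pc k M e.1 e.2) = ⊤ from
      (BigradedComplex.internal (k := k) (M := M)).submodule_iSup_eq_top]
    trivial
  induction hx using Submodule.iSup_induction' with
  | mem e x hx => exact h _ _ _ hx
  | zero => simp
  | add x y _ _ hx hy => simp [hx, hy]

theorem sg_mem (n : ℤ) {i j : ℤ} {x : M} (h : x ∈ pc k M i j) : sg k n x ∈ pc k M i j := by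
  rw [sg_of_mem k n h]; exact zsmul_mem h _

theorem sg_sg (m n : ℤ) (x : M) : sg k m (sg k n x) = sg k (m + n) x := by
  have : sg k m ∘ₗ sg k n = (sg k (m + n) : M →ₗ[k] M) := by
    refine ext_pc k fun i j x h => ?_
    simp only [LinearMap.comp_apply]
    rw [sg_of_mem k _ h, map_zsmul, sg_of_mem k _ h, sg_of_mem k _ h, smul_smul, add_mul,
      Int.negOnePow_add, Units.val_mul, mul_comm]
  exact LinearMap.congr_fun this x

theorem sg_even {n : ℤ} (hn : Even n) (x : M) : sg k n x = x := by
  have : sg k n = (LinearMap.id : M →ₗ[k] M) := by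
    refine ext_pc k fun i j x h => ?_
    rw [sg_of_mem k _ h, Int.negOnePow_even _ (hn.mul_right i)]
    simp
  exact LinearMap.congr_fun this x

theorem sg_one_sg_one (x : M) : sg k 1 (sg k 1 x) = x := by
  rw [sg_sg]; exact sg_even k (by decide) x

theorem dd_sg (n : ℤ) (x : M) : dd k (sg k n x) = (n.negOnePow : ℤ) • sg k n (dd k x) := by
  have : dd k ∘ₗ sg k n = (n.negOnePow : ℤ) • (sg k n ∘ₗ dd k : M →ₗ[k] M) := by
    refine ext_pc k fun i j x h => ?_
    simp only [LinearMap.comp_apply, LinearMap.smul_apply]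
    rw [sg_of_mem k _ h, map_zsmul, sg_of_mem k _ (dd_mem k h), smul_smul, mul_add,
      Int.negOnePow_add, Units.val_mul, mul_one, mul_comm (_ : ℤ) (n.negOnePow : ℤ)]
    rw [← mul_assoc, ← Units.val_mul, ← Int.negOnePow_add, Int.negOnePow_even (n + n) ⟨n, rfl⟩]
    simp
  exact LinearMap.congr_fun this x

end Complex

/-! ### Bigraded dg categories and their Hochschild complexes -/

/-- A bigraded dg category over `k`. `Mor Y X` is the bigraded complex of morphisms to `Y`
from `X`, so that composition is a map `Mor Z Y ⊗ Mor Y X → Mor Z X`. -/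
structure BigradedDGCategory (k : Type u) [Field k] where
  Obj : Type u
  Mor : Obj → Obj → Type u
  [acg : ∀ Y X, AddCommGroup (Mor Y X)]
  [mod : ∀ Y X, Module k (Mor Y X)]
  [cx : ∀ Y X, BigradedComplex k (Mor Y X)]
  one : ∀ X, Mor X X
  comp : ∀ {Z Y X}, Mor Z Y →ₗ[k] Mor Y X →ₗ[k] Mor Z X
  one_comp : ∀ {Y X} (f : Mor Y X), comp (one Y) f = f
  comp_one : ∀ {Y X} (f : Mor Y X), comp f (one X) = f
  assoc : ∀ {W Z Y X} (h : Mor W Z) (g : Mor Z Y) (f : Mor Y X),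
    comp (comp h g) f = comp h (comp g f)
  one_mem : ∀ X, one X ∈ pc k (Mor X X) 0 0
  comp_mem : ∀ {Z Y X} {i j i' j' : ℤ} {g : Mor Z Y} {f : Mor Y X},
    g ∈ pc k (Mor Z Y) i j → f ∈ pc k (Mor Y X) i' j' →
      comp g f ∈ pc k (Mor Z X) (i + i') (j + j')
  leibniz : ∀ {Z Y X} (g : Mor Z Y) (f : Mor Y X),
    dd k (comp g f) = comp (dd k g) f + comp (sg k 1 g) (dd k f)

attribute [instance] BigradedDGCategory.acg BigradedDGCategory.mod BigradedDGCategory.cx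

section Hochschild

variable {k : Type u} [Field k] (C : BigradedDGCategory k)

/-- Composable strings `x₁, …, xₚ` of morphisms, `xᵢ ∈ Mor Xᵢ₋₁ Xᵢ`, with `X₀ = Z` and `Xₚ = X`.
The chain of objects and the length `p ≥ 0` are part of the string. -/
inductive Str : C.Obj → C.Obj → Type u
  | nil (X : C.Obj) : Str X X
  | cons {Z Y X : C.Obj} (g : C.Mor Z Y) (s : Str Y X) : Str Z X

variable {C}

namespace Str

/-- Concatenation of strings. -/
def append : {Z Y X : C.Obj} → Str C Z Y → Str C Y X → Str C Z X
  | _, _, _, nil _, t => t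
  | _, _, _, cons g s, t => cons g (append s t)

/-- `HasDeg s p q` : all entries `x₁, …, xₘ` of `s` are bihomogeneous, `p` is the sum of the shifted
cohomological degrees `|xᵢ| - 1`, and `q` is the sum of the inner degrees. -/
inductive HasDeg : {Z X : C.Obj} → Str C Z X → ℤ → ℤ → Prop
  | nil (X : C.Obj) : HasDeg (nil X) 0 0
  | cons {Z Y X : C.Obj} {g : C.Mor Z Y} {s : Str C Y X} {i j p q : ℤ}
      (hg : g ∈ pc k (C.Mor Z Y) i j) (hs : HasDeg s p q) : HasDeg (cons g s) (i - 1 + p) (j + q)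

end Str

/-- Functions on composable strings with values in a vector space that are `k`-linear in each
entry. -/
def IsMultilinear {N : Type u} [AddCommGroup N] [Module k N] {Z X : C.Obj}
    (φ : Str C Z X → N) : Prop :=
  ∀ (Y W : C.Obj) (s : Str C Z Y) (t : Str C W X) (c : k) (g g' : C.Mor Y W),
    φ (s.append (.cons (c • g + g') t)) =
      c • φ (s.append (.cons g t)) + φ (s.append (.cons g' t))

variable (C) in
/-- Families `φ` of functions `φ (x₁, …, xₚ) ∈ Mor X₀ Xₚ`, for all `p ≥ 0` and all chains of objects
`X₀, …, Xₚ`. -/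
abbrev Fam : Type u := ∀ Z X : C.Obj, Str C Z X → C.Mor Z X

variable (C) in
/-- Hochschild cochains of total cohomological degree `n` and inner degree `j`: families of
multilinear maps, over all `p ≥ 0` and all chains `X₀, …, Xₚ`,
`Mor X₀ X₁ ⊗ ⋯ ⊗ Mor Xₚ₋₁ Xₚ → Mor X₀ Xₚ` of bidegree `(n - p, j)`; that is, the product
over `p` and over all chains of the spaces of such maps. -/
def Hoch (n j : ℤ) : Submodule k (Fam C) where
  carrier := {φ | (∀ Z X, IsMultilinear (φ Z X)) ∧
    ∀ {Z X} {s : Str C Z X} {p q : ℤ}, s.HasDeg p q → φ Z X s ∈ pc k (C.Mor Z X) (n + p) (j + q)}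
  add_mem' := by
    rintro φ ψ ⟨h1, h2⟩ ⟨h3, h4⟩
    refine ⟨fun Z X Y W s t c g g' => ?_, fun h => add_mem (h2 h) (h4 h)⟩
    simp only [Pi.add_apply]
    rw [h1 Z X Y W s t, h3 Z X Y W s t]
    module
  zero_mem' := ⟨fun Z X Y W s t c g g' => by simp, fun h => zero_mem _⟩
  smul_mem' := by
    rintro a φ ⟨h1, h2⟩
    refine ⟨fun Z X Y W s t c g g' => ?_, fun h => Submodule.smul_mem _ _ (h2 h)⟩
    simp only [Pi.smul_apply]
    rw [h1 Z X Y W s t]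
    module

section Operators

variable {N : Type u} [AddCommGroup N] [Module k N]

/-- `merge φ x₁ (x₂, …, xₚ) = (-1) ^ |x₁| φ (x₁ x₂, x₃, …, xₚ)`, and `0` if `p = 1`. -/
def merge {Z Y X : C.Obj} (φ : Str C Z X → N) (g : C.Mor Z Y) : Str C Y X → N
  | .nil _ => 0
  | .cons f t => φ (.cons (C.comp (sg k 1 g) f) t)

/-- The inner part of the differential,
`∑ i, (-1) ^ εᵢ (φ (x₁, …, d xᵢ, …, xₚ) + (-1) ^ |xᵢ| φ (x₁, …, xᵢ xᵢ₊₁, …, xₚ))`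
with `εᵢ = ∑ l < i, (|x_l| - 1)`. -/
def inner : {Z X : C.Obj} → (Str C Z X → N) → Str C Z X → N
  | _, _, _, .nil _ => 0
  | _, _, φ, .cons g s =>
      φ (.cons (dd k g) s) + merge φ g s - inner (fun s' => φ (.cons (sg k 1 g) s')) s

/-- The right boundary term without sign, `χ (x₁, …, xₚ₋₁) xₚ`, and `0` if `p = 0`. -/
def rmul : {U Z X : C.Obj} → (∀ W, Str C Z W → C.Mor U W) → Str C Z X → C.Mor U X
  | _, _, _, _, .nil _ => 0
  | _, _, _, χ, .cons g (.nil _) => C.comp (χ _ (.nil _)) g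
  | _, _, _, χ, .cons g (.cons f t) => rmul (fun W s' => χ W (.cons g s')) (.cons f t)

/-- The left boundary term `(-1) ^ (n |x₁|) x₁ φ (x₂, …, xₚ)`, and `0` if `p = 0`. -/
def lmul (n : ℤ) {Z X : C.Obj} (φ : ∀ W, Str C W X → C.Mor W X) : Str C Z X → C.Mor Z X
  | .nil _ => 0
  | .cons g s => C.comp (sg k n g) (φ _ s)

end Operators

/-- The total Hochschild differential of a cochain `φ` of total degree `n`:
`(δ φ) (x₁, …, xₚ) = d (φ (x₁, …, xₚ)) + (-1) ^ |φ (x₁, …, xₚ₋₁)| φ (x₁, …, xₚ₋₁) xₚ`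
`  + (-1) ^ n ∑ i, (-1) ^ εᵢ (φ (x₁, …, d xᵢ, …, xₚ) + (-1) ^ |xᵢ| φ (x₁, …, xᵢ xᵢ₊₁, …, xₚ))`
`  - (-1) ^ (n + n |x₁|) x₁ φ (x₂, …, xₚ)`
with `εᵢ = ∑ l < i, (|x_l| - 1)`. -/
def delta (n : ℤ) (φ : Fam C) : Fam C := fun Z X s =>
  dd k (φ Z X s) + rmul (fun W s' => sg k 1 (φ Z W s')) s +
    (n.negOnePow : ℤ) • (inner (φ Z X) s - lmul n (fun W => φ W X) s)

section Lemmas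

variable {N N' : Type u} [AddCommGroup N] [AddCommGroup N']

theorem merge_add {Z Y X : C.Obj} (φ ψ : Str C Z X → N) (g : C.Mor Z Y) (s : Str C Y X) :
    merge (fun t => φ t + ψ t) g s = merge φ g s + merge ψ g s := by
  cases s <;> simp [merge]

theorem merge_map {Z Y X : C.Obj} (f : N →+ N') (φ : Str C Z X → N) (g : C.Mor Z Y)
    (s : Str C Y X) : merge (fun t => f (φ t)) g s = f (merge φ g s) := by
  cases s <;> simp [merge]

theorem inner_add {Z X : C.Obj} (s : Str C Z X) : ∀ (φ ψ : Str C Z X → N),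
    inner (fun t => φ t + ψ t) s = inner φ s + inner ψ s := by
  induction s with
  | nil => intro φ ψ; simp [inner]
  | cons g s ih => intro φ ψ; simp only [inner, merge_add, ih]; abel

theorem inner_map {Z X : C.Obj} (f : N →+ N') (s : Str C Z X) : ∀ (φ : Str C Z X → N),
    inner (fun t => f (φ t)) s = f (inner φ s) := by
  induction s with
  | nil => intro φ; simp [inner]
  | cons g s ih => intro φ; simp only [inner, merge_map, ih, map_add, map_sub]

theorem inner_cons {Z Y X : C.Obj} (φ : Str C Z X → N) (g : C.Mor Z Y) (s : Str C Y X) :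
    inner φ (.cons g s) =
      φ (.cons (dd k g) s) + merge φ g s - inner (fun s' => φ (.cons (sg k 1 g) s')) s := rfl

theorem inner_neg {Z X : C.Obj} (s : Str C Z X) (φ : Str C Z X → N) :
    inner (fun t => - φ t) s = - inner φ s :=
  inner_map (-AddMonoidHom.id N) s φ

theorem inner_sub {Z X : C.Obj} (s : Str C Z X) (φ ψ : Str C Z X → N) :
    inner (fun t => φ t - ψ t) s = inner φ s - inner ψ s := by
  simp only [sub_eq_add_neg, inner_add, inner_neg]

theorem inner_zsmul {Z X : C.Obj} (s : Str C Z X) (c : ℤ) (φ : Str C Z X → N) :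
    inner (fun t => c • φ t) s = c • inner φ s :=
  inner_map (zsmulAddGroupHom c : N →+ N) s φ

variable [Module k N]

theorem inner_smul {Z X : C.Obj} (s : Str C Z X) (c : k) (φ : Str C Z X → N) :
    inner (fun t => c • φ t) s = c • inner φ s :=
  inner_map (DistribSMul.toAddMonoidHom N c) s φ

theorem IsMultilinear.tail {Z Y X : C.Obj} {φ : Str C Z X → N} (h : IsMultilinear φ)
    (g : C.Mor Z Y) : IsMultilinear fun s => φ (.cons g s) :=
  fun Y W s t c f f' => h Y W (.cons g s) t c f f'

theorem IsMultilinear.head {Z Y X : C.Obj} {φ : Str C Z X → N} (h : IsMultilinear φ)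
    (c : k) (g g' : C.Mor Z Y) (t : Str C Y X) :
    φ (.cons (c • g + g') t) = c • φ (.cons g t) + φ (.cons g' t) :=
  h _ _ (.nil Z) t c g g'

/-- The function `g ↦ φ (g, t)` as a linear map. -/
def IsMultilinear.headMap {Z X : C.Obj} {φ : Str C Z X → N} (h : IsMultilinear φ)
    (Y : C.Obj) (t : Str C Y X) : C.Mor Z Y →ₗ[k] N where
  toFun g := φ (.cons g t)
  map_add' g g' := by simpa using h.head 1 g g' t
  map_smul' c g := by
    have h0 : φ (.cons (0 : C.Mor Z Y) t) = 0 := by simpa using h.head 1 0 0 t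
    simpa [h0] using h.head c g 0 t

theorem inner_isMultilinear {Z X : C.Obj} {φ : Str C Z X → N} (h : IsMultilinear φ) :
    IsMultilinear (inner φ) := by
  intro Y W s t c f f'
  induction s with
  | nil Z =>
    simp only [Str.append, inner]
    have e1 : φ (.cons (dd k (c • f + f')) t) =
        c • φ (.cons (dd k f) t) + φ (.cons (dd k f') t) := by
      rw [map_add, map_smul]
      exact h.head _ _ _ _
    have e2 : ∀ (c : k) (f f' : C.Mor Z W), merge φ (c • f + f') t =
        c • merge φ f t + merge φ f' t := by
      intro c f f'
      cases t with
      | nil => simp [merge]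
      | cons a t =>
        simp only [merge, map_add, map_smul, LinearMap.add_apply, LinearMap.smul_apply]
        exact h.head _ _ _ _
    have e3 : ∀ s', φ (.cons (sg k 1 (c • f + f')) s') =
        c • φ (.cons (sg k 1 f) s') + φ (.cons (sg k 1 f') s') := by
      intro s'
      rw [map_add, map_smul]
      exact h.head _ _ _ _
    rw [e1, e2, funext e3, inner_add, inner_smul]
    module
  | cons g s ih =>
    simp only [Str.append, inner]
    rw [ih (h.tail _), show φ (.cons (dd k g) (s.append (.cons (c • f + f') t))) = _ from
      (h.tail (dd k g)) _ _ s t c f f']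
    have e2 : merge φ g (s.append (.cons (c • f + f') t)) =
        c • merge φ g (s.append (.cons f t)) + merge φ g (s.append (.cons f' t)) := by
      cases s with
      | nil =>
        simp only [Str.append, merge, map_add, map_smul]
        exact h.head _ _ _ _
      | cons a s => exact (h.tail _) _ _ s t c f f'
    rw [e2]
    module

/-- The contribution of the last entry to `rmul`. -/
def rlast {U Z Y X : C.Obj} (χ : ∀ W, Str C Z W → C.Mor U W) (g : C.Mor Z Y) :
    Str C Y X → C.Mor U X
  | .nil _ => C.comp (χ _ (.nil _)) g
  | .cons _ _ => 0

theorem rmul_cons {U Z Y X : C.Obj} (χ : ∀ W, Str C Z W → C.Mor U W) (g : C.Mor Z Y)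
    (s : Str C Y X) :
    rmul χ (.cons g s) = rlast χ g s + rmul (fun W s' => χ W (.cons g s')) s := by
  cases s <;> simp [rmul, rlast]

theorem rmul_add {U Z X : C.Obj} (s : Str C Z X) : ∀ χ ψ : ∀ W, Str C Z W → C.Mor U W,
    rmul (fun W t => χ W t + ψ W t) s = rmul χ s + rmul ψ s := by
  induction s with
  | nil => intro χ ψ; simp [rmul]
  | cons g s ih => intro χ ψ; rw [rmul_cons, ih, rmul_cons, rmul_cons]; cases s <;> simp [rlast]; abel

theorem rmul_smul {U Z X : C.Obj} (s : Str C Z X) (c : k) : ∀ χ : ∀ W, Str C Z W → C.Mor U W,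
    rmul (fun W t => c • χ W t) s = c • rmul χ s := by
  induction s with
  | nil => intro χ; simp [rmul]
  | cons g s ih => intro χ; rw [rmul_cons, ih, rmul_cons]; cases s <;> simp [rlast]

theorem rmul_isMultilinear {U Z X : C.Obj} {χ : ∀ W, Str C Z W → C.Mor U W}
    (h : ∀ W, IsMultilinear (χ W)) : IsMultilinear (rmul (X := X) χ) := by
  intro Y W s t c f f'
  induction s with
  | nil Z =>
    simp only [Str.append, rmul_cons]
    have e : ∀ W' s', χ W' (.cons (c • f + f') s') = c • χ W' (.cons f s') + χ W' (.cons f' s') :=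
      fun W' s' => (h W').head _ _ _ _
    simp only [e, rmul_add, rmul_smul]
    cases t <;> simp [rlast]
    abel
  | cons g s ih =>
    simp only [Str.append, rmul_cons]
    rw [ih (fun W => (h W).tail g)]
    cases s <;> simp [rlast, Str.append]

theorem lmul_isMultilinear (n : ℤ) {Z X : C.Obj} {φ : ∀ W, Str C W X → C.Mor W X}
    (h : ∀ W, IsMultilinear (φ W)) : IsMultilinear (lmul n φ (Z := Z)) := by
  intro Y W s t c f f'
  cases s with
  | nil => simp [Str.append, lmul]
  | cons g s =>
    simp only [Str.append, lmul]
    rw [h _ _ _ s t c f f', map_add, map_smul]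

theorem comp_isMultilinear {N' : Type u} [AddCommGroup N'] [Module k N'] {Z X : C.Obj}
    (f : N →ₗ[k] N') {φ : Str C Z X → N} (h : IsMultilinear φ) :
    IsMultilinear fun s => f (φ s) := by
  intro Y W s t c g g'
  simp only []
  rw [h Y W s t c g g', map_add, map_smul]

/-! Degrees -/

theorem inner_degree {M : Type u} [AddCommGroup M] [Module k M] [BigradedComplex k M]
    {Z X : C.Obj} {s : Str C Z X} {p q : ℤ} (hs : s.HasDeg p q) :
    ∀ {n j : ℤ} {φ : Str C Z X → M},
      (∀ {t : Str C Z X} {p q : ℤ}, t.HasDeg p q → φ t ∈ pc k M (n + p) (j + q)) →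
      inner φ s ∈ pc k M (n + 1 + p) (j + q) := by
  induction hs with
  | nil => intro n j φ _; exact zero_mem _
  | @cons Z Y X g s i j' p q hg hs ih =>
    intro n j φ h
    simp only [inner]
    refine sub_mem (add_mem ?_ ?_) ?_
    · have := h (Str.HasDeg.cons (dd_mem k hg) hs)
      rwa [show n + (i + 1 - 1 + p) = n + 1 + (i - 1 + p) by ring] at this
    · cases hs with
      | nil => exact zero_mem _
      | @cons _ _ _ f t i2 j2 p2 q2 hf ht =>
        have := h (Str.HasDeg.cons (C.comp_mem (sg_mem k 1 hg) hf) ht)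
        rwa [show n + (i + i2 - 1 + p2) = n + 1 + (i - 1 + (i2 - 1 + p2)) by ring,
          show j + (j' + j2 + q2) = j + (j' + (j2 + q2)) by ring] at this
    · have := @ih (n + (i - 1)) (j + j') (fun s' => φ (.cons (sg k 1 g) s')) (by
        intro t p q ht
        have := h (Str.HasDeg.cons (sg_mem k 1 hg) ht)
        rwa [show n + (i - 1 + p) = n + (i - 1) + p by ring,
          show j + (j' + q) = j + j' + q by ring] at this)
      rwa [show n + (i - 1) + 1 + p = n + 1 + (i - 1 + p) by ring,
          show j + j' + q = j + (j' + q) by ring] at this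

theorem rmul_degree {Z X : C.Obj} {s : Str C Z X} {p q : ℤ} (hs : s.HasDeg p q) :
    ∀ {n j : ℤ} {U : C.Obj} {χ : ∀ W, Str C Z W → C.Mor U W},
      (∀ {W : C.Obj} {t : Str C Z W} {p q : ℤ}, t.HasDeg p q →
        χ W t ∈ pc k (C.Mor U W) (n + p) (j + q)) →
      rmul χ s ∈ pc k (C.Mor U X) (n + 1 + p) (j + q) := by
  induction hs with
  | nil => intro n j U χ _; exact zero_mem _
  | @cons Z Y X g s i j' p q hg hs ih =>
    intro n j U χ h
    rw [rmul_cons]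
    refine add_mem ?_ ?_
    · cases hs with
      | nil =>
        have := C.comp_mem (h (Str.HasDeg.nil _)) hg
        rwa [show n + 0 + i = n + 1 + (i - 1 + 0) by ring,
          show j + 0 + j' = j + (j' + 0) by ring] at this
      | cons => exact zero_mem _
    · have := @ih (n + (i - 1)) (j + j') U (fun W s' => χ W (.cons g s')) (by
        intro W t p q ht
        have := h (Str.HasDeg.cons hg ht)
        rwa [show n + (i - 1 + p) = n + (i - 1) + p by ring,
          show j + (j' + q) = j + j' + q by ring] at this)
      rwa [show n + (i - 1) + 1 + p = n + 1 + (i - 1 + p) by ring,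
          show j + j' + q = j + (j' + q) by ring] at this

theorem delta_mem {n j : ℤ} {φ : Fam C} (h : φ ∈ Hoch C n j) : delta n φ ∈ Hoch C (n + 1) j := by
  obtain ⟨h1, h2⟩ := h
  refine ⟨fun Z X Y W s t c g g' => ?_, fun {Z X s p q} hs => ?_⟩
  · simp only [delta]
    rw [h1 Z X Y W s t c g g', map_add, map_smul,
      rmul_isMultilinear (fun W => comp_isMultilinear (sg k 1) (h1 Z W)) Y W s t c g g',
      inner_isMultilinear (h1 Z X) Y W s t c g g',
      lmul_isMultilinear n (fun W => h1 W X) Y W s t c g g']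
    module
  · refine add_mem (add_mem ?_ ?_) (zsmul_mem (sub_mem ?_ ?_) _)
    · have := dd_mem k (h2 hs)
      rwa [show n + p + 1 = n + 1 + p by ring] at this
    · exact rmul_degree hs fun ht => sg_mem k 1 (h2 ht)
    · exact inner_degree hs h2
    · cases hs with
      | nil => exact zero_mem _
      | @cons _ Y _ g s i j' p q hg hs =>
        have := C.comp_mem (sg_mem k n hg) (h2 hs)
        rwa [show i + (n + p) = n + 1 + (i - 1 + p) by ring,
          show j' + (j + q) = j + (j' + q) by ring] at this

variable (C) in
/-- The Hochschild differential as a linear map. -/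
def deltaL (n : ℤ) : Fam C →ₗ[k] Fam C where
  toFun := delta n
  map_add' φ ψ := by
    funext Z X s
    have : lmul n (fun W => (φ + ψ) W X) s = lmul n (fun W => φ W X) s
        + lmul n (fun W => ψ W X) s := by cases s <;> simp [lmul]
    simp only [delta, this]
    simp only [Pi.add_apply, map_add, rmul_add]
    rw [show φ Z X + ψ Z X = fun t => φ Z X t + ψ Z X t from rfl, inner_add]
    simp only [delta]
    module
  map_smul' c φ := by
    funext Z X s
    have : lmul n (fun W => (c • φ) W X) s = c • lmul n (fun W => φ W X) s := by
      cases s <;> simp [lmul]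
    simp only [delta, this, RingHom.id_apply]
    simp only [Pi.smul_apply, map_smul, rmul_smul]
    rw [show c • φ Z X = fun t => c • φ Z X t from rfl, inner_smul]
    simp only [delta]
    module

/-! The square of the differential -/

theorem sg_comp (n : ℤ) {Z Y X : C.Obj} (g : C.Mor Z Y) (f : C.Mor Y X) :
    sg k n (C.comp g f) = C.comp (sg k n g) (sg k n f) := by
  have : (C.comp.compr₂ (sg k n) : C.Mor Z Y →ₗ[k] C.Mor Y X →ₗ[k] C.Mor Z X)
      = C.comp.compl₁₂ (sg k n) (sg k n) := by
    refine ext_pc k fun i j x hx => ext_pc k fun i' j' y hy => ?_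
    simp only [LinearMap.compr₂_apply, LinearMap.compl₁₂_apply]
    rw [sg_of_mem k n hx, sg_of_mem k n hy, sg_of_mem k n (C.comp_mem hx hy), map_zsmul, map_zsmul,
      LinearMap.smul_apply, smul_smul, mul_add, Int.negOnePow_add, Units.val_mul, mul_comm]
  exact LinearMap.congr_fun (LinearMap.congr_fun this g) f

theorem dd_sg_one {Z Y : C.Obj} (g : C.Mor Z Y) : dd k (sg k 1 g) = - sg k 1 (dd k g) := by
  rw [dd_sg]; simp

theorem inner_inner {Z X : C.Obj} (s : Str C Z X) : ∀ {φ : Str C Z X → N}, IsMultilinear φ →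
    inner (inner φ) s = 0 := by
  induction s with
  | nil => intro φ _; rfl
  | @cons Z Y X g s ih =>
    intro φ h
    have hneg : ∀ (W : C.Obj) (f : C.Mor Z W) (t : Str C W X), φ (.cons (-f) t) = - φ (.cons f t) :=
      fun W f t => map_neg (h.headMap W t) f
    have hadd : ∀ (W : C.Obj) (f f' : C.Mor Z W) (t : Str C W X),
        φ (.cons (f + f') t) = φ (.cons f t) + φ (.cons f' t) :=
      fun W f f' t => map_add (h.headMap W t) f f'
    have h0 : ∀ (W : C.Obj) (t : Str C W X), φ (.cons (0 : C.Mor Z W) t) = 0 :=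
      fun W t => map_zero (h.headMap W t)
    have key : merge φ (dd k g) s + merge (inner φ) g s - inner (merge φ (sg k 1 g)) s = 0 := by
      cases s with
      | nil => simp [merge, inner]
      | @cons _ V _ f t =>
        have e1 : merge (inner φ) g (.cons f t) = inner φ (.cons (C.comp (sg k 1 g) f) t) := rfl
        have e2 : merge φ (dd k g) (.cons f t) = φ (.cons (C.comp (sg k 1 (dd k g)) f) t) := rfl
        have e3 : (fun s' => merge φ (sg k 1 g) (.cons (sg k 1 f) s')) =
            fun s' => φ (.cons (sg k 1 (C.comp (sg k 1 g) f)) s') := by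
          funext s'
          simp only [merge]
          rw [sg_comp]
        have e4 : merge φ (sg k 1 g) (.cons (dd k f) t) = φ (.cons (C.comp g (dd k f)) t) := by
          simp only [merge]
          rw [sg_one_sg_one]
        have e5 : merge (merge φ (sg k 1 g)) f t = merge φ (C.comp (sg k 1 g) f) t := by
          cases t with
          | nil => rfl
          | cons a r =>
            simp only [merge]
            rw [sg_comp, C.assoc]
        rw [e1, e2, inner_cons, inner_cons, e3, e4, e5, C.leibniz, dd_sg_one,
          sg_one_sg_one, hadd, map_neg, LinearMap.neg_apply, hneg]
        abel
    rw [inner_cons, inner_cons, dd_dd, h0]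
    have e : (fun s' => inner φ (.cons (sg k 1 g) s')) = fun s' =>
        (- φ (.cons (sg k 1 (dd k g)) s') + merge φ (sg k 1 g) s')
          - inner (fun s'' => φ (.cons g s'')) s' := by
      funext s'
      rw [inner_cons, dd_sg_one, hneg, sg_one_sg_one]
    rw [e, inner_sub, inner_add, inner_neg, ih (h.tail g)]
    refine Eq.trans ?_ key
    abel

theorem lmul_cons (n : ℤ) {Z Y X : C.Obj} (φ : ∀ W, Str C W X → C.Mor W X) (g : C.Mor Z Y)
    (s : Str C Y X) : lmul n φ (.cons g s) = C.comp (sg k n g) (φ _ s) := rfl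

/-- The terms `(-1) ^ (n (|x₁| + 1)) (d x₁) φ (x₂, …, xₚ)`. -/
def ldd (n : ℤ) {Z X : C.Obj} (φ : ∀ W, Str C W X → C.Mor W X) : Str C Z X → C.Mor Z X
  | .nil _ => 0
  | .cons g s => C.comp (sg k n (dd k g)) (φ _ s)

theorem inner_lmul (n : ℤ) {X : C.Obj} (φ : ∀ W, Str C W X → C.Mor W X) {Z : C.Obj}
    (s : Str C Z X) : inner (lmul n φ) s =
      ldd n φ s + lmul (n + 1) (fun _ => lmul n φ) s - lmul (n + 1) (fun W => inner (φ W)) s := by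
  cases s with
  | nil => simp [inner, ldd, lmul]
  | cons g s =>
    rw [inner_cons]
    simp only [lmul_cons, ldd]
    have e1 : merge (lmul n φ) g s = C.comp (sg k (n + 1) g) (lmul n φ s) := by
      cases s with
      | nil => simp [merge, lmul]
      | cons f t => simp only [merge, lmul]; rw [sg_comp, sg_sg, C.assoc]
    rw [e1, sg_sg]
    have := inner_map (C.comp (sg k (n + 1) g)).toAddMonoidHom s (φ _)
    simp only [LinearMap.toAddMonoidHom_coe] at this
    rw [this]

theorem dd_lmul (n : ℤ) {X : C.Obj} (φ : ∀ W, Str C W X → C.Mor W X) {Z : C.Obj}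
    (s : Str C Z X) : dd k (lmul n φ s) =
      lmul (n + 1) (fun W t => dd k (φ W t)) s + (n.negOnePow : ℤ) • ldd n φ s := by
  cases s with
  | nil => simp [ldd, lmul]
  | cons g s =>
    simp only [lmul, ldd]
    rw [C.leibniz, sg_sg, dd_sg, map_zsmul, LinearMap.smul_apply, add_comm n 1, add_comm]

theorem lmul_add (n : ℤ) {X : C.Obj} (φ ψ : ∀ W, Str C W X → C.Mor W X) {Z : C.Obj}
    (s : Str C Z X) : lmul n (fun W t => φ W t + ψ W t) s = lmul n φ s + lmul n ψ s := by
  cases s <;> simp [lmul]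

theorem lmul_sub (n : ℤ) {X : C.Obj} (φ ψ : ∀ W, Str C W X → C.Mor W X) {Z : C.Obj}
    (s : Str C Z X) : lmul n (fun W t => φ W t - ψ W t) s = lmul n φ s - lmul n ψ s := by
  cases s <;> simp [lmul]

theorem lmul_zsmul (n c : ℤ) {X : C.Obj} (φ : ∀ W, Str C W X → C.Mor W X) {Z : C.Obj}
    (s : Str C Z X) : lmul n (fun W t => c • φ W t) s = c • lmul n φ s := by
  cases s <;> simp [lmul]

/-- The string `(s, x)`. -/
def snoc {Z Y X : C.Obj} (s : Str C Z Y) (x : C.Mor Y X) : Str C Z X :=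
  s.append (.cons x (.nil X))

theorem snoc_cases {Z X : C.Obj} (s : Str C Z X) : ∀ {P : ∀ X, Str C Z X → Prop},
    P _ (.nil Z) → (∀ (Y X) (s : Str C Z Y) (x : C.Mor Y X), P _ (snoc s x)) → P X s := by
  induction s with
  | nil => intro P h _; exact h
  | cons g s ih =>
    intro P _ h2
    exact ih (P := fun X s => P X (.cons g s)) (h2 _ _ (.nil _) g) fun Y X s x => h2 _ _ (.cons g s) x

theorem rmul_snoc {Z Y X : C.Obj} (s : Str C Z Y) (x : C.Mor Y X) :
    ∀ {U : C.Obj} (χ : ∀ W, Str C Z W → C.Mor U W), rmul χ (snoc s x) = C.comp (χ Y s) x := by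
  induction s with
  | nil => intro U χ; rfl
  | cons g s ih =>
    intro U χ
    rw [show snoc (.cons g s) x = .cons g (snoc s x) from rfl, rmul_cons, ih]
    cases s <;> simp [snoc, Str.append, rlast]

/-- `(-1) ^ p` for a string of length `p`. -/
def lsign : {Z X : C.Obj} → Str C Z X → ℤ
  | _, _, .nil _ => 1
  | _, _, .cons _ s => - lsign s

/-- The sign operator applied to all entries. -/
def twist : {Z X : C.Obj} → Str C Z X → Str C Z X
  | _, _, .nil X => .nil X
  | _, _, .cons g s => .cons (sg k 1 g) (twist s)

theorem lsign_mul {Z X : C.Obj} (s : Str C Z X) : lsign s * lsign s = 1 := by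
  induction s with
  | nil => rfl
  | cons g s ih => simpa [lsign] using ih

theorem lsign_twist {Z X : C.Obj} (s : Str C Z X) : lsign (twist s) = lsign s := by
  induction s with
  | nil => rfl
  | cons g s ih => simpa [lsign, twist] using ih

theorem twist_twist {Z X : C.Obj} (s : Str C Z X) : twist (twist s) = s := by
  induction s with
  | nil => rfl
  | cons g s ih => simp only [twist]; rw [ih, sg_one_sg_one]

theorem inner_snoc_snoc {N₀ : Type u} [AddCommGroup N₀] {Z V Y X : C.Obj} (s : Str C Z V) (y : C.Mor V Y) (x : C.Mor Y X) :
    ∀ φ : Str C Z X → N₀, inner φ (snoc (snoc s y) x) =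
      inner (fun s' => φ (snoc s' x)) (snoc s y) +
        lsign (snoc s y) • φ (snoc (twist (snoc s y)) (dd k x)) +
        lsign s • φ (snoc (twist s) (C.comp (sg k 1 y) x)) := by
  induction s with
  | nil =>
    intro φ
    simp [snoc, Str.append, inner, merge, lsign, twist]
    abel
  | cons g s ih =>
    intro φ
    rw [show snoc (snoc (.cons g s) y) x = .cons g (snoc (snoc s y) x) from rfl,
      show snoc (.cons g s) y = .cons g (snoc s y) from rfl, inner_cons, inner_cons, ih]
    have e : merge (fun s' => φ (snoc s' x)) g (snoc s y) = merge φ g (snoc (snoc s y) x) := by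
      cases s <;> rfl
    rw [e]
    simp only [lsign, twist, neg_smul]
    simp only [snoc, Str.append]
    abel

theorem sg_cochain {M : Type u} [AddCommGroup M] [Module k M] [BigradedComplex k M] {Z X : C.Obj}
    (s : Str C Z X) : ∀ {n j : ℤ} {φ : Str C Z X → M}, IsMultilinear φ →
      (∀ {t : Str C Z X} {p q : ℤ}, t.HasDeg p q → φ t ∈ pc k M (n + p) (j + q)) →
      sg k 1 (φ s) = ((n.negOnePow : ℤ) * lsign s) • φ (twist s) := by
  induction s with
  | nil =>
    intro n j φ _ h
    rw [sg_of_mem k 1 (h (Str.HasDeg.nil _))]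
    simp [lsign, twist]
  | @cons Z Y X g s ih =>
    intro n j φ hm h
    have : sg k 1 ∘ₗ hm.headMap Y s =
        ((n.negOnePow : ℤ) * lsign (.cons g s)) • (hm.headMap Y (twist s) ∘ₗ sg k 1) := by
      refine ext_pc k fun i j' g' hg => ?_
      have h1 := @ih (n + (i - 1)) (j + j') (fun t => φ (.cons g' t)) (hm.tail g') (by
        intro t p q ht
        have := h (Str.HasDeg.cons hg ht)
        rwa [show n + (i - 1 + p) = n + (i - 1) + p by ring,
          show j + (j' + q) = j + j' + q by ring] at this)
      simp only [LinearMap.comp_apply, LinearMap.smul_apply]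
      rw [sg_of_mem k 1 hg, map_zsmul, smul_smul]
      refine Eq.trans h1 ?_
      rw [show hm.headMap Y (twist s) g' = φ (.cons g' (twist s)) from rfl]
      congr 1
      simp [Int.negOnePow_add, Int.negOnePow_sub, lsign]
      ring
    exact LinearMap.congr_fun this g

theorem negOnePow_mul_self (n : ℤ) : (n.negOnePow : ℤ) * n.negOnePow = 1 := by
  rw [← Units.val_mul, ← Int.negOnePow_add, Int.negOnePow_even _ ⟨n, rfl⟩]; rfl

/-- The terms of the square of the differential that involve the right boundary term cancel. -/
theorem right_terms {n j : ℤ} {φ : Fam C} (h : φ ∈ Hoch C n j) {Z X : C.Obj} (s : Str C Z X) :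
    dd k (rmul (fun W t => sg k 1 (φ Z W t)) s) + rmul (fun W t => sg k 1 (dd k (φ Z W t))) s +
      rmul (fun W t => sg k 1 (rmul (fun W t => sg k 1 (φ Z W t)) t)) s +
      (n.negOnePow : ℤ) • (rmul (fun W t => sg k 1 (inner (φ Z W) t)) s -
        inner (rmul fun W t => sg k 1 (φ Z W t)) s) = 0 := by
  obtain ⟨h1, h2⟩ := h
  have hs : ∀ {Y : C.Obj} (t : Str C Z Y),
      lsign t • sg k 1 (φ Z Y (twist t)) = (n.negOnePow : ℤ) • φ Z Y t := by
    intro Y t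
    rw [sg_cochain (twist t) (h1 Z Y) h2, twist_twist, lsign_twist, smul_smul]
    congr 1
    rw [mul_comm, mul_assoc, lsign_mul, mul_one]
  have hlast : ∀ {Y X : C.Obj} (t : Str C Z Y) (x : C.Mor Y X),
      lsign t • C.comp (sg k 1 (φ Z Y (twist t))) x = (n.negOnePow : ℤ) • C.comp (φ Z Y t) x := by
    intro Y X t x
    rw [← LinearMap.smul_apply, ← map_zsmul, hs, map_zsmul, LinearMap.smul_apply]
  have hin : ∀ {Y X : C.Obj} (t : Str C Z Y) (x : C.Mor Y X),
      inner (fun t => C.comp (sg k 1 (φ Z Y t)) x) t = C.comp (sg k 1 (inner (φ Z Y) t)) x :=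
    fun {Y X} t x => inner_map (((C.comp.flip x) ∘ₗ sg k 1).toAddMonoidHom) t (φ Z Y)
  refine snoc_cases s (P := fun _ s => dd k (rmul (fun W t => sg k 1 (φ Z W t)) s) +
      rmul (fun W t => sg k 1 (dd k (φ Z W t))) s +
      rmul (fun W t => sg k 1 (rmul (fun W t => sg k 1 (φ Z W t)) t)) s +
      (n.negOnePow : ℤ) • (rmul (fun W t => sg k 1 (inner (φ Z W) t)) s -
        inner (rmul fun W t => sg k 1 (φ Z W t)) s) = 0) (by simp [rmul, inner]) ?_
  intro Y X s x
  simp only [rmul_snoc]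
  rw [C.leibniz, dd_sg_one, sg_one_sg_one, map_neg, LinearMap.neg_apply]
  refine snoc_cases s (P := fun Y s => ∀ x : C.Mor Y X, -C.comp (sg k 1 (dd k (φ Z Y s))) x +
      C.comp (φ Z Y s) (dd k x) + C.comp (sg k 1 (dd k (φ Z Y s))) x +
      C.comp (sg k 1 (rmul (fun W t => sg k 1 (φ Z W t)) s)) x +
      (n.negOnePow : ℤ) • (C.comp (sg k 1 (inner (φ Z Y) s)) x -
        inner (rmul fun W t => sg k 1 (φ Z W t)) (snoc s x)) = 0) ?_ ?_ x
  · intro x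
    have e0 : inner (rmul fun W t => sg k 1 (φ Z W t)) (snoc (.nil Z) x) =
        C.comp (sg k 1 (φ Z Z (.nil Z))) (dd k x) := by
      simp [snoc, Str.append, inner, merge, rmul]
    have e1 := hlast (.nil Z) (dd k x)
    simp only [lsign, twist, one_smul] at e1
    rw [e0, e1, smul_sub, smul_smul, negOnePow_mul_self]
    simp [inner, rmul]
  · intro V Y s y x
    rw [inner_snoc_snoc]
    simp only [rmul_snoc]
    rw [hlast, hlast, hin, sg_comp, sg_one_sg_one, C.assoc, smul_sub, smul_add, smul_add, smul_smul,
      smul_smul, negOnePow_mul_self]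
    module

theorem rmul_sub {U Z X : C.Obj} (s : Str C Z X) (χ ψ : ∀ W, Str C Z W → C.Mor U W) :
    rmul (fun W t => χ W t - ψ W t) s = rmul χ s - rmul ψ s := by
  have := rmul_add s χ fun W t => (-1 : k) • ψ W t
  rw [rmul_smul] at this
  simpa [sub_eq_add_neg] using this

theorem rmul_zsmul {U Z X : C.Obj} (s : Str C Z X) (c : ℤ) (χ : ∀ W, Str C Z W → C.Mor U W) :
    rmul (fun W t => c • χ W t) s = c • rmul χ s := by
  have := rmul_smul s (c : k) χ
  simpa [Int.cast_smul_eq_zsmul] using this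

theorem rmul_lmul (n : ℤ) {φ : Fam C} {Z X : C.Obj} (s : Str C Z X) :
    rmul (fun W t => sg k 1 (lmul n (fun V => φ V W) t)) s =
      lmul (n + 1) (fun W t => rmul (fun V t => sg k 1 (φ W V t)) t) s := by
  refine snoc_cases s (P := fun X s => rmul (fun W t => sg k 1 (lmul n (fun V => φ V W) t)) s =
      lmul (n + 1) (fun W t => rmul (fun V t => sg k 1 (φ W V t)) t) s) rfl ?_
  intro Y X s x
  rw [rmul_snoc]
  cases s with
  | nil => simp [lmul, snoc, Str.append, rmul]
  | cons g s =>
    rw [show snoc (.cons g s) x = .cons g (snoc s x) from rfl, lmul_cons, lmul_cons, rmul_snoc,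
      sg_comp, sg_sg, C.assoc, add_comm 1 n]

theorem delta_delta {n j : ℤ} {φ : Fam C} (h : φ ∈ Hoch C n j) :
    delta (n + 1) (delta n φ) = 0 := by
  funext Z X s
  have hr := right_terms h s
  have hi := inner_inner s (h.1 Z X)
  have hil := inner_lmul n (fun W => φ W X) s
  have hdl := dd_lmul n (fun W => φ W X) s
  have hrl := rmul_lmul n (φ := φ) s
  have hdi := inner_map (dd k).toAddMonoidHom s (φ Z X)
  simp only [LinearMap.toAddMonoidHom_coe] at hdi
  have hii : inner (delta n φ Z X) s = inner (fun t => dd k (φ Z X t)) s +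
      inner (rmul fun W t => sg k 1 (φ Z W t)) s +
      (n.negOnePow : ℤ) • (inner (inner (φ Z X)) s - inner (lmul n fun W => φ W X) s) := by
    rw [← inner_sub, ← inner_zsmul, ← inner_add, ← inner_add]
    rfl
  have hll : lmul (n + 1) (fun W => delta n φ W X) s = lmul (n + 1) (fun W t => dd k (φ W X t)) s +
      lmul (n + 1) (fun W t => rmul (fun V t => sg k 1 (φ W V t)) t) s +
      (n.negOnePow : ℤ) • (lmul (n + 1) (fun W => inner (φ W X)) s -
        lmul (n + 1) (fun _ => lmul n fun W => φ W X) s) := by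
    rw [← lmul_sub, ← lmul_zsmul, ← lmul_add, ← lmul_add]
    rfl
  have hrr : rmul (fun W t => sg k 1 (delta n φ Z W t)) s =
      rmul (fun W t => sg k 1 (dd k (φ Z W t))) s +
      rmul (fun W t => sg k 1 (rmul (fun W t => sg k 1 (φ Z W t)) t)) s +
      (n.negOnePow : ℤ) • (rmul (fun W t => sg k 1 (inner (φ Z W) t)) s -
        rmul (fun W t => sg k 1 (lmul n (fun V => φ V W) t)) s) := by
    rw [← rmul_sub, ← rmul_zsmul, ← rmul_add, ← rmul_add]
    simp only [delta, map_add, map_sub, map_zsmul]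
  have hsign : (((n + 1).negOnePow : ℤˣ) : ℤ) = - (n.negOnePow : ℤ) := by
    rw [Int.negOnePow_succ]; rfl
  rw [delta, hrr, hii, hll, hsign, hi, hil, hrl, hdi]
  simp only [delta, map_add, map_zsmul, map_sub, dd_dd, hdl]
  have hsq := negOnePow_mul_self n
  set e : ℤ := (n.negOnePow : ℤ)
  refine Eq.trans ?_ hr
  clear_value e
  rcases mul_self_eq_one_iff.mp hsq with he | he <;> rw [he] <;> module

end Lemmas

end Hochschild

/-! ### Complexes of vector spaces -/

section Subcomplexes

variable {k : Type u} [Field k]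

/-- The complex with terms `F n ⊆ V` and differential `F n → F (n + 1)` induced by `δ n`. -/
def subCx {V : Type u} [AddCommGroup V] [Module k V] (F : ℤ → Submodule k V) (δ : ℤ → V →ₗ[k] V)
    (hF : ∀ n, ∀ x ∈ F n, δ n x ∈ F (n + 1)) (hδ : ∀ n, ∀ x ∈ F n, δ (n + 1) (δ n x) = 0) :
    CochainComplex (ModuleCat.{u} k) ℤ :=
  CochainComplex.of (fun n => ModuleCat.of k (F n))
    (fun n => ModuleCat.ofHom ((δ n).restrict (hF n)))
    (fun n => by
      refine ModuleCat.hom_ext (LinearMap.ext fun x => ?_)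
      exact Subtype.ext (hδ n x x.2))

/-- The chain map induced by linear maps `f n : V → V'` that map `F n` to `F' n` and commute with
the differentials. -/
def subCxMap {V V' : Type u} [AddCommGroup V] [Module k V] [AddCommGroup V'] [Module k V']
    {F : ℤ → Submodule k V} {δ : ℤ → V →ₗ[k] V}
    {hF : ∀ n, ∀ x ∈ F n, δ n x ∈ F (n + 1)} {hδ : ∀ n, ∀ x ∈ F n, δ (n + 1) (δ n x) = 0}
    {F' : ℤ → Submodule k V'} {δ' : ℤ → V' →ₗ[k] V'}
    {hF' : ∀ n, ∀ x ∈ F' n, δ' n x ∈ F' (n + 1)} {hδ' : ∀ n, ∀ x ∈ F' n, δ' (n + 1) (δ' n x) = 0}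
    (f : ℤ → V →ₗ[k] V') (hf : ∀ n, ∀ x ∈ F n, f n x ∈ F' n)
    (hc : ∀ n, ∀ x ∈ F n, δ' n (f n x) = f (n + 1) (δ n x)) :
    subCx F δ hF hδ ⟶ subCx F' δ' hF' hδ' :=
  CochainComplex.ofHom (X := subCx F δ hF hδ) (Y := subCx F' δ' hF' hδ')
    (fun n => ModuleCat.ofHom ((f n).restrict (hf n)))
    (fun n => by
      simp only [subCx, CochainComplex.of_d]
      refine ModuleCat.hom_ext (LinearMap.ext fun x => ?_)
      exact Subtype.ext (hc n x x.2))

end Subcomplexes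

section HochschildComplex

variable {k : Type u} [Field k]

/-- The graded Hochschild complex: in cohomological degree `n` it is the direct sum over the inner
degrees `j` of the spaces of cochains of bidegree `(n, j)`. -/
def HochGr (C : BigradedDGCategory k) : CochainComplex (ModuleCat.{u} k) ℤ :=
  CochainComplex.of (fun n => ModuleCat.of k (DirectSum ℤ fun j => Hoch C n j))
    (fun n => ModuleCat.ofHom
      (DirectSum.lmap fun j => (deltaL C n).restrict fun _ h => delta_mem (j := j) h))
    (fun n => by
      refine ModuleCat.hom_ext (DirectSum.linearMap_ext _ fun j => ?_)
      ext φ : 1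
      simp only [ModuleCat.hom_comp, ModuleCat.hom_ofHom, LinearMap.comp_apply, DirectSum.lmap_lof]
      rw [show ((deltaL C (n + 1)).restrict fun _ h => delta_mem (j := j) h)
          (((deltaL C n).restrict fun _ h => delta_mem (j := j) h) φ) = 0 from
        Subtype.ext (delta_delta φ.2)]
      simp)

/-- A functor of bigraded dg categories that is an isomorphism of bigraded complexes on all
morphism complexes (a strictly fully faithful functor). -/
structure FullFunctor (C D : BigradedDGCategory k) where
  obj : C.Obj → D.Obj
  map : ∀ Y X, C.Mor Y X ≃ₗ[k] D.Mor (obj Y) (obj X)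
  map_one : ∀ X, map X X (C.one X) = D.one (obj X)
  map_comp : ∀ {Z Y X} (g : C.Mor Z Y) (f : C.Mor Y X),
    map Z X (C.comp g f) = D.comp (map Z Y g) (map Y X f)
  map_d : ∀ {Y X} (f : C.Mor Y X), map Y X (dd k f) = dd k (map Y X f)
  map_mem : ∀ {Y X} {i j : ℤ} {f : C.Mor Y X},
    map Y X f ∈ pc k (D.Mor (obj Y) (obj X)) i j ↔ f ∈ pc k (C.Mor Y X) i j

namespace FullFunctor

variable {C D : BigradedDGCategory k} (F : FullFunctor C D)

/-- The image of a composable string. -/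
def str : {Z X : C.Obj} → Str C Z X → Str D (F.obj Z) (F.obj X)
  | _, _, .nil X => .nil (F.obj X)
  | _, _, .cons g s => .cons (F.map _ _ g) (str s)

/-- The restriction of a family of functions on strings. -/
def pull : Fam D →ₗ[k] Fam C where
  toFun φ := fun Z X s => (F.map Z X).symm (φ _ _ (F.str s))
  map_add' φ ψ := by funext Z X s; simp
  map_smul' c φ := by funext Z X s; simp

theorem map_sg (n : ℤ) {Y X : C.Obj} (f : C.Mor Y X) :
    F.map Y X (sg k n f) = sg k n (F.map Y X f) := by
  have : (F.map Y X).toLinearMap ∘ₗ sg k n = sg k n ∘ₗ (F.map Y X).toLinearMap := by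
    refine ext_pc k fun i j x h => ?_
    simp only [LinearMap.comp_apply, LinearEquiv.coe_coe]
    rw [sg_of_mem k n h, sg_of_mem k n (F.map_mem.2 h), map_zsmul]
  exact LinearMap.congr_fun this f

theorem str_append {Z Y X : C.Obj} (s : Str C Z Y) (t : Str C Y X) :
    F.str (s.append t) = (F.str s).append (F.str t) := by
  induction s with
  | nil => rfl
  | cons g s ih => simp only [Str.append, str]; rw [ih]

theorem str_hasDeg {Z X : C.Obj} {s : Str C Z X} {p q : ℤ} (h : s.HasDeg p q) :
    (F.str s).HasDeg p q := by
  induction h with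
  | nil => exact .nil _
  | cons hg _ ih => exact .cons (F.map_mem.2 hg) ih

theorem pull_mem {n j : ℤ} {φ : Fam D} (h : φ ∈ Hoch D n j) : F.pull φ ∈ Hoch C n j := by
  refine ⟨fun Z X Y W s t c g g' => ?_, fun {Z X s p q} hs => ?_⟩
  · simp only [pull, LinearMap.coe_mk, AddHom.coe_mk, str_append, str, map_add, map_smul]
    rw [h.1 _ _ _ _ (F.str s) (F.str t), map_add, map_smul]
  · rw [← F.map_mem]
    simpa [pull] using h.2 (F.str_hasDeg hs)

theorem merge_str {N : Type u} [AddCommGroup N] {Z Y X : C.Obj}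
    (φ : Str D (F.obj Z) (F.obj X) → N) (g : C.Mor Z Y) (s : Str C Y X) :
    merge φ (F.map Z Y g) (F.str s) = merge (fun t => φ (F.str t)) g s := by
  cases s with
  | nil => rfl
  | cons f t => simp only [merge, str]; rw [F.map_comp, map_sg]

theorem inner_str {N : Type u} [AddCommGroup N] {Z X : C.Obj} (s : Str C Z X) :
    ∀ φ : Str D (F.obj Z) (F.obj X) → N, inner φ (F.str s) = inner (fun t => φ (F.str t)) s := by
  induction s with
  | nil => intro φ; rfl
  | cons g s ih =>
    intro φ
    simp only [str]
    rw [inner_cons, inner_cons, merge_str, ih]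
    simp only [str, map_sg, map_d]

theorem rmul_str {Z X : C.Obj} (s : Str C Z X) : ∀ {U : C.Obj}
    (χ : ∀ W, Str D (F.obj Z) W → D.Mor (F.obj U) W),
    rmul χ (F.str s) = F.map U X (rmul (fun W t => (F.map U W).symm (χ _ (F.str t))) s) := by
  induction s with
  | nil => intro U χ; simp [str, rmul]
  | cons g s ih =>
    intro U χ
    simp only [str]
    rw [rmul_cons, rmul_cons, ih, map_add]
    simp only [str]
    congr 1
    cases s with
    | nil => simp only [rlast, str]; rw [F.map_comp, LinearEquiv.apply_symm_apply]
    | cons => simp [rlast, str]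

theorem pull_delta (n : ℤ) (φ : Fam D) : F.pull (delta n φ) = delta n (F.pull φ) := by
  funext Z X s
  rw [← (F.map Z X).injective.eq_iff]
  have h1 : F.map Z X (lmul n (fun W => F.pull φ W X) s) =
      lmul n (fun W => φ W (F.obj X)) (F.str s) := by
    cases s with
    | nil => simp [lmul, str]
    | cons g s => simp [lmul, str, F.map_comp, map_sg, pull]
  have h2 : F.map Z X (inner (F.pull φ Z X) s) = inner (φ _ _) (F.str s) := by
    rw [inner_str]
    exact (inner_map (F.map Z X).toAddMonoidHom s _).symm.trans (by simp [pull])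
  have h3 : (fun W t => sg k 1 (F.pull φ Z W t)) =
      fun W t => (F.map Z W).symm (sg k 1 (φ _ _ (F.str t))) := by
    funext W t
    rw [LinearEquiv.eq_symm_apply, map_sg]
    simp [pull]
  simp only [delta, map_add, map_zsmul, map_sub, h1, h2, F.map_d]
  rw [h3, ← rmul_str F s fun W t => sg k 1 (φ _ _ t)]
  simp [pull, delta]

/-- The projection of graded Hochschild complexes given by restricting cochains to strings of
morphisms in the full subcategory. -/
def proj : HochGr D ⟶ HochGr C :=
  CochainComplex.ofHom (X := HochGr D) (Y := HochGr C)
    (fun n => ModuleCat.ofHom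
      (DirectSum.lmap fun j => F.pull.restrict fun _ h => F.pull_mem (n := n) (j := j) h))
    (fun n => by
      simp only [HochGr, CochainComplex.of_d]
      refine ModuleCat.hom_ext (DirectSum.linearMap_ext _ fun j => ?_)
      ext φ : 1
      simp only [ModuleCat.hom_comp, ModuleCat.hom_ofHom, LinearMap.comp_apply, DirectSum.lmap_lof]
      congr 1
      exact Subtype.ext (F.pull_delta n φ).symm)

end FullFunctor

end HochschildComplex

/-! ### Bigraded dg algebras, dg bimodules and derived homs -/

/-- A bigraded dg algebra over `k` (associative and unital). A bigraded algebra without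
differential is the case `d = 0`. -/
structure BigradedDGAlgebra (k : Type u) [Field k] where
  carrier : Type u
  [ring : Ring carrier]
  [algebra : Algebra k carrier]
  [cx : BigradedComplex k carrier]
  one_mem : (1 : carrier) ∈ pc k carrier 0 0
  mul_mem : ∀ {i j i' j' : ℤ} {x y : carrier}, x ∈ pc k carrier i j → y ∈ pc k carrier i' j' →
    x * y ∈ pc k carrier (i + i') (j + j')
  leibniz : ∀ x y : carrier, dd k (x * y) = dd k x * y + sg k 1 x * dd k y

attribute [instance] BigradedDGAlgebra.ring BigradedDGAlgebra.algebra BigradedDGAlgebra.cx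

/-- A bigraded dg `B`-`A`-bimodule: `B` acts from the left and `A` from the right. -/
structure BigradedDGBimodule {k : Type u} [Field k] (B A : BigradedDGAlgebra k) where
  carrier : Type u
  [acg : AddCommGroup carrier]
  [mod : Module k carrier]
  [cx : BigradedComplex k carrier]
  lact : B.carrier →ₗ[k] carrier →ₗ[k] carrier
  ract : carrier →ₗ[k] A.carrier →ₗ[k] carrier
  one_lact : ∀ x, lact 1 x = x
  mul_lact : ∀ b b' x, lact (b * b') x = lact b (lact b' x)
  ract_one : ∀ x, ract x 1 = x
  ract_mul : ∀ x a a', ract x (a * a') = ract (ract x a) a'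
  lact_ract : ∀ b x a, ract (lact b x) a = lact b (ract x a)
  lact_mem : ∀ {i j i' j' : ℤ} {b : B.carrier} {x : carrier}, b ∈ pc k B.carrier i j →
    x ∈ pc k carrier i' j' → lact b x ∈ pc k carrier (i + i') (j + j')
  ract_mem : ∀ {i j i' j' : ℤ} {x : carrier} {a : A.carrier}, x ∈ pc k carrier i j →
    a ∈ pc k A.carrier i' j' → ract x a ∈ pc k carrier (i + i') (j + j')
  leibniz_lact : ∀ b x, dd k (lact b x) = lact (dd k b) x + lact (sg k 1 b) (dd k x)
  leibniz_ract : ∀ x a, dd k (ract x a) = ract (dd k x) a + ract (sg k 1 x) (dd k a)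

attribute [instance] BigradedDGBimodule.acg BigradedDGBimodule.mod BigradedDGBimodule.cx

section Ground

variable (k : Type u) [Field k]

/-- The ground field in bidegree `(0, 0)`. -/
@[reducible] def groundCx : BigradedComplex k k where
  piece i j := if i = 0 ∧ j = 0 then ⊤ else ⊥
  internal := by
    classical
    rw [DirectSum.isInternal_submodule_iff_iSupIndep_and_iSup_eq_top]
    constructor
    · intro e
      by_cases he : e.1 = 0 ∧ e.2 = 0
      · have : (⨆ (e' : ℤ × ℤ) (_ : e' ≠ e),
            (if e'.1 = 0 ∧ e'.2 = 0 then ⊤ else ⊥ : Submodule k k)) = ⊥ := by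
          refine iSup₂_eq_bot.2 fun e' h => if_neg fun h' => h ?_
          exact Prod.ext (h'.1.trans he.1.symm) (h'.2.trans he.2.symm)
        rw [this]
        exact disjoint_bot_right
      · simp only [if_neg he]
        exact disjoint_bot_left
    · refine top_le_iff.1 (le_trans ?_ (le_iSup _ ((0, 0) : ℤ × ℤ)))
      simp
  d := 0
  d_mem _ := zero_mem _
  d_d _ := rfl

/-- The ground field as a bigraded dg algebra. -/
def ground : BigradedDGAlgebra k where
  carrier := k
  cx := groundCx k
  one_mem := by
    let := groundCx k
    change (1 : k) ∈ (if (0 : ℤ) = 0 ∧ (0 : ℤ) = 0 then ⊤ else ⊥ : Submodule k k)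
    simp
  mul_mem := by
    let := groundCx k
    intro i j i' j' x y hx hy
    change x ∈ (if i = 0 ∧ j = 0 then ⊤ else ⊥ : Submodule k k) at hx
    change y ∈ (if i' = 0 ∧ j' = 0 then ⊤ else ⊥ : Submodule k k) at hy
    change x * y ∈ (if i + i' = 0 ∧ j + j' = 0 then ⊤ else ⊥ : Submodule k k)
    split_ifs at hx hy with h1 h2
    · simp [h1, h2]
    all_goals simp_all
  leibniz x y := by
    let := groundCx k
    change (0 : k) = 0 * y + _ * 0
    simp

theorem ground_mem {i j : ℤ} {c : (ground k).carrier} (h : c ∈ pc k (ground k).carrier i j) :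
    (i = 0 ∧ j = 0) ∨ c = 0 := by
  change c ∈ (if i = 0 ∧ j = 0 then ⊤ else ⊥ : Submodule k k) at h
  split_ifs at h with h1
  · exact .inl h1
  · exact .inr h

variable {k} in
/-- The identification of `ground k` with `k`. -/
def scalar : (ground k).carrier →ₗ[k] k := LinearMap.id (M := k)

theorem scalar_one : scalar (1 : (ground k).carrier) = (1 : k) := rfl

theorem scalar_mul (b c : (ground k).carrier) : scalar (b * c) = scalar b * scalar c := rfl

theorem ground_dd (c : (ground k).carrier) : dd k c = 0 := rfl

theorem ground_sg (n : ℤ) (c : (ground k).carrier) : sg k n c = c := by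
  have : sg k n = (LinearMap.id : (ground k).carrier →ₗ[k] (ground k).carrier) := by
    refine ext_pc k fun i j x h => ?_
    rw [sg_of_mem k n h]
    rcases ground_mem k h with ⟨rfl, -⟩ | rfl
    · simp
    · simp
  exact LinearMap.congr_fun this c

end Ground

section Modules

variable {k : Type u} [Field k] {A B : BigradedDGAlgebra k}

theorem sg_lact (M : BigradedDGBimodule B A) (n : ℤ) (b : B.carrier) (x : M.carrier) :
    sg k n (M.lact b x) = M.lact (sg k n b) (sg k n x) := by
  have : M.lact.compr₂ (sg k n) = M.lact.compl₁₂ (sg k n) (sg k n) := by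
    refine ext_pc k fun i j x hx => ext_pc k fun i' j' y hy => ?_
    simp only [LinearMap.compr₂_apply, LinearMap.compl₁₂_apply]
    rw [sg_of_mem k n hx, sg_of_mem k n hy, sg_of_mem k n (M.lact_mem hx hy), map_zsmul, map_zsmul,
      LinearMap.smul_apply, smul_smul, mul_add, Int.negOnePow_add, Units.val_mul, mul_comm]
  exact LinearMap.congr_fun (LinearMap.congr_fun this b) x

theorem sg_ract (M : BigradedDGBimodule B A) (n : ℤ) (x : M.carrier) (a : A.carrier) :
    sg k n (M.ract x a) = M.ract (sg k n x) (sg k n a) := by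
  have : M.ract.compr₂ (sg k n) = M.ract.compl₁₂ (sg k n) (sg k n) := by
    refine ext_pc k fun i j x hx => ext_pc k fun i' j' y hy => ?_
    simp only [LinearMap.compr₂_apply, LinearMap.compl₁₂_apply]
    rw [sg_of_mem k n hx, sg_of_mem k n hy, sg_of_mem k n (M.ract_mem hx hy), map_zsmul, map_zsmul,
      LinearMap.smul_apply, smul_smul, mul_add, Int.negOnePow_add, Units.val_mul, mul_comm]
  exact LinearMap.congr_fun (LinearMap.congr_fun this x) a

/-- The underlying right dg module of a bimodule. Right dg `A`-modules are `k`-`A`-bimodules. -/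
abbrev BigradedDGBimodule.toRight (M : BigradedDGBimodule B A) :
    BigradedDGBimodule (ground k) A where
  carrier := M.carrier
  lact := LinearMap.lsmul k M.carrier ∘ₗ scalar
  ract := M.ract
  one_lact x := by simp [scalar_one]
  mul_lact b b' x := by
    simp [scalar_mul, mul_smul, smul_comm (scalar b) (scalar b')]
  ract_one := M.ract_one
  ract_mul := M.ract_mul
  lact_ract b x a := by simp
  lact_mem := by
    intro i j i' j' b x hb hx
    rcases ground_mem k hb with ⟨rfl, rfl⟩ | rfl
    · rw [zero_add, zero_add]
      exact Submodule.smul_mem _ (scalar b) hx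
    · simp
  ract_mem := M.ract_mem
  leibniz_lact b x := by simp [ground_dd, ground_sg]
  leibniz_ract := M.leibniz_ract

/-- The underlying left dg module of a bimodule. Left dg `B`-modules are `B`-`k`-bimodules. -/
abbrev BigradedDGBimodule.toLeft (M : BigradedDGBimodule B A) :
    BigradedDGBimodule B (ground k) where
  carrier := M.carrier
  lact := M.lact
  ract := (LinearMap.lsmul k M.carrier ∘ₗ scalar).flip
  one_lact := M.one_lact
  mul_lact := M.mul_lact
  ract_one x := by simp [scalar_one]
  ract_mul x a a' := by simp [scalar_mul, mul_smul, smul_comm (scalar a) (scalar a')]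
  lact_ract b x a := by simp
  lact_mem := M.lact_mem
  ract_mem := by
    intro i j i' j' x a hx ha
    rcases ground_mem k ha with ⟨rfl, rfl⟩ | rfl
    · rw [add_zero, add_zero]
      exact Submodule.smul_mem _ (scalar a) hx
    · simp
  leibniz_lact := M.leibniz_lact
  leibniz_ract x a := by simp [ground_dd]

/-- The component of inner degree `j` of a bigraded complex. -/
def strand (k : Type u) [Field k] (M : Type u) [AddCommGroup M] [Module k M] [BigradedComplex k M]
    (j : ℤ) : CochainComplex (ModuleCat.{u} k) ℤ :=
  subCx (fun n => pc k M n j) (fun _ => dd k) (fun _ _ h => dd_mem k h) (fun _ x _ => dd_dd k x)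

/-- Bihomogeneous homs of bidegree `(n, j)` of bigraded bimodules: linear maps `f` of bidegree
`(n, j)` with `f (x a) = f (x) a` and `f (b x) = (-1) ^ (n |b|) b f (x)`. -/
def homs (M N : BigradedDGBimodule B A) (n j : ℤ) : Submodule k (M.carrier →ₗ[k] N.carrier) where
  carrier := {f |
    (∀ {p q : ℤ} {x : M.carrier}, x ∈ pc k M.carrier p q → f x ∈ pc k N.carrier (n + p) (j + q)) ∧
    (∀ x a, f (M.ract x a) = N.ract (f x) a) ∧ ∀ b x, f (M.lact b x) = N.lact (sg k n b) (f x)}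
  add_mem' := by
    rintro f g ⟨h1, h2, h3⟩ ⟨h1', h2', h3'⟩
    exact ⟨fun h => add_mem (h1 h) (h1' h), fun x a => by simp [h2, h2'],
      fun b x => by simp [h3, h3']⟩
  zero_mem' := ⟨fun h => zero_mem _, fun x a => by simp, fun b x => by simp⟩
  smul_mem' := by
    rintro c f ⟨h1, h2, h3⟩
    exact ⟨fun h => Submodule.smul_mem _ _ (h1 h), fun x a => by simp [h2], fun b x => by simp [h3]⟩

/-- The differential `f ↦ d f - (-1) ^ n f d` on homs of cohomological degree `n`. -/
def homD (M N : Type u) [AddCommGroup M] [Module k M] [BigradedComplex k M]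
    [AddCommGroup N] [Module k N] [BigradedComplex k N] (n : ℤ) : (M →ₗ[k] N) →ₗ[k] (M →ₗ[k] N) :=
  LinearMap.llcomp k M N N (dd k) - (n.negOnePow : ℤ) • LinearMap.lcomp k N (dd k)

theorem homD_apply {M N : Type u} [AddCommGroup M] [Module k M] [BigradedComplex k M]
    [AddCommGroup N] [Module k N] [BigradedComplex k N] (n : ℤ) (f : M →ₗ[k] N) (x : M) :
    homD M N n f x = dd k (f x) - (n.negOnePow : ℤ) • f (dd k x) := rfl

theorem homD_homD {M N : Type u} [AddCommGroup M] [Module k M] [BigradedComplex k M]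
    [AddCommGroup N] [Module k N] [BigradedComplex k N] (n : ℤ) (f : M →ₗ[k] N) :
    homD M N (n + 1) (homD M N n f) = 0 := by
  ext x
  simp only [homD_apply, map_sub, map_zsmul, dd_dd, map_zero, Int.negOnePow_succ, Units.val_neg]
  simp

theorem homD_mem {M N : BigradedDGBimodule B A} {n j : ℤ} {f : M.carrier →ₗ[k] N.carrier}
    (h : f ∈ homs M N n j) : homD M.carrier N.carrier n f ∈ homs M N (n + 1) j := by
  obtain ⟨h1, h2, h3⟩ := h
  have hsg : ∀ x, sg k 1 (f x) = (n.negOnePow : ℤ) • f (sg k 1 x) := by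
    have : sg k 1 ∘ₗ f = (n.negOnePow : ℤ) • (f ∘ₗ sg k 1) := by
      refine ext_pc k fun p q x hx => ?_
      simp only [LinearMap.comp_apply, LinearMap.smul_apply]
      rw [sg_of_mem k 1 (h1 hx), sg_of_mem k 1 hx, map_zsmul, smul_smul, one_mul, one_mul,
        Int.negOnePow_add, Units.val_mul]
    exact LinearMap.congr_fun this
  refine ⟨fun {p q x} hx => ?_, fun x a => ?_, fun b x => ?_⟩
  · rw [homD_apply]
    refine sub_mem ?_ (zsmul_mem ?_ _)
    · have := dd_mem k (h1 hx)
      rwa [show n + p + 1 = n + 1 + p by ring] at this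
    · have := h1 (dd_mem k hx)
      rwa [show n + (p + 1) = n + 1 + p by ring] at this
  · simp only [homD_apply]
    rw [h2, N.leibniz_ract, M.leibniz_ract, map_add, h2, h2, hsg, map_zsmul, map_sub, map_zsmul]
    simp only [LinearMap.sub_apply, LinearMap.smul_apply]
    module
  · simp only [homD_apply]
    rw [h3, N.leibniz_lact, M.leibniz_lact, map_add, h3, h3, dd_sg, sg_sg, sg_sg, map_zsmul,
      map_sub, map_zsmul, add_comm 1 n]
    simp only [LinearMap.smul_apply]
    module

/-- The complex of homs of inner degree `j`. -/
def homCx (M N : BigradedDGBimodule B A) (j : ℤ) : CochainComplex (ModuleCat.{u} k) ℤ :=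
  subCx (fun n => homs M N n j) (fun n => homD M.carrier N.carrier n)
    (fun _ _ h => homD_mem h) (fun n f _ => homD_homD n f)

/-- Morphisms of bigraded dg bimodules. -/
structure BimoduleHom (M N : BigradedDGBimodule B A) where
  toLin : M.carrier →ₗ[k] N.carrier
  map_mem : ∀ {i j : ℤ} {x : M.carrier}, x ∈ pc k M.carrier i j → toLin x ∈ pc k N.carrier i j
  map_d : ∀ x, toLin (dd k x) = dd k (toLin x)
  map_lact : ∀ b x, toLin (M.lact b x) = N.lact b (toLin x)
  map_ract : ∀ x a, toLin (M.ract x a) = N.ract (toLin x) a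

/-- The component of inner degree `j` of a morphism. -/
def BimoduleHom.strand {M N : BigradedDGBimodule B A} (f : BimoduleHom M N) (j : ℤ) :
    strand k M.carrier j ⟶ strand k N.carrier j :=
  subCxMap (fun _ => f.toLin) (fun _ _ h => f.map_mem h) (fun _ x _ => (f.map_d x).symm)

/-- K-projective (homotopically projective) bigraded dg bimodules: `Hom (P, -)` maps acyclic
bimodules to acyclic complexes. -/
def IsKProjective (P : BigradedDGBimodule B A) : Prop :=
  ∀ N : BigradedDGBimodule B A, (∀ j, (strand k N.carrier j).Acyclic) → ∀ j, (homCx P N j).Acyclic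

/-- A K-projective resolution `P → M`; for such a resolution `Hom (P, N)` is `RHom (M, N)`. -/
structure KProjectiveResolution (M : BigradedDGBimodule B A) where
  P : BigradedDGBimodule B A
  π : BimoduleHom P M
  kProjective : IsKProjective P
  quasiIso : ∀ j, QuasiIso (π.strand j)

/-- The map `B → RHom (K, K) = Hom (P, K)` of the derived category of bigraded right dg `A`-modules
given by the left action of `B` on `K`, in inner degree `j`: `b` acts by `x ↦ b π (x)`. -/
def leftAction (K : BigradedDGBimodule B A) (R : KProjectiveResolution K.toRight) (j : ℤ) :
    strand k B.carrier j ⟶ homCx R.P K.toRight j :=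
  subCxMap (fun _ => (LinearMap.lcomp k K.carrier R.π.toLin) ∘ₗ K.lact)
    (fun n b hb => ⟨fun hx => K.lact_mem hb (R.π.map_mem hx),
      fun x a => by simp [R.π.map_ract, K.lact_ract],
      fun c x => by simp [R.π.map_lact, ground_sg]⟩)
    (fun n b hb => by
      ext x
      simp only [homD_apply, LinearMap.comp_apply, LinearMap.lcomp_apply]
      rw [R.π.map_d, K.leibniz_lact, sg_of_mem k 1 hb, one_mul, map_zsmul, LinearMap.smul_apply]
      abel)

/-- The map `Aᵒᵖᵖ → RHom (K, K) = Hom (P, K)` of the derived category of bigraded left dg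
`B`-modules given by the right action of `A` on `K`, in inner degree `j`: `a` acts by
`x ↦ (-1) ^ (|a| |x|) π (x) a`. -/
def rightAction (K : BigradedDGBimodule B A) (R : KProjectiveResolution K.toLeft) (j : ℤ) :
    strand k A.carrier j ⟶ homCx R.P K.toLeft j :=
  subCxMap (fun n => (LinearMap.lcomp k K.carrier ((sg k n : K.carrier →ₗ[k] K.carrier) ∘ₗ
      R.π.toLin)) ∘ₗ K.ract.flip)
    (fun n a ha => ⟨fun {p q x} hx => by
        have := K.ract_mem (sg_mem k n (R.π.map_mem hx)) ha
        rw [add_comm n p, add_comm j q]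
        exact this,
      fun x c => by simp [R.π.map_ract],
      fun b x => by simp [R.π.map_lact, sg_lact, K.lact_ract]⟩)
    (fun n a ha => by
      ext x
      simp only [homD_apply, LinearMap.comp_apply, LinearMap.lcomp_apply, LinearMap.flip_apply]
      rw [R.π.map_d, K.leibniz_ract, sg_sg, dd_sg, map_zsmul, LinearMap.smul_apply, add_comm 1 n]
      abel)

/-- The graded Keller condition: the maps `B → RHom (K, K)` (bigraded right dg `A`-modules) and
`Aᵒᵖᵖ → RHom (K, K)` (bigraded left dg `B`-modules) are bigraded quasi-isomorphisms. -/
def GradedKellerCondition (A B : BigradedDGAlgebra k) (K : BigradedDGBimodule B A) : Prop :=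
  (∃ R : KProjectiveResolution K.toRight, ∀ j, QuasiIso (leftAction K R j)) ∧
    ∃ R : KProjectiveResolution K.toLeft, ∀ j, QuasiIso (rightAction K R j)

end Modules

/-! ### The two-object category of a bimodule -/

section Keller

variable {k : Type u} [Field k]

/-- The bigraded dg category with one object and endomorphism algebra `A`. -/
def oneObject (A : BigradedDGAlgebra k) : BigradedDGCategory k where
  Obj := PUnit
  Mor _ _ := A.carrier
  one _ := 1
  comp := LinearMap.mul k A.carrier
  one_comp f := one_mul f
  comp_one f := mul_one f
  assoc h g f := mul_assoc h g f
  one_mem _ := A.one_mem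
  comp_mem := A.mul_mem
  leibniz := A.leibniz

/-- The zero bigraded complex. -/
instance zeroCx : BigradedComplex k PUnit.{u + 1} where
  piece _ _ := ⊤
  internal := by
    refine ⟨fun x y _ => ?_, fun x =>
      ⟨DirectSum.of (fun _ : ℤ × ℤ => (⊤ : Submodule k PUnit.{u + 1})) (0, 0) ⟨x, trivial⟩,
        Subsingleton.elim _ _⟩⟩
    exact DFinsupp.ext fun e => Subtype.ext (Subsingleton.elim _ _)
  d := 0
  d_mem _ := trivial
  d_d _ := rfl

/-- The two objects `a` and `b`. -/
inductive KellerObj : Type u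
  | a
  | b

variable {A B : BigradedDGAlgebra k} (K : BigradedDGBimodule B A)

/-- `Mor (a, a) = A`, `Mor (b, b) = B`, `Mor (b, a) = K`, `Mor (a, b) = 0`. -/
def kellerMor : KellerObj.{u} → KellerObj.{u} → Type u
  | .a, .a => A.carrier
  | .b, .b => B.carrier
  | .b, .a => K.carrier
  | .a, .b => PUnit.{u + 1}

instance kellerAcg : ∀ Y X, AddCommGroup (kellerMor K Y X)
  | .a, .a => inferInstanceAs (AddCommGroup A.carrier)
  | .b, .b => inferInstanceAs (AddCommGroup B.carrier)
  | .b, .a => inferInstanceAs (AddCommGroup K.carrier)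
  | .a, .b => inferInstanceAs (AddCommGroup PUnit.{u + 1})

instance kellerMod : ∀ Y X, Module k (kellerMor K Y X)
  | .a, .a => inferInstanceAs (Module k A.carrier)
  | .b, .b => inferInstanceAs (Module k B.carrier)
  | .b, .a => inferInstanceAs (Module k K.carrier)
  | .a, .b => inferInstanceAs (Module k PUnit.{u + 1})

instance kellerCx : ∀ Y X, BigradedComplex k (kellerMor K Y X)
  | .a, .a => inferInstanceAs (BigradedComplex k A.carrier)
  | .b, .b => inferInstanceAs (BigradedComplex k B.carrier)
  | .b, .a => inferInstanceAs (BigradedComplex k K.carrier)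
  | .a, .b => inferInstanceAs (BigradedComplex k PUnit.{u + 1})

/-- The identities of `cat (A, B, K)`. -/
def kellerOne : ∀ X, kellerMor K X X
  | .a => (1 : A.carrier)
  | .b => (1 : B.carrier)

/-- The compositions of `cat (A, B, K)`: the products of `A` and `B` and their actions on `K`. -/
def kellerComp : ∀ Z Y X, kellerMor K Z Y →ₗ[k] kellerMor K Y X →ₗ[k] kellerMor K Z X
  | .a, .a, .a => LinearMap.mul k A.carrier
  | .b, .b, .b => LinearMap.mul k B.carrier
  | .b, .b, .a => K.lact
  | .b, .a, .a => K.ract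
  | .a, .b, _ => 0
  | _, .a, .b => 0

/-- The bigraded dg category `cat (A, B, K)`. -/
def cat : BigradedDGCategory k where
  Obj := KellerObj
  Mor := kellerMor K
  one := kellerOne K
  comp {Z Y X} := kellerComp K Z Y X
  one_comp {Y X} f := by
    cases Y <;> cases X
    · exact one_mul (M := A.carrier) f
    · rfl
    · exact K.one_lact f
    · exact one_mul (M := B.carrier) f
  comp_one {Y X} f := by
    cases Y <;> cases X
    · exact mul_one (M := A.carrier) f
    · rfl
    · exact K.ract_one f
    · exact mul_one (M := B.carrier) f
  assoc {W Z Y X} h g f := by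
    cases W <;> cases Z <;> cases Y <;> cases X <;>
      first
      | exact mul_assoc (G := A.carrier) h g f
      | exact mul_assoc (G := B.carrier) h g f
      | exact K.mul_lact h g f
      | exact (K.ract_mul h g f).symm
      | exact K.lact_ract h g f
      | rfl
      | exact (map_zero (kellerComp K _ _ _ h)).symm
      | exact LinearMap.map_zero₂ (kellerComp K _ _ _) f
      | exact (LinearMap.map_zero₂ (kellerComp K _ _ _) f).trans (map_zero (kellerComp K _ _ _ h)).symm
  one_mem X := by
    cases X
    · exact A.one_mem
    · exact B.one_mem
  comp_mem {Z Y X i j i' j' g f} hg hf := by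
    cases Z <;> cases Y <;> cases X <;>
      first
      | exact A.mul_mem hg hf
      | exact B.mul_mem hg hf
      | exact K.lact_mem hg hf
      | exact K.ract_mem hg hf
      | exact zero_mem _
  leibniz {Z Y X} g f := by
    cases Z <;> cases Y <;> cases X <;>
      first
      | exact A.leibniz g f
      | exact B.leibniz g f
      | exact K.leibniz_lact g f
      | exact K.leibniz_ract g f
      | exact (map_zero _).trans (add_zero _).symm

/-- The full embedding of `A` as the endomorphisms of `a`. -/
def inclA : FullFunctor (oneObject A) (cat K) where
  obj _ := .a
  map _ _ := LinearEquiv.refl k A.carrier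
  map_one _ := rfl
  map_comp _ _ := rfl
  map_d _ := rfl
  map_mem := Iff.rfl

/-- The full embedding of `B` as the endomorphisms of `b`. -/
def inclB : FullFunctor (oneObject B) (cat K) where
  obj _ := .b
  map _ _ := LinearEquiv.refl k B.carrier
  map_one _ := rfl
  map_comp _ _ := rfl
  map_d _ := rfl
  map_mem := Iff.rfl

/-- The projection `p_A`. -/
def projA : HochGr (cat K) ⟶ HochGr (oneObject A) := (inclA K).proj

/-- The projection `p_B`. -/
def projB : HochGr (cat K) ⟶ HochGr (oneObject B) := (inclB K).proj

end Keller

end GradedKeller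

end

/-!
Extension by zero shows that the projections `p_A` and `p_B` are surjective on cochains, so it has
to be shown that their kernels are acyclic (`FullFunctor.proj_quasiIso`).

As there are no morphisms to `a` from `b`, a cochain in the kernel of `p_A` lives on the strings
`X₀, …, Xₚ` with `X₀ = b`. Such a string starts with a number of elements of `B`, the *depth* of the
string, before it leaves `b` by an element of `K` or ends. The kernel is complete for the filtration
by depth, and its graded pieces consist of the multilinear maps from powers of `B` to the complex of
cochains on strings of depth `0`. The latter consists of a copy of `B` (the values on the empty
string) and of the multilinear maps from `K ⊗ A ⊗ ⋯ ⊗ A` to `K`: it is the cone of the map from `B`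
to the complex of homomorphisms from the bar resolution of the right `A`-module `K` to `K`, which
represents `RHom (K, K)`. The Keller condition says that it is acyclic. Over a field an acyclic
complex has a linear contraction; it yields contractions of all the graded pieces
(`KellerData.exists_depth_contraction`), and successive approximation gives
`KellerData.exists_delta_eq`.

The Keller condition is about some K-projective resolution `P → K` and has to be transported to the
bar construction. For an object `U` of a bigraded dg category the *one-sided cochains*, with values
in the morphisms to `U` and on strings that start at a varying object `Z`, form a right dg module in
`Z`: the augmented standard resolution of the module of morphisms to `U` by relatively injective
modules. It is acyclic, by insertion of identities, so homomorphisms from `P` to it form an acyclic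
complex. On the other hand, the homomorphisms from an acyclic module, such as the cone of `P → K`,
to the submodule of the cochains that vanish on empty strings also form an acyclic complex
(`exists_primitive_of_acyclic`), since that submodule is relatively injective up to a complete
filtration. A diagram chase with these two facts (`KellerData.exists_sub_rdelta_mem`) yields the
acyclicity of the complex of cochains of depth `0`.

The argument is carried out for an arbitrary dg category with an object `U` that has no morphisms to
other objects, with the hypotheses collected in the structure `KellerData`. The statement for `p_A`
is the case of `cat (A, B, K)` and `U = b` (`rightKellerData`). The statement for `p_B` is the case
of the opposite category and `U = a` (`leftKellerData`); reversal of strings, with signs, identifies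
the Hochschild cochains of a dg category with those of its opposite (`opFam_delta`,
`reverse_reverse`).
-/

open CategoryTheory

noncomputable section

namespace GradedKeller

universe u

/-! ### Linear algebra of filtered and graded complexes -/

/-- Successive approximation in a complete filtered complex: if every `x` in the `m`-th step of the
filtration satisfying `Z` is, up to the next step, a boundary of an element of the `m`-th step, then
every `x` in the zeroth step satisfying `Z` is a boundary. -/
theorem exists_of_complete_filtration {V V' : Type*} [AddCommGroup V] [AddCommGroup V']
    (δ : V →+ V') (F : ℕ → AddSubgroup V) (F' : ℕ → AddSubgroup V') (H : V → Prop) (Z : V' → Prop)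
    (hδ : ∀ m x, x ∈ F m → δ x ∈ F' m)
    (hF' : ∀ x, (∀ m, x ∈ F' m) → x = 0)
    (hcomplete : ∀ ψ : ℕ → V, (∀ m, ψ m ∈ F m) → (∀ m, H (ψ m)) →
      ∃ y, H y ∧ ∀ m, y - ∑ i ∈ Finset.range m, ψ i ∈ F m)
    (step : ∀ m x, x ∈ F' m → Z x → ∃ y ∈ F m, H y ∧ x - δ y ∈ F' (m + 1) ∧ Z (x - δ y))
    {x : V'} (hx : x ∈ F' 0) (hZ : Z x) : ∃ y, H y ∧ δ y = x := by
  choose f hf1 hf2 hf3 hf4 using step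
  let seq : ∀ m : ℕ, {x : V' // x ∈ F' m ∧ Z x} := fun m =>
    Nat.rec ⟨x, hx, hZ⟩ (fun m y => ⟨y.1 - δ (f m y.1 y.2.1 y.2.2), hf3 _ _ _ _, hf4 _ _ _ _⟩) m
  let ψ : ℕ → V := fun m => f m (seq m).1 (seq m).2.1 (seq m).2.2
  have hsum : ∀ m, x - δ (∑ i ∈ Finset.range m, ψ i) = (seq m).1 := by
    intro m
    induction m with
    | zero => simp [seq]
    | succ m ih =>
      rw [Finset.sum_range_succ, map_add, ← sub_sub, ih]
  obtain ⟨y, hy, hy'⟩ := hcomplete ψ (fun m => hf1 _ _ _ _) fun m => hf2 _ _ _ _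
  refine ⟨y, hy, ?_⟩
  rw [eq_comm, ← sub_eq_zero]
  refine hF' _ fun m => ?_
  have : x - δ y = (seq m).1 - δ (y - ∑ i ∈ Finset.range m, ψ i) := by
    rw [← hsum, map_sub]; abel
  rw [this]
  exact sub_mem (seq m).2.1 (hδ _ _ (hy' m))

/-- Linear maps given on an independent family of subspaces have a common extension. -/
theorem exists_extension_of_iSupIndep {k V W ι : Type*} [Field k] [AddCommGroup V] [Module k V]
    [AddCommGroup W] [Module k W] [DecidableEq ι] {G : ι → Submodule k V} (hG : iSupIndep G)
    (g : ∀ i, G i →ₗ[k] W) : ∃ H : V →ₗ[k] W, ∀ i (x : G i), H x = g i x := by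
  have hinj : Function.Injective (DirectSum.coeLinearMap G) := hG.dfinsupp_lsum_injective
  obtain ⟨l, hl⟩ := LinearMap.exists_leftInverse_of_injective _ (LinearMap.ker_eq_bot.2 hinj)
  refine ⟨DirectSum.toModule k ι W g ∘ₗ l, fun i x => ?_⟩
  have h1 : DirectSum.coeLinearMap G (DirectSum.lof k ι (fun i => G i) i x) = x :=
    DirectSum.coeLinearMap_lof G i x
  have h2 := LinearMap.congr_fun hl (DirectSum.lof k ι (fun i => G i) i x)
  rw [LinearMap.comp_apply, h1] at h2
  rw [LinearMap.comp_apply, h2, LinearMap.id_apply, DirectSum.toModule_lof]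

/-- A linear map with image containing a subspace, up to `R`, has a linear section there that
vanishes on `R`. -/
theorem exists_section_mod {k V : Type*} [Field k] [AddCommGroup V] [Module k V]
    (D : V →ₗ[k] V) (S G R : Submodule k V) (h : ∀ x ∈ S, ∃ y ∈ G, x - D y ∈ R) :
    ∃ σ : V →ₗ[k] V, (∀ x, σ x ∈ G) ∧ (∀ x ∈ S, x - D (σ x) ∈ R) ∧ ∀ x ∈ R, σ x = 0 := by
  let f : G →ₗ[k] V ⧸ R := R.mkQ ∘ₗ D ∘ₗ G.subtype
  obtain ⟨q, hq⟩ := LinearMap.exists_extend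
    (Classical.choose (f.rangeRestrict.exists_rightInverse_of_surjective f.range_rangeRestrict))
  have hq' := Classical.choose_spec
    (f.rangeRestrict.exists_rightInverse_of_surjective f.range_rangeRestrict)
  refine ⟨G.subtype ∘ₗ q ∘ₗ R.mkQ, fun x => (q (R.mkQ x)).2, fun x hx => ?_, fun x hx => ?_⟩
  · obtain ⟨y, hy, hxy⟩ := h x hx
    have h1 : R.mkQ x = f ⟨y, hy⟩ := by
      simpa [f, sub_eq_zero] using (Submodule.Quotient.mk_eq_zero R).2 hxy
    have hmem : R.mkQ x ∈ LinearMap.range f := ⟨_, h1.symm⟩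
    have h2 : q (R.mkQ x) = _ := LinearMap.congr_fun hq ⟨_, hmem⟩
    have h3 := congrArg Subtype.val (LinearMap.congr_fun hq' ⟨_, hmem⟩)
    rw [← Submodule.Quotient.mk_eq_zero, Submodule.Quotient.mk_sub, sub_eq_zero]
    refine h3.symm.trans ?_
    simp only [LinearMap.comp_apply]
    rw [h2]
    rfl
  · have : R.mkQ x = 0 := by simpa using hx
    simp [this]

/-- A bigraded complex over a field that is acyclic modulo a subcomplex `R` has a linear contraction
modulo `R` that vanishes on `R`. -/
theorem exists_contraction_mod {k V : Type*} [Field k] [AddCommGroup V] [Module k V]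
    {G : ℤ → ℤ → Submodule k V} (hG : iSupIndep fun e : ℤ × ℤ => G e.1 e.2)
    (D : V →ₗ[k] V) (R : Submodule k V)
    (hD : ∀ {i j x}, x ∈ G i j → D x ∈ G (i + 1) j)
    (hDD : ∀ {i j x}, x ∈ G i j → D (D x) = 0)
    (hR : ∀ {i j x}, x ∈ G i j → x ∈ R → D x ∈ R)
    (hac : ∀ {i j x}, x ∈ G i j → D x ∈ R → ∃ y ∈ G (i - 1) j, x - D y ∈ R) :
    ∃ H : V →ₗ[k] V, (∀ {i j x}, x ∈ G i j → H x ∈ G (i - 1) j) ∧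
      (∀ {i j x}, x ∈ G i j → x ∈ R → H x = 0) ∧
      ∀ {i j x}, x ∈ G i j → x - D (H x) - H (D x) ∈ R := by
  choose σ hσ1 hσ2 hσ3 using fun i j => exists_section_mod D (G i j ⊓ R.comap D) (G (i - 1) j) R
    fun x hx => hac hx.1 hx.2
  obtain ⟨H, hH⟩ := exists_extension_of_iSupIndep hG fun e =>
    (σ e.1 e.2 ∘ₗ (LinearMap.id - σ (e.1 + 1) e.2 ∘ₗ D)) ∘ₗ (G e.1 e.2).subtype
  have hH' : ∀ {i j x}, x ∈ G i j → H x = σ i j (x - σ (i + 1) j (D x)) :=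
    fun {i j x} hx => hH (i, j) ⟨x, hx⟩
  have hz : ∀ {i j x}, x ∈ G i j → D x - D (σ (i + 1) j (D x)) ∈ R := fun {i j x} hx =>
    hσ2 _ _ _ ⟨hD hx, by simp [hDD hx]⟩
  refine ⟨H, fun hx => by rw [hH' hx]; exact hσ1 _ _ _, fun {i j x} hx hxR => ?_,
    fun {i j x} hx => ?_⟩
  · rw [hH' hx, hσ3 _ _ _ (hR hx hxR), sub_zero, hσ3 _ _ _ hxR]
  · rw [hH' hx, hH' (hD hx), hDD hx, map_zero, sub_zero, sub_right_comm]
    refine hσ2 i j _ ⟨sub_mem hx ?_, ?_⟩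
    · simpa using hσ1 (i + 1) j (D x)
    · simpa using hz hx

/-- A bihomogeneous linear map to a bigraded complex kills the intersection of a piece with the sum of
the other pieces. -/
theorem map_eq_zero_of_mem_iSup_ne {k V M : Type u} [Field k] [AddCommGroup V] [Module k V]
    {G : ℤ → ℤ → Submodule k V} [AddCommGroup M] [Module k M] [BigradedComplex k M]
    (ev : V →ₗ[k] M) (p q : ℤ) (hev : ∀ {i j x}, x ∈ G i j → ev x ∈ pc k M (i + p) (j + q))
    {e : ℤ × ℤ} {x : V} (hx : x ∈ G e.1 e.2)
    (hx' : x ∈ ⨆ (e' : ℤ × ℤ) (_ : e' ≠ e), G e'.1 e'.2) : ev x = 0 := by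
  have hind := (BigradedComplex.internal (k := k) (M := M)).submodule_iSupIndep
  have := hind (e.1 + p, e.2 + q)
  rw [Submodule.disjoint_def] at this
  refine this _ (hev hx) ?_
  have hle : (⨆ (e' : ℤ × ℤ) (_ : e' ≠ e), G e'.1 e'.2).map ev ≤
      ⨆ (e' : ℤ × ℤ) (_ : e' ≠ (e.1 + p, e.2 + q)), pc k M e'.1 e'.2 := by
    rw [Submodule.map_iSup]
    refine iSup_le fun e' => ?_
    rw [Submodule.map_iSup]
    refine iSup_le fun he' => ?_
    refine le_trans ?_ (le_iSup₂ (f := fun (e' : ℤ × ℤ)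
      (_ : e' ≠ (e.1 + p, e.2 + q)) => pc k M e'.1 e'.2) (e'.1 + p, e'.2 + q) ?_)
    · rintro _ ⟨y, hy, rfl⟩
      exact hev hy
    · intro h
      apply he'
      simp only [Prod.mk.injEq, add_left_inj] at h
      exact Prod.ext h.1 h.2
  exact hle ⟨x, hx', rfl⟩

/-- A bigraded family of subspaces is independent if it is detected by bihomogeneous linear maps to
bigraded complexes. -/
theorem iSupIndep_of_tests {k V : Type u} [Field k] [AddCommGroup V] [Module k V]
    (G : ℤ → ℤ → Submodule k V) {T : Type*} (M : T → Type u) [∀ t, AddCommGroup (M t)]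
    [∀ t, Module k (M t)] [∀ t, BigradedComplex k (M t)] (ev : ∀ t, V →ₗ[k] M t) (p q : T → ℤ)
    (hev : ∀ t {i j x}, x ∈ G i j → ev t x ∈ pc k (M t) (i + p t) (j + q t))
    (hinj : ∀ {i j x}, x ∈ G i j → (∀ t, ev t x = 0) → x = 0) :
    iSupIndep fun e : ℤ × ℤ => G e.1 e.2 := by
  intro e
  rw [Submodule.disjoint_def]
  exact fun x hx hx' => hinj hx fun t => map_eq_zero_of_mem_iSup_ne (ev t) (p t) (q t) (hev t) hx hx'

/-- The sum of an independent bigraded family of subspaces that is stable under a differential, as a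
bigraded complex. -/
@[reducible] def iSupCx {k V : Type u} [Field k] [AddCommGroup V] [Module k V]
    {G : ℤ → ℤ → Submodule k V} (hG : iSupIndep fun e : ℤ × ℤ => G e.1 e.2)
    (D : V →ₗ[k] V) (hD : ∀ {i j x}, x ∈ G i j → D x ∈ G (i + 1) j)
    (hDD : ∀ {i j x}, x ∈ G i j → D (D x) = 0) :
    BigradedComplex k (⨆ e : ℤ × ℤ, G e.1 e.2 : Submodule k V) where
  piece i j := (G i j).comap (⨆ e : ℤ × ℤ, G e.1 e.2 : Submodule k V).subtype
  internal := by
    have hle : ∀ e : ℤ × ℤ, G e.1 e.2 ≤ ⨆ e : ℤ × ℤ, G e.1 e.2 :=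
      le_iSup fun e : ℤ × ℤ => G e.1 e.2
    have hmap : ∀ e : ℤ × ℤ, ((G e.1 e.2).comap (⨆ e : ℤ × ℤ, G e.1 e.2 : Submodule k V).subtype).map
        (⨆ e : ℤ × ℤ, G e.1 e.2 : Submodule k V).subtype = G e.1 e.2 := fun e => by
      rw [Submodule.map_comap_subtype, inf_eq_right.2 (hle e)]
    rw [DirectSum.isInternal_submodule_iff_iSupIndep_and_iSup_eq_top]
    constructor
    · intro e
      rw [Submodule.disjoint_def]
      intro x hx hx'
      refine Subtype.ext (Submodule.disjoint_def.1 (hG e) x hx ?_)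
      have := Submodule.mem_map_of_mem
        (f := (⨆ e : ℤ × ℤ, G e.1 e.2 : Submodule k V).subtype) hx'
      simp only [Submodule.map_iSup, hmap] at this
      exact this
    · refine Submodule.map_injective_of_injective
        (⨆ e : ℤ × ℤ, G e.1 e.2 : Submodule k V).injective_subtype ?_
      rw [Submodule.map_iSup, Submodule.map_top, Submodule.range_subtype]
      exact iSup_congr hmap
  d := D.restrict fun x hx => by
    induction hx using Submodule.iSup_induction' with
    | mem e x hx => exact Submodule.mem_iSup_of_mem (e.1 + 1, e.2) (hD hx)
    | zero => simp
    | add x y _ _ hx hy => rw [map_add]; exact add_mem hx hy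
  d_mem := fun {i j x} hx => hD hx
  d_d x := by
    obtain ⟨x, hx⟩ := x
    refine Subtype.ext ?_
    change D (D x) = 0
    induction hx using Submodule.iSup_induction' with
    | mem e x hx => exact hDD hx
    | zero => simp
    | add x y _ _ hx hy => rw [map_add, map_add, hx, hy, add_zero]

/-- A linear map takes values in a subspace if it does so on bihomogeneous elements. -/
theorem mem_of_forall_pc {k M V : Type u} [Field k] [AddCommGroup M] [Module k M]
    [BigradedComplex k M] [AddCommGroup V] [Module k V] (L : M →ₗ[k] V) (S : Submodule k V)
    (h : ∀ i j x, x ∈ pc k M i j → L x ∈ S) (x : M) : L x ∈ S := by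
  have : S.mkQ ∘ₗ L = 0 := ext_pc k fun i j x hx => by
    simpa using h i j x hx
  simpa using LinearMap.congr_fun this x

/-! ### Elementwise criteria for complexes of vector spaces -/

section Elementwise

variable {k : Type u} [Field k]

theorem shortComplex_homologyπ_eq_zero_iff (S : ShortComplex (ModuleCat.{u} k)) (c : S.cycles) :
    S.homologyπ c = 0 ↔ ∃ y, S.f y = S.iCycles c := by
  have hex : (ShortComplex.mk S.toCycles S.homologyπ (by simp)).Exact :=
    ShortComplex.exact_of_g_is_cokernel _ S.homologyIsCokernel
  have hi : Function.Injective S.iCycles := (ModuleCat.mono_iff_injective _).1 inferInstance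
  have hti : ∀ y, S.iCycles (S.toCycles y) = S.f y := fun y => by
    rw [← ConcreteCategory.comp_apply, S.toCycles_i]
  constructor
  · intro h
    obtain ⟨y, hy⟩ := (ShortComplex.moduleCat_exact_iff _).1 hex c h
    exact ⟨y, by rw [← hti]; exact congrArg _ hy⟩
  · rintro ⟨y, hy⟩
    have : S.toCycles y = c := hi (by rw [hti, hy])
    rw [← this, ← ConcreteCategory.comp_apply, S.toCycles_comp_homologyπ]
    rfl

theorem shortComplex_exists_cycle (S : ShortComplex (ModuleCat.{u} k)) {x : S.X₂} (h : S.g x = 0) :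
    ∃ c : S.cycles, S.iCycles c = x := by
  have hex : (ShortComplex.mk S.iCycles S.g (by simp)).Exact :=
    ShortComplex.exact_of_f_is_kernel _ S.cyclesIsKernel
  exact (ShortComplex.moduleCat_exact_iff _).1 hex x h

/-- A morphism of short complexes is a quasi-isomorphism iff it is injective and surjective on
homology, in terms of elements. -/
theorem shortComplex_quasiIso_iff {S T : ShortComplex (ModuleCat.{u} k)} (f : S ⟶ T) :
    ShortComplex.QuasiIso f ↔
      (∀ x, S.g x = 0 → (∃ y, T.f y = f.τ₂ x) → ∃ z, S.f z = x) ∧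
        ∀ y, T.g y = 0 → ∃ x, S.g x = 0 ∧ ∃ z, T.f z = y - f.τ₂ x := by
  have hm : ∀ c, T.iCycles (ShortComplex.cyclesMap f c) = f.τ₂ (S.iCycles c) := fun c => by
    rw [← ConcreteCategory.comp_apply, ← ConcreteCategory.comp_apply, ShortComplex.cyclesMap_i]
  have hπ : ∀ c, ShortComplex.homologyMap f (S.homologyπ c) =
      T.homologyπ (ShortComplex.cyclesMap f c) := fun c => by
    rw [← ConcreteCategory.comp_apply, ← ConcreteCategory.comp_apply,
      ShortComplex.homologyπ_naturality]
  have hS : Function.Surjective S.homologyπ := (ModuleCat.epi_iff_surjective _).1 inferInstance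
  have hT : Function.Surjective T.homologyπ := (ModuleCat.epi_iff_surjective _).1 inferInstance
  have hSg : ∀ c, S.g (S.iCycles c) = 0 := fun c => by
    rw [← ConcreteCategory.comp_apply, S.iCycles_g]; rfl
  have hTg : ∀ c, T.g (T.iCycles c) = 0 := fun c => by
    rw [← ConcreteCategory.comp_apply, T.iCycles_g]; rfl
  rw [ShortComplex.quasiIso_iff, ConcreteCategory.isIso_iff_bijective]
  constructor
  · rintro ⟨hinj, hsurj⟩
    refine ⟨fun x hx ⟨y, hy⟩ => ?_, fun y hy => ?_⟩
    · obtain ⟨c, rfl⟩ := shortComplex_exists_cycle S hx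
      rw [← shortComplex_homologyπ_eq_zero_iff]
      apply hinj
      rw [hπ, map_zero, shortComplex_homologyπ_eq_zero_iff]
      exact ⟨y, by rw [hm, hy]⟩
    · obtain ⟨c, rfl⟩ := shortComplex_exists_cycle T hy
      obtain ⟨b, hb⟩ := hsurj (T.homologyπ c)
      obtain ⟨b, rfl⟩ := hS b
      refine ⟨S.iCycles b, hSg b, ?_⟩
      rw [← hm, ← map_sub, ← shortComplex_homologyπ_eq_zero_iff, map_sub, ← hπ, hb, sub_self]
  · rintro ⟨h1, h2⟩
    refine ⟨(injective_iff_map_eq_zero _).2 fun a ha => ?_, fun b => ?_⟩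
    · obtain ⟨c, rfl⟩ := hS a
      rw [hπ, shortComplex_homologyπ_eq_zero_iff] at ha
      rw [shortComplex_homologyπ_eq_zero_iff]
      obtain ⟨y, hy⟩ := ha
      exact h1 _ (hSg c) ⟨y, by rw [hy, hm]⟩
    · obtain ⟨c, rfl⟩ := hT b
      obtain ⟨x, hx, z, hz⟩ := h2 _ (hTg c)
      obtain ⟨a, rfl⟩ := shortComplex_exists_cycle S hx
      refine ⟨S.homologyπ a, ?_⟩
      rw [hπ, eq_comm, ← sub_eq_zero, ← map_sub, shortComplex_homologyπ_eq_zero_iff]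
      exact ⟨z, by rw [hz, map_sub, hm]⟩

/-- A chain map is a quasi-isomorphism iff it is injective and surjective on cohomology, in terms of
elements. -/
theorem cochain_quasiIso_iff {K L : CochainComplex (ModuleCat.{u} k) ℤ} (f : K ⟶ L) :
    QuasiIso f ↔ ∀ n,
      (∀ x, K.d n (n + 1) x = 0 → (∃ y, L.d (n - 1) n y = f.f n x) → ∃ z, K.d (n - 1) n z = x) ∧
        ∀ y, L.d n (n + 1) y = 0 →
          ∃ x, K.d n (n + 1) x = 0 ∧ ∃ z, L.d (n - 1) n z = y - f.f n x := by
  rw [quasiIso_iff]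
  refine forall_congr' fun n => ?_
  rw [quasiIsoAt_iff' f (n - 1) n (n + 1) (by simp) (by simp), shortComplex_quasiIso_iff]
  rfl

theorem cochain_acyclic_iff {K : CochainComplex (ModuleCat.{u} k) ℤ} :
    K.Acyclic ↔ ∀ n x, K.d n (n + 1) x = 0 → ∃ z, K.d (n - 1) n z = x := by
  refine forall_congr' fun n => ?_
  rw [K.exactAt_iff' (n - 1) n (n + 1) (by simp) (by simp), ShortComplex.moduleCat_exact_iff]
  rfl

section SubCx

variable {V V' : Type u} [AddCommGroup V] [Module k V] [AddCommGroup V'] [Module k V']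
  {F : ℤ → Submodule k V} {δ : ℤ → V →ₗ[k] V}
  {hF : ∀ n, ∀ x ∈ F n, δ n x ∈ F (n + 1)} {hδ : ∀ n, ∀ x ∈ F n, δ (n + 1) (δ n x) = 0}
  {F' : ℤ → Submodule k V'} {δ' : ℤ → V' →ₗ[k] V'}
  {hF' : ∀ n, ∀ x ∈ F' n, δ' n x ∈ F' (n + 1)} {hδ' : ∀ n, ∀ x ∈ F' n, δ' (n + 1) (δ' n x) = 0}

theorem subCx_d (n : ℤ) (x : F n) :
    (subCx F δ hF hδ).d n (n + 1) x = (⟨δ n x, hF n x x.2⟩ : F (n + 1)) := by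
  simp only [subCx, CochainComplex.of_d]
  rfl

theorem subCx_d_eq_zero_iff (n : ℤ) (x : F n) :
    (subCx F δ hF hδ).d n (n + 1) x = 0 ↔ δ n x = 0 := by
  rw [subCx_d]
  exact Subtype.ext_iff

theorem subCx_exists_d_eq_iff (n : ℤ) (x : F n) :
    (∃ z, (subCx F δ hF hδ).d (n - 1) n z = x) ↔ ∃ z ∈ F (n - 1), δ (n - 1) z = x := by
  obtain ⟨m, rfl⟩ : ∃ m, n = m + 1 := ⟨n - 1, by ring⟩
  have hm : m + 1 - 1 = m := by ring
  rw [hm]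
  constructor
  · rintro ⟨z, hz⟩
    refine ⟨z.1, z.2, ?_⟩
    exact congrArg Subtype.val ((subCx_d m z).symm.trans hz)
  · rintro ⟨z, hz, h⟩
    exact ⟨(⟨z, hz⟩ : F m), (subCx_d _ _).trans (Subtype.ext h)⟩

theorem subCx_acyclic_iff :
    (subCx F δ hF hδ).Acyclic ↔ ∀ n, ∀ x ∈ F n, δ n x = 0 → ∃ z ∈ F (n - 1), δ (n - 1) z = x := by
  rw [cochain_acyclic_iff]
  refine forall_congr' fun n => ⟨fun h x hx h0 => ?_, fun h x h0 => ?_⟩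
  · exact (subCx_exists_d_eq_iff n ⟨x, hx⟩).1 (h (⟨x, hx⟩ : F n) ((subCx_d_eq_zero_iff n _).2 h0))
  · exact (subCx_exists_d_eq_iff n x).2 (h x.1 x.2 ((subCx_d_eq_zero_iff n _).1 h0))

theorem subCxMap_quasiIso_iff (f : ℤ → V →ₗ[k] V') (hf : ∀ n, ∀ x ∈ F n, f n x ∈ F' n)
    (hc : ∀ n, ∀ x ∈ F n, δ' n (f n x) = f (n + 1) (δ n x)) :
    QuasiIso (subCxMap (hF := hF) (hδ := hδ) (hF' := hF') (hδ' := hδ') f hf hc) ↔ ∀ n,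
      (∀ x ∈ F n, δ n x = 0 → (∃ y ∈ F' (n - 1), δ' (n - 1) y = f n x) →
        ∃ z ∈ F (n - 1), δ (n - 1) z = x) ∧
      ∀ y ∈ F' n, δ' n y = 0 →
        ∃ x ∈ F n, δ n x = 0 ∧ ∃ z ∈ F' (n - 1), δ' (n - 1) z = y - f n x := by
  have hval : ∀ n (x : F n), (subCxMap (hF := hF) (hδ := hδ) (hF' := hF') (hδ' := hδ') f hf hc).f n x
      = (⟨f n x, hf n x x.2⟩ : F' n) := fun n x => rfl
  rw [cochain_quasiIso_iff]
  refine forall_congr' fun n => and_congr ⟨fun h x hx h0 h1 => ?_, fun h x h0 h1 => ?_⟩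
    ⟨fun h y hy h0 => ?_, fun h y h0 => ?_⟩
  · refine (subCx_exists_d_eq_iff n ⟨x, hx⟩).1 (h (⟨x, hx⟩ : F n) ((subCx_d_eq_zero_iff n _).2 h0) ?_)
    exact (subCx_exists_d_eq_iff n ⟨f n x, hf n x hx⟩).2 h1
  · refine (subCx_exists_d_eq_iff n x).2 (h x.1 x.2 ((subCx_d_eq_zero_iff n _).1 h0) ?_)
    exact (subCx_exists_d_eq_iff n ⟨f n x.1, hf n x.1 x.2⟩).1 h1
  · obtain ⟨x, h1, h2⟩ := h (⟨y, hy⟩ : F' n) ((subCx_d_eq_zero_iff n _).2 h0)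
    exact ⟨x.1, x.2, (subCx_d_eq_zero_iff n _).1 h1,
      (subCx_exists_d_eq_iff n (⟨y - f n x.1, sub_mem hy (hf n x.1 x.2)⟩)).1 h2⟩
  · obtain ⟨x, hx, h1, h2⟩ := h y.1 y.2 ((subCx_d_eq_zero_iff n _).1 h0)
    exact ⟨(⟨x, hx⟩ : F n), (subCx_d_eq_zero_iff n _).2 h1,
      (subCx_exists_d_eq_iff n (⟨y.1 - f n x, sub_mem y.2 (hf n x hx)⟩)).2 h2⟩

end SubCx

end Elementwise

/-! ### One-sided Hochschild cochains -/

section OneSided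

variable {k : Type u} [Field k] {C : BigradedDGCategory k}

theorem dd_one (X : C.Obj) : dd k (C.one X) = 0 := by
  have h := C.leibniz (C.one X) (C.one X)
  rw [C.one_comp, sg_of_mem k 1 (C.one_mem X), C.comp_one] at h
  simpa [C.one_comp] using h

theorem sg_one (n : ℤ) (X : C.Obj) : sg k n (C.one X) = C.one X := by
  rw [sg_of_mem k n (C.one_mem X)]; simp

/-- A multilinear function that vanishes on strings of bihomogeneous entries is zero. -/
theorem IsMultilinear.eq_zero {N : Type u} [AddCommGroup N] [Module k N] {Z X : C.Obj}
    (s : Str C Z X) : ∀ {φ : Str C Z X → N}, IsMultilinear φ →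
      (∀ {t : Str C Z X} {p q : ℤ}, t.HasDeg p q → φ t = 0) → φ s = 0 := by
  induction s with
  | nil => intro φ _ h; exact h (.nil _)
  | @cons Z Y X g s ih =>
    intro φ hm h
    have : hm.headMap Y s = 0 := by
      refine ext_pc k fun i j x hx => ?_
      exact ih (hm.tail x) fun ht => h (.cons hx ht)
    exact LinearMap.congr_fun this g

/-- Families of functions on the strings that start at `Z`, with values in the morphisms to `U`. -/
abbrev RFam (C : BigradedDGCategory k) (U Z : C.Obj) : Type u := ∀ W, Str C Z W → C.Mor U W

variable {U Z Y : C.Obj}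

/-- One-sided cochains of bidegree `(n, j)`: the multilinear families of bidegree `(n, j)`, where
the entries of strings carry shifted degrees. As `Z` varies they form the standard relatively
injective resolution of the right module of morphisms to `U`, including the augmentation (the
values on empty strings). -/
def RCoch (C : BigradedDGCategory k) (U Z : C.Obj) (n j : ℤ) : Submodule k (RFam C U Z) where
  carrier := {χ | (∀ W, IsMultilinear (χ W)) ∧
    ∀ {W} {s : Str C Z W} {p q : ℤ}, s.HasDeg p q → χ W s ∈ pc k (C.Mor U W) (n + p) (j + q)}
  add_mem' := by
    rintro φ ψ ⟨h1, h2⟩ ⟨h3, h4⟩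
    refine ⟨fun X Y W s t c g g' => ?_, fun h => add_mem (h2 h) (h4 h)⟩
    simp only [Pi.add_apply]
    rw [h1 X Y W s t, h3 X Y W s t]
    module
  zero_mem' := ⟨fun X Y W s t c g g' => by simp, fun h => zero_mem _⟩
  smul_mem' := by
    rintro a φ ⟨h1, h2⟩
    refine ⟨fun X Y W s t c g g' => ?_, fun h => Submodule.smul_mem _ _ (h2 h)⟩
    simp only [Pi.smul_apply]
    rw [h1 X Y W s t]
    module

theorem RCoch.nil_mem {n j : ℤ} {χ : RFam C U Z} (h : χ ∈ RCoch C U Z n j) :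
    χ Z (.nil Z) ∈ pc k (C.Mor U Z) n j := by
  have := h.2 (.nil Z)
  rwa [add_zero, add_zero] at this

theorem RCoch.eq_zero {n j : ℤ} {χ : RFam C U Z} (h : χ ∈ RCoch C U Z n j)
    (h0 : ∀ {W} {s : Str C Z W} {p q : ℤ}, s.HasDeg p q → χ W s = 0) : χ = 0 := by
  funext W s
  exact IsMultilinear.eq_zero s (h.1 W) h0

theorem RCoch.iSupIndep (C : BigradedDGCategory k) (U Z : C.Obj) :
    iSupIndep fun e : ℤ × ℤ => RCoch C U Z e.1 e.2 := by
  let T := Σ W : C.Obj, Σ s : Str C Z W, {e : ℤ × ℤ // s.HasDeg e.1 e.2}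
  refine iSupIndep_of_tests (RCoch C U Z) (T := T) (fun t => C.Mor U t.1)
    (fun t => LinearMap.proj t.2.1 ∘ₗ LinearMap.proj t.1) (fun t => t.2.2.1.1)
    (fun t => t.2.2.1.2) (fun t {i j x} hx => hx.2 t.2.2.2) fun hx h => ?_
  exact RCoch.eq_zero hx fun {W s p q} hs => h ⟨W, s, (p, q), hs⟩

/-- The differential of one-sided cochains,
`(D χ) (x₁, …, xₚ) = d (χ (x₁, …, xₚ)) ± χ (x₁, …, xₚ₋₁) xₚ + (-1) ^ n inner χ (x₁, …, xₚ)`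
for `χ` of cohomological degree `n`. The sign `(-1) ^ n` is written as the product of the parities
of the value and of the argument, so that a single linear map serves all degrees. -/
def rdelta (C : BigradedDGCategory k) (U Z : C.Obj) : RFam C U Z →ₗ[k] RFam C U Z where
  toFun χ := fun W s => dd k (χ W s) + rmul (fun W t => sg k 1 (χ W t)) s +
    inner (fun t => lsign t • sg k 1 (χ W (twist t))) s
  map_add' χ ψ := by
    funext W s
    simp only [Pi.add_apply, map_add, rmul_add, smul_add, inner_add]
    abel
  map_smul' c χ := by
    funext W s
    simp only [Pi.smul_apply, map_smul, rmul_smul, RingHom.id_apply, smul_add]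
    rw [← inner_smul]
    simp only [smul_comm c]

theorem RCoch.parity {n j : ℤ} {χ : RFam C U Z} (h : χ ∈ RCoch C U Z n j) {W : C.Obj}
    (t : Str C Z W) : lsign t • sg k 1 (χ W (twist t)) = (n.negOnePow : ℤ) • χ W t := by
  rw [sg_cochain (twist t) (h.1 W) h.2, twist_twist, lsign_twist, smul_smul]
  congr 1
  rw [mul_comm, mul_assoc, lsign_mul, mul_one]

theorem rdelta_apply {n j : ℤ} {χ : RFam C U Z} (h : χ ∈ RCoch C U Z n j) {W : C.Obj}
    (s : Str C Z W) : rdelta C U Z χ W s =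
      dd k (χ W s) + rmul (fun W t => sg k 1 (χ W t)) s + (n.negOnePow : ℤ) • inner (χ W) s := by
  rw [← inner_zsmul]
  simp only [← RCoch.parity h]
  rfl

theorem rdelta_nil (χ : RFam C U Z) : rdelta C U Z χ Z (.nil Z) = dd k (χ Z (.nil Z)) := by
  simp [rdelta, rmul, inner]

theorem rdelta_mem {n j : ℤ} {χ : RFam C U Z} (h : χ ∈ RCoch C U Z n j) :
    rdelta C U Z χ ∈ RCoch C U Z (n + 1) j := by
  refine ⟨fun W X Y s t c g g' => ?_, fun {W s p q} hs => ?_⟩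
  · rw [rdelta_apply h, rdelta_apply h, rdelta_apply h]
    rw [h.1 W X Y s t c g g', map_add, map_smul,
      rmul_isMultilinear (fun W => comp_isMultilinear (sg k 1) (h.1 W)) X Y s t c g g',
      inner_isMultilinear (h.1 W) X Y s t c g g']
    module
  · rw [rdelta_apply h]
    refine add_mem (add_mem ?_ ?_) (zsmul_mem (inner_degree hs h.2) _)
    · have := dd_mem k (h.2 hs)
      rwa [show n + p + 1 = n + 1 + p by ring] at this
    · exact rmul_degree hs fun ht => sg_mem k 1 (h.2 ht)

/-- The family `χ (g, -)`. -/
def rtail (g : C.Mor Z Y) : RFam C U Z →ₗ[k] RFam C U Y where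
  toFun χ := fun W s => χ W (.cons g s)
  map_add' _ _ := rfl
  map_smul' _ _ := rfl

/-- The right action of morphisms on families: `(χ g) () = χ () g` on empty strings and
`(χ g) (x₁, …, xₚ) = (-1) ^ |g| χ (g x₁, x₂, …, xₚ)` for `p > 0`. -/
def rract (g : C.Mor Z Y) : RFam C U Z →ₗ[k] RFam C U Y where
  toFun χ := fun W s => rlast χ g s + merge (χ W) g s
  map_add' χ ψ := by funext W s; cases s <;> simp [rlast, merge]
  map_smul' c χ := by funext W s; cases s <;> simp [rlast, merge]

theorem rract_nil (g : C.Mor Z Y) (χ : RFam C U Z) :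
    rract g χ Y (.nil Y) = C.comp (χ Z (.nil Z)) g := by
  simp [rract, rlast, merge]

theorem rtail_rract {X : C.Obj} (g : C.Mor Z Y) (f : C.Mor Y X) (χ : RFam C U Z) :
    rtail f (rract g χ) = rtail (C.comp (sg k 1 g) f) χ := by
  funext W s
  simp [rtail, rract, rlast, merge]

theorem rract_cons {X W : C.Obj} (g : C.Mor Z Y) (f : C.Mor Y X) (s : Str C X W)
    (χ : RFam C U Z) : rract g χ W (.cons f s) = χ W (.cons (C.comp (sg k 1 g) f) s) := by
  simp [rract, rlast, merge]

/-- Two families agree if they agree on empty strings and on strings `(g, -)` for bihomogeneous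
`g`. -/
theorem RFam.ext_homogeneous {χ ψ : RFam C U Z} (hχ : ∀ W, IsMultilinear (χ W))
    (hψ : ∀ W, IsMultilinear (ψ W)) (hnil : χ Z (.nil Z) = ψ Z (.nil Z))
    (h : ∀ (Y : C.Obj) (i j : ℤ) (g : C.Mor Z Y), g ∈ pc k (C.Mor Z Y) i j →
      rtail g χ = rtail g ψ) : χ = ψ := by
  funext W s
  cases s with
  | nil => exact hnil
  | @cons _ Y _ g s =>
    have : (hχ W).headMap Y s = (hψ W).headMap Y s :=
      ext_pc k fun i j x hx => congrFun (congrFun (h Y i j x hx) W) s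
    exact LinearMap.congr_fun this g

theorem rtail_isMultilinear {χ : RFam C U Z} (h : ∀ W, IsMultilinear (χ W)) (g : C.Mor Z Y)
    (W : C.Obj) : IsMultilinear (rtail g χ W) :=
  (h W).tail g

/-- `rtail` as a linear map in the morphism. -/
def rtailL {χ : RFam C U Z} (h : ∀ W, IsMultilinear (χ W)) (Y : C.Obj) :
    C.Mor Z Y →ₗ[k] RFam C U Y :=
  LinearMap.pi fun W => LinearMap.pi fun s => (h W).headMap Y s

theorem rtailL_apply {χ : RFam C U Z} (h : ∀ W, IsMultilinear (χ W)) (g : C.Mor Z Y) :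
    rtailL h Y g = rtail g χ := rfl

/-- `rract` as a linear map in the morphism. -/
def rractL {χ : RFam C U Z} (h : ∀ W, IsMultilinear (χ W)) (Y : C.Obj) :
    C.Mor Z Y →ₗ[k] RFam C U Y where
  toFun g := rract g χ
  map_add' g g' := by
    funext W s
    cases s with
    | nil => simp [rract_nil]
    | @cons _ X _ f s =>
      simp only [Pi.add_apply, rract_cons, map_add, LinearMap.add_apply]
      exact map_add ((h W).headMap X s) _ _
  map_smul' c g := by
    funext W s
    cases s with
    | nil => simp [rract_nil]
    | @cons _ X _ f s =>
      simp only [Pi.smul_apply, rract_cons, map_smul, LinearMap.smul_apply]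
      exact map_smul ((h W).headMap X s) _ _

theorem rractL_apply {χ : RFam C U Z} (h : ∀ W, IsMultilinear (χ W)) (g : C.Mor Z Y) :
    rractL h Y g = rract g χ := rfl

theorem rtail_mem {n j i j' : ℤ} {χ : RFam C U Z} (h : χ ∈ RCoch C U Z n j) {g : C.Mor Z Y}
    (hg : g ∈ pc k (C.Mor Z Y) i j') : rtail g χ ∈ RCoch C U Y (n + (i - 1)) (j + j') := by
  refine ⟨rtail_isMultilinear h.1 g, fun {W s p q} hs => ?_⟩
  have := h.2 (Str.HasDeg.cons hg hs)
  rwa [← add_assoc, ← add_assoc] at this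

theorem rract_mem {n j i j' : ℤ} {χ : RFam C U Z} (h : χ ∈ RCoch C U Z n j) {g : C.Mor Z Y}
    (hg : g ∈ pc k (C.Mor Z Y) i j') : rract g χ ∈ RCoch C U Y (n + i) (j + j') := by
  refine ⟨fun W X V s t c f f' => ?_, fun {W s p q} hs => ?_⟩
  · cases s with
    | nil =>
      simp only [Str.append, rract_cons, map_add, map_smul]
      exact (h.1 W).head _ _ _ _
    | cons x s =>
      simp only [Str.append, rract_cons]
      exact (h.1 W) _ _ (.cons (C.comp (sg k 1 g) x) s) t c f f'
  · cases hs with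
    | nil => rw [rract_nil, add_zero, add_zero]; exact C.comp_mem (RCoch.nil_mem h) hg
    | @cons _ _ _ f s i2 j2 p q hf hs =>
      rw [rract_cons]
      have := h.2 (Str.HasDeg.cons (C.comp_mem (sg_mem k 1 hg) hf) hs)
      rwa [show n + (i + i2 - 1 + p) = n + i + (i2 - 1 + p) by ring,
        show j + (j' + j2 + q) = j + j' + (j2 + q) by ring] at this

theorem rract_rract {X : C.Obj} (g : C.Mor Z Y) (f : C.Mor Y X) (χ : RFam C U Z) :
    rract f (rract g χ) = rract (C.comp g f) χ := by
  funext W s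
  cases s with
  | nil => simp only [rract_nil, C.assoc]
  | cons x s => simp only [rract_cons, sg_comp, C.assoc]

theorem rract_one (χ : RFam C U Z) : rract (C.one Z) χ = χ := by
  funext W s
  cases s with
  | nil => rw [rract_nil, C.comp_one]
  | cons x s => rw [rract_cons, sg_one, C.one_comp]

/-- The recursion satisfied by the differential of one-sided cochains. -/
theorem rtail_rdelta {n j i j' : ℤ} {χ : RFam C U Z} (h : χ ∈ RCoch C U Z n j) {g : C.Mor Z Y}
    (hg : g ∈ pc k (C.Mor Z Y) i j') :
    rtail g (rdelta C U Z χ) = rdelta C U Y (rtail g χ) + (n.negOnePow : ℤ) • rract g χ +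
      (n.negOnePow : ℤ) • rtail (dd k g) χ := by
  funext W s
  simp only [Pi.add_apply, Pi.smul_apply]
  rw [rdelta_apply (rtail_mem h hg)]
  refine (rdelta_apply h _).trans ?_
  rw [rmul_cons, inner_cons]
  have e1 : (fun s' => χ W (.cons (sg k 1 g) s')) = fun s' => (i.negOnePow : ℤ) • rtail g χ W s' := by
    funext s'
    rw [sg_of_mem k 1 hg, one_mul]
    exact map_zsmul ((h.1 W).headMap Y s') _ _
  have e2 : rlast (fun W t => sg k 1 (χ W t)) g s = (n.negOnePow : ℤ) • rlast χ g s := by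
    cases s with
    | nil =>
      simp only [rlast]
      rw [sg_of_mem k 1 (RCoch.nil_mem h), one_mul, map_zsmul, LinearMap.smul_apply]
    | cons => simp [rlast]
  have e3 : (((n + (i - 1)).negOnePow : ℤˣ) : ℤ) = - ((n.negOnePow : ℤ) * i.negOnePow) := by
    simp [Int.negOnePow_add, Int.negOnePow_sub]
  rw [e1, e2, e3, inner_zsmul]
  simp only [rract, rtail, LinearMap.coe_mk, AddHom.coe_mk]
  module

/-- The Leibniz rule for the right action on one-sided cochains. -/
theorem rdelta_rract {n j : ℤ} {χ : RFam C U Z} (h : χ ∈ RCoch C U Z n j) (g : C.Mor Z Y) :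
    rdelta C U Y (rract g χ) = rract g (rdelta C U Z χ) + (n.negOnePow : ℤ) • rract (dd k g) χ := by
  have hD := rdelta_mem h
  suffices H : rdelta C U Y ∘ₗ rractL h.1 Y =
      rractL hD.1 Y + (n.negOnePow : ℤ) • (rractL h.1 Y ∘ₗ dd k) from
    LinearMap.congr_fun H g
  refine ext_pc k fun i j' g hg => ?_
  simp only [LinearMap.comp_apply, LinearMap.add_apply, LinearMap.smul_apply, rractL_apply]
  have hr := rract_mem h hg
  have hd := rract_mem h (dd_mem k hg)
  refine RFam.ext_homogeneous (rdelta_mem hr).1 (fun W => ?_) ?_ fun X i2 j2 f hf => ?_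
  · have h1 := rract_mem hD hg
    have h2 := zsmul_mem hd (n.negOnePow : ℤ)
    rw [show n + (i + 1) = n + 1 + i by ring] at h2
    exact (add_mem h1 h2).1 W
  · simp only [Pi.add_apply, Pi.smul_apply, rdelta_nil, rract_nil, C.leibniz]
    rw [sg_of_mem k 1 (RCoch.nil_mem h), one_mul, map_zsmul, LinearMap.smul_apply]
  · have hgf := C.comp_mem (sg_mem k 1 hg) hf
    rw [map_add, map_zsmul, rtail_rract, rtail_rract, rtail_rdelta hr hf, rtail_rdelta h hgf,
      rtail_rract, rract_rract, rtail_rract, C.leibniz, sg_one_sg_one, dd_sg_one]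
    simp only [← rtailL_apply h.1, ← rractL_apply h.1, map_add, map_neg, LinearMap.neg_apply]
    have e1 : sg k 1 g = (i.negOnePow : ℤ) • g := by rw [sg_of_mem k 1 hg, one_mul]
    have e3 : (((n + i).negOnePow : ℤˣ) : ℤ) = (n.negOnePow : ℤ) * i.negOnePow := by
      simp [Int.negOnePow_add]
    rw [e1, e3]
    simp only [map_zsmul, LinearMap.smul_apply]
    have hsq := negOnePow_mul_self i
    set e : ℤ := (i.negOnePow : ℤ)
    clear_value e
    rcases mul_self_eq_one_iff.mp hsq with he | he <;> rw [he] <;> module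

theorem rdelta_rdelta {n j : ℤ} {χ : RFam C U Z} (h : χ ∈ RCoch C U Z n j) :
    rdelta C U Z (rdelta C U Z χ) = 0 := by
  suffices H : ∀ (Z W : C.Obj) (s : Str C Z W) {n j : ℤ} {χ : RFam C U Z},
      χ ∈ RCoch C U Z n j → rdelta C U Z (rdelta C U Z χ) W s = 0 by
    funext W s
    exact H Z W s h
  intro Z W s
  induction s with
  | nil => intro n j χ _; rw [rdelta_nil, rdelta_nil, dd_dd]
  | @cons Z Y W g s ih =>
    intro n j χ h
    have hD := rdelta_mem h
    have : ((rdelta_mem hD).1 W).headMap Y s = 0 := by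
      refine ext_pc k fun i j' g hg => ?_
      change rtail g (rdelta C U Z (rdelta C U Z χ)) W s = 0
      rw [rtail_rdelta hD hg, rtail_rdelta h hg, rtail_rdelta h (dd_mem k hg), dd_dd, map_add,
        map_add, map_zsmul, map_zsmul, rdelta_rract h]
      simp only [Pi.add_apply, ih (rtail_mem h hg)]
      have e : rtail (0 : C.Mor Z Y) χ = 0 := map_zero (rtailL h.1 Y)
      rw [e, Int.negOnePow_succ]
      simp only [Pi.smul_apply, Pi.add_apply, Units.val_neg, smul_zero, Pi.zero_apply]
      set e : ℤ := (n.negOnePow : ℤ) with he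
      have hsq : e * e = 1 := negOnePow_mul_self n
      clear_value e
      rcases mul_self_eq_one_iff.mp hsq with he | he <;> rw [he] <;> module
    exact LinearMap.congr_fun this g

/-- Insertion of an identity as the first entry is a contraction of the one-sided cochains. -/
theorem rtail_one_rdelta {n j : ℤ} {χ : RFam C U Z} (h : χ ∈ RCoch C U Z n j) :
    rtail (C.one Z) (rdelta C U Z χ) =
      rdelta C U Z (rtail (C.one Z) χ) + (n.negOnePow : ℤ) • χ := by
  rw [rtail_rdelta h (C.one_mem Z), dd_one, rract_one]
  have e : rtail (0 : C.Mor Z Z) χ = 0 := map_zero (rtailL h.1 Z)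
  rw [e, smul_zero, add_zero]

theorem RCoch.exact {n j : ℤ} {χ : RFam C U Z} (h : χ ∈ RCoch C U Z n j)
    (h0 : rdelta C U Z χ = 0) : ∃ ψ ∈ RCoch C U Z (n - 1) j, rdelta C U Z ψ = χ := by
  have h1 := rtail_mem h (C.one_mem Z)
  rw [show n + (0 - 1) = n - 1 by ring, add_zero] at h1
  refine ⟨-(n.negOnePow : ℤ) • rtail (C.one Z) χ, zsmul_mem h1 _, ?_⟩
  have := rtail_one_rdelta h
  rw [h0, map_zero, eq_comm, add_eq_zero_iff_eq_neg] at this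
  rw [map_zsmul, this, smul_neg, neg_smul, neg_neg, smul_smul, negOnePow_mul_self, one_smul]

end OneSided

/-! ### Right dg modules over a bigraded dg category -/

/-- Right bigraded dg modules over a bigraded dg category: complexes `carrier X`, with
`carrier Y ⊗ Mor Y X → carrier X`. -/
structure RMod {k : Type u} [Field k] (C : BigradedDGCategory k) where
  carrier : C.Obj → Type u
  [acg : ∀ X, AddCommGroup (carrier X)]
  [mod : ∀ X, Module k (carrier X)]
  [cx : ∀ X, BigradedComplex k (carrier X)]
  act : ∀ {Y X}, carrier Y →ₗ[k] C.Mor Y X →ₗ[k] carrier X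
  act_one : ∀ {X} (x : carrier X), act x (C.one X) = x
  act_act : ∀ {Z Y X} (x : carrier Z) (g : C.Mor Z Y) (f : C.Mor Y X),
    act (act x g) f = act x (C.comp g f)
  act_mem : ∀ {Y X} {i j i' j' : ℤ} {x : carrier Y} {g : C.Mor Y X},
    x ∈ pc k (carrier Y) i j → g ∈ pc k (C.Mor Y X) i' j' →
      act x g ∈ pc k (carrier X) (i + i') (j + j')
  leibniz : ∀ {Y X} (x : carrier Y) (g : C.Mor Y X),
    dd k (act x g) = act (dd k x) g + act (sg k 1 x) (dd k g)

attribute [instance] RMod.acg RMod.mod RMod.cx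

namespace RMod

variable {k : Type u} [Field k] {C : BigradedDGCategory k}

theorem sg_act (M : RMod C) (n : ℤ) {Y X : C.Obj} (x : M.carrier Y) (g : C.Mor Y X) :
    sg k n (M.act x g) = M.act (sg k n x) (sg k n g) := by
  have : (M.act.compr₂ (sg k n) : M.carrier Y →ₗ[k] C.Mor Y X →ₗ[k] M.carrier X)
      = M.act.compl₁₂ (sg k n) (sg k n) := by
    refine ext_pc k fun i j x hx => ext_pc k fun i' j' y hy => ?_
    simp only [LinearMap.compr₂_apply, LinearMap.compl₁₂_apply]
    rw [sg_of_mem k n hx, sg_of_mem k n hy, sg_of_mem k n (M.act_mem hx hy), map_zsmul, map_zsmul,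
      LinearMap.smul_apply, smul_smul, mul_add, Int.negOnePow_add, Units.val_mul, mul_comm]
  exact LinearMap.congr_fun (LinearMap.congr_fun this x) g

/-- Homomorphisms of bidegree `(n, j)` of right dg modules, not necessarily compatible with the
differentials. -/
structure IsHom (M N : RMod C) (n j : ℤ) (F : ∀ Y, M.carrier Y →ₗ[k] N.carrier Y) : Prop where
  mem : ∀ {Y} {i i' : ℤ} {x : M.carrier Y}, x ∈ pc k (M.carrier Y) i i' →
    F Y x ∈ pc k (N.carrier Y) (n + i) (j + i')
  act : ∀ {Y X} (x : M.carrier Y) (g : C.Mor Y X), F X (M.act x g) = N.act (F Y x) g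

/-- Acyclicity of a right dg module, in terms of elements. -/
def Acyclic (M : RMod C) : Prop :=
  ∀ {Y : C.Obj} {i j : ℤ} {x : M.carrier Y}, x ∈ pc k (M.carrier Y) i j → dd k x = 0 →
    ∃ y ∈ pc k (M.carrier Y) (i - 1) j, dd k y = x

/-- K-projectivity of a right dg module, in terms of elements. -/
def KProjective (P : RMod C) : Prop :=
  ∀ N : RMod C, N.Acyclic → ∀ {n j : ℤ} {F : ∀ Y, P.carrier Y →ₗ[k] N.carrier Y},
    IsHom P N n j F → (∀ Y, homD _ _ n (F Y) = 0) →
      ∃ G, IsHom P N (n - 1) j G ∧ ∀ Y, homD _ _ (n - 1) (G Y) = F Y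

/-- A contraction of an acyclic right dg module by linear maps, which need not be compatible with
the action. -/
theorem Acyclic.exists_contraction {M : RMod C} (hM : M.Acyclic) :
    ∃ h : ∀ Y, M.carrier Y →ₗ[k] M.carrier Y,
      (∀ {Y i j x}, x ∈ pc k (M.carrier Y) i j → h Y x ∈ pc k (M.carrier Y) (i - 1) j) ∧
        ∀ {Y} (x : M.carrier Y), dd k (h Y x) + h Y (dd k x) = x := by
  have : ∀ Y, ∃ h : M.carrier Y →ₗ[k] M.carrier Y,
      (∀ {i j x}, x ∈ pc k (M.carrier Y) i j → h x ∈ pc k (M.carrier Y) (i - 1) j) ∧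
        ∀ (x : M.carrier Y), dd k (h x) + h (dd k x) = x := by
    intro Y
    obtain ⟨h, h1, -, h3⟩ := exists_contraction_mod (V := M.carrier Y)
      (G := fun i j => pc k (M.carrier Y) i j)
      (BigradedComplex.internal (k := k) (M := M.carrier Y)).submodule_iSupIndep (dd k) ⊥
      (fun hx => dd_mem k hx) (fun _ => dd_dd k _) (fun _ hx => by simp_all) (fun hx h0 => by
        obtain ⟨y, hy, h⟩ := hM hx (by simpa using h0)
        exact ⟨y, hy, by simp [h]⟩)
    refine ⟨h, h1, fun x => ?_⟩
    have : dd k ∘ₗ h + h ∘ₗ dd k = LinearMap.id := ext_pc k fun i j x hx => by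
      have := h3 hx
      rw [Submodule.mem_bot, sub_sub, sub_eq_zero] at this
      exact this.symm
    exact LinearMap.congr_fun this x
  choose h h1 h2 using this
  exact ⟨h, fun {Y i j x} => h1 Y, fun {Y} => h2 Y⟩

/-! #### The module of one-sided cochains -/

theorem isMultilinear_of_mem_iSup {U Z : C.Obj} {χ : RFam C U Z}
    (h : χ ∈ (⨆ e : ℤ × ℤ, RCoch C U Z e.1 e.2 : Submodule k (RFam C U Z))) (W : C.Obj) :
    IsMultilinear (χ W) := by
  induction h using Submodule.iSup_induction' with
  | mem e x hx => exact hx.1 W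
  | zero => intro Y W s t c g g'; simp
  | add x y _ _ hx hy =>
    intro Y W s t c g g'
    simp only [Pi.add_apply]
    rw [hx, hy]
    module

theorem rract_mem_iSup {U Z Y : C.Obj} {χ : RFam C U Z}
    (h : χ ∈ (⨆ e : ℤ × ℤ, RCoch C U Z e.1 e.2 : Submodule k (RFam C U Z))) (g : C.Mor Z Y) :
    rract g χ ∈ (⨆ e : ℤ × ℤ, RCoch C U Y e.1 e.2 : Submodule k (RFam C U Y)) := by
  induction h using Submodule.iSup_induction' with
  | mem e x hx =>
    refine mem_of_forall_pc (rractL hx.1 Y) _ (fun i j g hg => ?_) g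
    exact Submodule.mem_iSup_of_mem (e.1 + i, e.2 + j) (rract_mem hx hg)
  | zero => rw [map_zero]; exact zero_mem _
  | add x y _ _ hx hy => rw [map_add]; exact add_mem hx hy

instance coindCx (U Z : C.Obj) :
    BigradedComplex k (⨆ e : ℤ × ℤ, RCoch C U Z e.1 e.2 : Submodule k (RFam C U Z)) :=
  iSupCx (RCoch.iSupIndep C U Z) (rdelta C U Z) (fun h => rdelta_mem h) fun h => rdelta_rdelta h

/-- The right action on finite sums of bihomogeneous one-sided cochains. -/
def coindAct (U Z Y : C.Obj) : (⨆ e : ℤ × ℤ, RCoch C U Z e.1 e.2 : Submodule k (RFam C U Z)) →ₗ[k]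
    C.Mor Z Y →ₗ[k] (⨆ e : ℤ × ℤ, RCoch C U Y e.1 e.2 : Submodule k (RFam C U Y)) :=
  LinearMap.mk₂ k (fun χ g => ⟨rract g χ.1, rract_mem_iSup χ.2 g⟩)
    (fun _ _ g => Subtype.ext (map_add (rract g) _ _))
    (fun _ _ g => Subtype.ext (map_smul (rract g) _ _))
    (fun χ _ _ => Subtype.ext (map_add (rractL (isMultilinear_of_mem_iSup χ.2) _) _ _))
    (fun _ χ _ => Subtype.ext (map_smul (rractL (isMultilinear_of_mem_iSup χ.2) _) _ _))

/-- The right dg module of finite sums of bihomogeneous one-sided cochains. -/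
def coind (C : BigradedDGCategory k) (U : C.Obj) : RMod C where
  carrier Z := (⨆ e : ℤ × ℤ, RCoch C U Z e.1 e.2 : Submodule k (RFam C U Z))
  act {Z Y} := coindAct U Z Y
  act_one χ := Subtype.ext (rract_one χ.1)
  act_act χ g f := Subtype.ext (rract_rract g f χ.1)
  act_mem {_ _ _ _ _ _ χ _} hχ hg := rract_mem (χ := χ.1) hχ hg
  leibniz {Z Y} χ g := by
    have : dd k ∘ₗ (coindAct U Z Y).flip g =
        (coindAct U Z Y).flip g ∘ₗ dd k + (coindAct U Z Y).flip (dd k g) ∘ₗ sg k 1 := by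
      refine ext_pc k fun i j χ hχ => Subtype.ext ?_
      simp only [LinearMap.comp_apply, LinearMap.add_apply, LinearMap.flip_apply]
      rw [sg_of_mem k 1 hχ, one_mul, map_zsmul]
      exact rdelta_rract (χ := χ.1) hχ g
    exact LinearMap.congr_fun this χ

/-- The underlying family of a sum of one-sided cochains. -/
def coindVal (U Z : C.Obj) : (coind C U).carrier Z →ₗ[k] RFam C U Z :=
  Submodule.subtype (⨆ e : ℤ × ℤ, RCoch C U Z e.1 e.2 : Submodule k (RFam C U Z))

theorem coindVal_dd {U Z : C.Obj} (χ : (coind C U).carrier Z) :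
    coindVal U Z (dd k χ) = rdelta C U Z (coindVal U Z χ) := rfl

theorem coindVal_act {U Z Y : C.Obj} (χ : (coind C U).carrier Z) (g : C.Mor Z Y) :
    coindVal U Y ((coind C U).act χ g) = rract g (coindVal U Z χ) := rfl

theorem coind_acyclic (U : C.Obj) : (coind C U).Acyclic := by
  intro Y i j χ hχ h0
  obtain ⟨ψ, hψ, h⟩ := RCoch.exact (χ := coindVal U Y χ) hχ (by rw [← coindVal_dd, h0, map_zero])
  exact ⟨⟨ψ, Submodule.mem_iSup_of_mem (i - 1, j) hψ⟩, hψ, Subtype.ext h⟩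

/-! #### Mapping cones -/

variable {P M : RMod C} {π : ∀ Y, P.carrier Y →ₗ[k] M.carrier Y}

/-- The mapping cone of a chain map of bigraded complexes. -/
@[reducible] def coneCx {V W : Type u} [AddCommGroup V] [Module k V] [BigradedComplex k V]
    [AddCommGroup W] [Module k W] [BigradedComplex k W] (π : V →ₗ[k] W)
    (hmem : ∀ {i j x}, x ∈ pc k V i j → π x ∈ pc k W i j) (hd : ∀ x, π (dd k x) = dd k (π x)) :
    BigradedComplex k (V × W) where
  piece i j := (pc k V (i + 1) j).prod (pc k W i j)
  internal := by
    rw [DirectSum.isInternal_submodule_iff_iSupIndep_and_iSup_eq_top]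
    constructor
    · intro e
      rw [Submodule.disjoint_def]
      intro x hx hx'
      refine Prod.ext ?_ ?_
      · exact map_eq_zero_of_mem_iSup_ne (G := fun i j => (pc k V (i + 1) j).prod (pc k W i j))
          (LinearMap.fst k V W) 1 0 (fun h => by rw [add_zero]; exact h.1) hx hx'
      · exact map_eq_zero_of_mem_iSup_ne (G := fun i j => (pc k V (i + 1) j).prod (pc k W i j))
          (LinearMap.snd k V W) 0 0 (fun h => by rw [add_zero, add_zero]; exact h.2) hx hx'
    · rw [eq_top_iff]
      rintro ⟨v, w⟩ -
      rw [show (v, w) = LinearMap.inl k V W v + LinearMap.inr k V W w by simp]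
      refine add_mem (mem_of_forall_pc _ _ (fun i j x hx => ?_) v)
        (mem_of_forall_pc _ _ (fun i j x hx => ?_) w)
      · refine Submodule.mem_iSup_of_mem (i - 1, j) ⟨?_, zero_mem _⟩
        rw [sub_add_cancel]
        exact hx
      · exact Submodule.mem_iSup_of_mem (i, j) ⟨zero_mem _, hx⟩
  d := LinearMap.prod (-(dd k ∘ₗ LinearMap.fst k V W))
    (π ∘ₗ LinearMap.fst k V W + dd k ∘ₗ LinearMap.snd k V W)
  d_mem h := ⟨neg_mem (dd_mem k h.1), add_mem (hmem h.1) (dd_mem k h.2)⟩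
  d_d x := by
    refine Prod.ext ?_ ?_
    · simp [dd_dd]
    · simp [dd_dd, hd]

theorem sg_cone {V W : Type u} [AddCommGroup V] [Module k V] [BigradedComplex k V]
    [AddCommGroup W] [Module k W] [BigradedComplex k W] (π : V →ₗ[k] W)
    (hmem : ∀ {i j x}, x ∈ pc k V i j → π x ∈ pc k W i j) (hd : ∀ x, π (dd k x) = dd k (π x))
    (x : V × W) :
    letI := coneCx π hmem hd
    sg k 1 x = (- sg k 1 x.1, sg k 1 x.2) := by
  let := coneCx π hmem hd
  have : sg k 1 = LinearMap.prod (-(sg k 1 ∘ₗ LinearMap.fst k V W))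
      (sg k 1 ∘ₗ LinearMap.snd k V W) := by
    refine ext_pc k fun i j x hx => ?_
    rw [sg_of_mem k 1 hx]
    refine Prod.ext ?_ ?_
    · change _ = -sg k 1 x.1
      rw [sg_of_mem k 1 hx.1, one_mul, one_mul, Int.negOnePow_succ]
      simp
    · change _ = sg k 1 x.2
      rw [sg_of_mem k 1 hx.2]
      rfl
  exact LinearMap.congr_fun this x

/-- The mapping cone of a morphism of right dg modules. -/
def cone (hπ : IsHom P M 0 0 π) (hd : ∀ Y x, π Y (dd k x) = dd k (π Y x)) : RMod C where
  carrier Y := P.carrier Y × M.carrier Y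
  cx Y := coneCx (π Y) (fun h => by simpa using hπ.mem h) (hd Y)
  act {Y X} := LinearMap.mk₂ k (fun x g => (P.act x.1 g, M.act x.2 g))
    (fun _ _ _ => by simp) (fun _ _ _ => by simp) (fun _ _ _ => by simp) (fun _ _ _ => by simp)
  act_one x := by simp [P.act_one, M.act_one]
  act_act x g f := by simp [P.act_act, M.act_act]
  act_mem {Y X i j i' j' x g} hx hg := by
    refine ⟨?_, M.act_mem hx.2 hg⟩
    have := P.act_mem hx.1 hg
    rwa [add_right_comm] at this
  leibniz {Y X} x g := by
    rw [sg_cone (π Y) (fun h => by simpa using hπ.mem h) (hd Y) x]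
    refine Prod.ext ?_ ?_
    · change -dd k (P.act x.1 g) = P.act (-dd k x.1) g + P.act (-sg k 1 x.1) (dd k g)
      rw [P.leibniz]
      simp only [map_neg, LinearMap.neg_apply]
      abel
    · change π X (P.act x.1 g) + dd k (M.act x.2 g) =
        M.act (π Y x.1 + dd k x.2) g + M.act (sg k 1 x.2) (dd k g)
      rw [M.leibniz, hπ.act]
      simp only [map_add, LinearMap.add_apply]
      abel

/-- The mapping cone of a quasi-isomorphism is acyclic. -/
theorem cone_acyclic (hπ : IsHom P M 0 0 π) (hd : ∀ Y x, π Y (dd k x) = dd k (π Y x))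
    (hinj : ∀ {Y i j} {x : P.carrier Y}, x ∈ pc k (P.carrier Y) i j → dd k x = 0 →
      (∃ y ∈ pc k (M.carrier Y) (i - 1) j, dd k y = π Y x) →
        ∃ z ∈ pc k (P.carrier Y) (i - 1) j, dd k z = x)
    (hsurj : ∀ {Y i j} {y : M.carrier Y}, y ∈ pc k (M.carrier Y) i j → dd k y = 0 →
      ∃ x ∈ pc k (P.carrier Y) i j, dd k x = 0 ∧
        ∃ z ∈ pc k (M.carrier Y) (i - 1) j, dd k z = y - π Y x) :
    (cone hπ hd).Acyclic := by
  rintro Y i j ⟨p, x⟩ ⟨hp, hx⟩ h0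
  have h1 : dd k p = 0 := neg_eq_zero.1 (congrArg Prod.fst h0)
  have h2 : π Y p + dd k x = 0 := congrArg Prod.snd h0
  obtain ⟨z, hz, rfl⟩ := hinj hp h1
    ⟨-x, by rw [add_sub_cancel_right]; exact neg_mem hx, by
      rw [map_neg, eq_comm, ← add_eq_zero_iff_eq_neg, h2]⟩
  rw [add_sub_cancel_right] at hz
  have hπz : π Y z ∈ pc k (M.carrier Y) i j := by simpa using hπ.mem hz
  obtain ⟨w, hw, hw0, v, hv, h⟩ := hsurj (add_mem hπz hx) (by rw [map_add, ← hd, h2])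
  refine ⟨(w - z, v), ⟨?_, hv⟩, ?_⟩
  · rw [sub_add_cancel]
    exact sub_mem hw hz
  · refine Prod.ext ?_ ?_
    · change -dd k (w - z) = dd k z
      rw [map_sub, hw0, zero_sub, neg_neg]
    · change π Y (w - z) + dd k v = x
      rw [h, map_sub]
      abel

end RMod

/-! ### Homomorphisms to one-sided cochains -/

section CoindHom

variable {k : Type u} [Field k] {C : BigradedDGCategory k}

/-- The number of entries of a string. -/
def Str.length : {Z X : C.Obj} → Str C Z X → ℕ
  | _, _, .nil _ => 0
  | _, _, .cons _ s => s.length + 1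

theorem Str.length_append {Z Y X : C.Obj} (s : Str C Z Y) (t : Str C Y X) :
    (s.append t).length = s.length + t.length := by
  induction s with
  | nil => simp [Str.append, Str.length]
  | cons g s ih => simp only [Str.append, Str.length, ih]; omega

theorem Str.length_twist {Z X : C.Obj} (s : Str C Z X) : (twist s).length = s.length := by
  induction s with
  | nil => rfl
  | cons g s ih => simp only [twist, Str.length, ih]

theorem merge_eq_zero_of_length {N : Type u} [AddCommGroup N] {Z Y X : C.Obj} {φ : Str C Z X → N}
    {m : ℕ} (h : ∀ t : Str C Z X, t.length ≤ m → φ t = 0) (g : C.Mor Z Y) {s : Str C Y X}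
    (hs : s.length ≤ m) : merge φ g s = 0 := by
  cases s with
  | nil => rfl
  | cons f t => exact h _ (by simpa [Str.length] using hs)

theorem inner_eq_zero_of_length {N : Type u} [AddCommGroup N] {Z X : C.Obj} (s : Str C Z X) :
    ∀ {φ : Str C Z X → N} {m : ℕ}, (∀ t : Str C Z X, t.length ≤ m → φ t = 0) → s.length ≤ m →
      inner φ s = 0 := by
  induction s with
  | nil => intros; rfl
  | cons g s ih =>
    intro φ m h hs
    obtain ⟨m, rfl⟩ : ∃ m', m = m' + 1 := ⟨m - 1, by simp only [Str.length] at hs; omega⟩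
    have hs' : s.length ≤ m := by simpa [Str.length] using hs
    rw [inner_cons, h _ (by simpa [Str.length] using hs'), merge_eq_zero_of_length h g (by omega),
      ih (m := m) (fun t ht => h _ (by simpa [Str.length] using ht)) hs']
    simp

theorem rmul_eq_zero_of_length {U Z X : C.Obj} (s : Str C Z X) :
    ∀ {χ : ∀ W, Str C Z W → C.Mor U W} {m : ℕ},
      (∀ W (t : Str C Z W), t.length ≤ m → χ W t = 0) → s.length ≤ m + 1 → rmul χ s = 0 := by
  induction s with
  | nil => intros; rfl
  | cons g s ih =>
    intro χ m h hs
    have hs' : s.length ≤ m := by simpa [Str.length] using hs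
    rw [rmul_cons]
    cases s with
    | nil => simp [rlast, rmul, h _ (.nil _) (Nat.zero_le _)]
    | cons f t =>
      obtain ⟨m, rfl⟩ : ∃ m', m = m' + 1 := ⟨m - 1, by simp only [Str.length] at hs'; omega⟩
      rw [ih (m := m) (fun W t ht => h _ _ (by simpa [Str.length] using ht)) hs']
      simp [rlast]

theorem rdelta_eq_zero_of_length {U Z W : C.Obj} {χ : RFam C U Z} {m : ℕ}
    (h : ∀ W (t : Str C Z W), t.length ≤ m → χ W t = 0) {s : Str C Z W} (hs : s.length ≤ m) :
    rdelta C U Z χ W s = 0 := by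
  change dd k (χ W s) + rmul (fun W t => sg k 1 (χ W t)) s + inner _ s = 0
  rw [h W s hs, rmul_eq_zero_of_length (m := m) s (fun W t ht => by rw [h W t ht, map_zero])
    (by omega), inner_eq_zero_of_length (m := m) s (fun t ht => by
      rw [h W _ (by rwa [Str.length_twist]), map_zero, smul_zero]) hs]
  simp

variable (Q : RMod C) (U : C.Obj)

/-- Families of linear maps from a right dg module to families of functions on strings. -/
abbrev CHom : Type u := ∀ Y, Q.carrier Y →ₗ[k] RFam C U Y

variable {Q U}

/-- Homomorphisms of bidegree `(n, j)` of right modules with values in one-sided cochains. -/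
structure IsCHom (n j : ℤ) (F : CHom Q U) : Prop where
  mem : ∀ {Y} {i i' : ℤ} {x : Q.carrier Y}, x ∈ pc k (Q.carrier Y) i i' →
    F Y x ∈ RCoch C U Y (n + i) (j + i')
  act : ∀ {Y X} (x : Q.carrier Y) (g : C.Mor Y X), F X (Q.act x g) = rract g (F Y x)

/-- The differential `F ↦ D F - (-1) ^ n F d` on homomorphisms of cohomological degree `n` with
values in one-sided cochains. -/
def chD (n : ℤ) : CHom Q U →ₗ[k] CHom Q U where
  toFun F := fun Y => rdelta C U Y ∘ₗ F Y - (n.negOnePow : ℤ) • (F Y ∘ₗ dd k)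
  map_add' F G := by
    funext Y
    ext x : 1
    simp only [Pi.add_apply, LinearMap.sub_apply, LinearMap.add_apply, LinearMap.smul_apply,
      LinearMap.comp_apply, map_add]
    module
  map_smul' c F := by
    funext Y
    ext x : 1
    simp only [Pi.smul_apply, LinearMap.sub_apply, LinearMap.smul_apply, LinearMap.comp_apply,
      map_smul, RingHom.id_apply, smul_sub, smul_comm c]

theorem chD_apply (n : ℤ) (F : CHom Q U) {Y : C.Obj} (x : Q.carrier Y) :
    chD n F Y x = rdelta C U Y (F Y x) - (n.negOnePow : ℤ) • F Y (dd k x) := rfl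

theorem IsCHom.sub {n j : ℤ} {F G : CHom Q U} (hF : IsCHom n j F) (hG : IsCHom n j G) :
    IsCHom n j (F - G) where
  mem hx := sub_mem (hF.mem hx) (hG.mem hx)
  act x g := by
    simp only [Pi.sub_apply, LinearMap.sub_apply]
    rw [hF.act, hG.act, map_sub]

theorem IsCHom.mem_iSup {n j : ℤ} {F : CHom Q U} (hF : IsCHom n j F) {Y : C.Obj}
    (x : Q.carrier Y) :
    F Y x ∈ (⨆ e : ℤ × ℤ, RCoch C U Y e.1 e.2 : Submodule k (RFam C U Y)) :=
  mem_of_forall_pc (F Y) _ (fun i i' _ hx =>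
    Submodule.mem_iSup_of_mem (n + i, j + i') (hF.mem hx)) x

theorem IsCHom.isMultilinear {n j : ℤ} {F : CHom Q U} (hF : IsCHom n j F) {Y : C.Obj}
    (x : Q.carrier Y) (W : C.Obj) : IsMultilinear (F Y x W) :=
  RMod.isMultilinear_of_mem_iSup (hF.mem_iSup x) W

theorem IsCHom.chD {n j : ℤ} {F : CHom Q U} (hF : IsCHom n j F) : IsCHom (n + 1) j (chD n F) where
  mem {Y i i' x} hx := by
    rw [chD_apply]
    refine sub_mem ?_ (zsmul_mem ?_ _)
    · have := rdelta_mem (hF.mem hx)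
      rwa [add_right_comm] at this
    · have := hF.mem (dd_mem k hx)
      rwa [← add_assoc, add_right_comm] at this
  act {Y X} x g := by
    suffices H : GradedKeller.chD n F X ∘ₗ Q.act.flip g = rract g ∘ₗ GradedKeller.chD n F Y from
      LinearMap.congr_fun H x
    refine ext_pc k fun i i' x hx => ?_
    simp only [LinearMap.comp_apply, LinearMap.flip_apply, chD_apply]
    rw [hF.act, rdelta_rract (hF.mem hx), Q.leibniz, map_add, hF.act, hF.act, map_sub, map_zsmul,
      sg_of_mem k 1 hx, one_mul, map_zsmul, map_zsmul, Int.negOnePow_add, Units.val_mul]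
    module

theorem chD_chD {n j : ℤ} {F : CHom Q U} (hF : IsCHom n j F) : chD (n + 1) (chD n F) = 0 := by
  funext Y
  refine ext_pc k fun i i' x hx => ?_
  rw [chD_apply, chD_apply, chD_apply, map_sub, map_zsmul, rdelta_rdelta (hF.mem hx), dd_dd,
    Int.negOnePow_succ]
  simp

/-- The families of homomorphisms that vanish on strings of length at most `m`. -/
def lengthFiltration (Q : RMod C) (U : C.Obj) (m : ℕ) : AddSubgroup (CHom Q U) where
  carrier := {F | ∀ Y x W (s : Str C Y W), s.length ≤ m → F Y x W s = 0}
  add_mem' h1 h2 Y x W s hs := by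
    simp only [Pi.add_apply, LinearMap.add_apply, h1 Y x W s hs, h2 Y x W s hs, add_zero]
  zero_mem' _ _ _ _ _ := rfl
  neg_mem' h Y x W s hs := by
    simp only [Pi.neg_apply, LinearMap.neg_apply, h Y x W s hs, neg_zero]

/-- The homomorphism `x ↦ (f, s) ↦ (-1) ^ (n - 1) F (h (x f)) (1, s)`, with Koszul signs, induced by
a linear contraction `h` of the source. -/
def precompContraction (h : ∀ Y, Q.carrier Y →ₗ[k] Q.carrier Y) (n : ℤ) (F : CHom Q U) :
    CHom Q U := fun Y => LinearMap.pi fun W => LinearMap.pi fun s =>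
  match s with
  | .nil _ => 0
  | @Str.cons _ _ _ _ V _ f s => ((n - 1).negOnePow : ℤ) • (LinearMap.proj (.cons (C.one V) s) ∘ₗ
      LinearMap.proj W ∘ₗ F V ∘ₗ sg k 1 ∘ₗ h V ∘ₗ Q.act.flip f ∘ₗ sg k 1)

theorem precompContraction_nil (h : ∀ Y, Q.carrier Y →ₗ[k] Q.carrier Y) (n : ℤ) (F : CHom Q U)
    {Y : C.Obj} (x : Q.carrier Y) : precompContraction h n F Y x Y (.nil Y) = 0 := rfl

theorem rtail_precompContraction (h : ∀ Y, Q.carrier Y →ₗ[k] Q.carrier Y) (n : ℤ) (F : CHom Q U)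
    {Y V : C.Obj} (x : Q.carrier Y) (f : C.Mor Y V) :
    rtail f (precompContraction h n F Y x) = ((n - 1).negOnePow : ℤ) •
      rtail (C.one V) (F V (sg k 1 (h V (Q.act (sg k 1 x) f)))) := rfl

theorem precompContraction_cons (h : ∀ Y, Q.carrier Y →ₗ[k] Q.carrier Y) (n : ℤ) (F : CHom Q U)
    {Y V W : C.Obj} (x : Q.carrier Y) (f : C.Mor Y V) (s : Str C V W) :
    precompContraction h n F Y x W (.cons f s) = ((n - 1).negOnePow : ℤ) •
      F V (sg k 1 (h V (Q.act (sg k 1 x) f))) W (.cons (C.one V) s) := rfl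

theorem IsCHom.precompContraction {h : ∀ Y, Q.carrier Y →ₗ[k] Q.carrier Y}
    (hh : ∀ {Y i j x}, x ∈ pc k (Q.carrier Y) i j → h Y x ∈ pc k (Q.carrier Y) (i - 1) j)
    {n j : ℤ} {F : CHom Q U} (hF : IsCHom n j F) :
    IsCHom (n - 1) j (precompContraction h n F) where
  mem {Y i i' x} hx := by
    refine ⟨fun W X V s t c f f' => ?_, fun {W s p q} hs => ?_⟩
    · cases s with
      | nil =>
        simp only [Str.append, precompContraction_cons, map_add, map_smul]
        simp only [Pi.add_apply, Pi.smul_apply]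
        module
      | cons g s =>
        simp only [Str.append, precompContraction_cons]
        refine (congrArg (fun v => ((n - 1).negOnePow : ℤ) • v)
          ((hF.isMultilinear _ W).tail (C.one _) X V s t c f f')).trans ?_
        simp only [smul_add, smul_comm c]
    · cases hs with
      | nil => exact zero_mem _
      | @cons _ _ _ f s i2 j2 p q hf hs =>
        rw [precompContraction_cons]
        refine zsmul_mem ?_ _
        have := (hF.mem (sg_mem k 1 (hh (Q.act_mem (sg_mem k 1 hx) hf)))).2
          (Str.HasDeg.cons (C.one_mem _) hs)
        rwa [show n + (i + i2 - 1) + (0 - 1 + p) = n - 1 + i + (i2 - 1 + p) by ring,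
          show j + (i' + j2) + (0 + q) = j + i' + (j2 + q) by ring] at this
  act {Y X} x g := by
    funext W s
    cases s with
    | nil => rw [rract_nil, precompContraction_nil, precompContraction_nil, map_zero,
        LinearMap.zero_apply]
    | cons f s =>
      rw [rract_cons, precompContraction_cons, precompContraction_cons, RMod.sg_act, Q.act_act]

/-- The induced contraction inverts the differential up to strings of greater length. -/
theorem sub_chD_precompContraction_mem {h : ∀ Y, Q.carrier Y →ₗ[k] Q.carrier Y}
    (hh : ∀ {Y i j x}, x ∈ pc k (Q.carrier Y) i j → h Y x ∈ pc k (Q.carrier Y) (i - 1) j)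
    (hc : ∀ {Y} (x : Q.carrier Y), dd k (h Y x) + h Y (dd k x) = x)
    {n j : ℤ} {F : CHom Q U} (hF : IsCHom n j F) (hd : GradedKeller.chD n F = 0) {m : ℕ}
    (hFm : F ∈ lengthFiltration Q U m) :
    F - GradedKeller.chD (n - 1) (GradedKeller.precompContraction h n F) ∈
      lengthFiltration Q U (m + 1) := by
  have hG := hF.precompContraction hh
  have hDG := hG.chD
  rw [sub_add_cancel] at hDG
  have hGm : ∀ {Y x W} (s : Str C Y W), s.length ≤ m →
      GradedKeller.precompContraction h n F Y x W s = 0 := by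
    intro Y x W s hs
    cases s with
    | nil => rfl
    | cons f s => rw [precompContraction_cons, hFm _ _ _ _ (by simpa [Str.length] using hs),
        smul_zero]
  have hdF : ∀ {Y} (x : Q.carrier Y), rdelta C U Y (F Y x) = (n.negOnePow : ℤ) • F Y (dd k x) := by
    intro Y x
    rw [← sub_eq_zero, ← chD_apply, hd]
    rfl
  intro Y x W s hs
  cases s with
  | nil =>
    have h0 : rdelta C U Y (GradedKeller.precompContraction h n F Y x) Y (.nil Y) = 0 :=
      rdelta_eq_zero_of_length (m := m) (fun W t ht => hGm t ht) (Nat.zero_le _)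
    rw [Pi.sub_apply, LinearMap.sub_apply, chD_apply]
    simp only [Pi.sub_apply, Pi.smul_apply]
    rw [h0, hFm _ _ _ _ (Nat.zero_le _), precompContraction_nil]
    simp
  | @cons _ V _ f s =>
    have hs' : s.length ≤ m := by simpa [Str.length] using hs
    let L : Q.carrier Y →ₗ[k] C.Mor U W := LinearMap.proj (.cons f s) ∘ₗ LinearMap.proj W ∘ₗ
      (F - GradedKeller.chD (n - 1) (GradedKeller.precompContraction h n F)) Y
    suffices H : L = 0 from LinearMap.congr_fun H x
    refine ext_pc k fun i i' x hx => ?_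
    suffices H : (((hF.sub hDG).isMultilinear x W).headMap V s) = 0 from LinearMap.congr_fun H f
    refine ext_pc k fun i2 j2 f hf => ?_
    change rtail f ((F - GradedKeller.chD (n - 1) (GradedKeller.precompContraction h n F)) Y x) W s
      = 0
    set y := sg k 1 (h V (Q.act (sg k 1 x) f)) with hy_def
    have hy : y ∈ pc k (Q.carrier V) (i + i2 - 1) (i' + j2) :=
      sg_mem k 1 (hh (Q.act_mem (sg_mem k 1 hx) hf))
    -- the right action on strings of length at most `m` only sees values that vanish
    have e1 : rract f (GradedKeller.precompContraction h n F Y x) W s = 0 := by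
      cases s with
      | nil => rw [rract_nil, precompContraction_nil, map_zero, LinearMap.zero_apply]
      | cons g s => rw [rract_cons, hGm _ (by simpa [Str.length] using hs')]
    -- the effect of the differential of `Q`
    have e2 : Q.act x (sg k 1 f) + dd k y - (i.negOnePow : ℤ) •
        sg k 1 (h V (Q.act (sg k 1 x) (dd k f))) + sg k 1 (h V (Q.act (sg k 1 (dd k x)) f)) = 0 := by
      have h1 := hc (Q.act (sg k 1 x) f)
      have h2 : Q.act x (sg k 1 f) = sg k 1 (Q.act (sg k 1 x) f) := by
        rw [RMod.sg_act, sg_one_sg_one]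
      have h3 : (i.negOnePow : ℤ) • Q.act (sg k 1 x) (dd k f) = Q.act x (dd k f) := by
        rw [sg_of_mem k 1 hx, one_mul, map_zsmul, LinearMap.smul_apply, smul_smul,
          negOnePow_mul_self, one_smul]
      have h4 : (i.negOnePow : ℤ) • sg k 1 (h V (Q.act (sg k 1 x) (dd k f))) =
          sg k 1 (h V (Q.act x (dd k f))) := by
        rw [← h3, map_zsmul, map_zsmul]
      rw [hy_def, h2, h4, dd_sg]
      conv_lhs => enter [1, 1, 1]; rw [← h1]
      rw [Q.leibniz, dd_sg, sg_one_sg_one]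
      simp only [map_add, Int.negOnePow_one, Units.val_neg, Units.val_one, neg_smul, one_smul,
        map_neg, LinearMap.neg_apply]
      abel
    have e3 := congrFun (congrFun (congrArg (rtail (U := U) (C.one V)) (congrArg (F V) e2)) W) s
    have e4 : rtail (C.one V) (F V (Q.act x (sg k 1 f))) = rtail f (F Y x) := by
      rw [hF.act, rtail_rract, sg_one_sg_one, C.comp_one]
    have e5 : F V y W s = 0 := hFm _ _ _ _ hs'
    have e6 := congrFun (congrFun (rtail_one_rdelta (hF.mem hy)) W) s
    rw [hdF] at e6
    simp only [map_add, map_sub, map_zsmul, map_zero, Pi.add_apply, Pi.sub_apply, Pi.smul_apply,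
      Pi.zero_apply, e4, e5, smul_zero, add_zero] at e3 e6
    rw [Pi.sub_apply, LinearMap.sub_apply, chD_apply, map_sub, map_sub, map_zsmul,
      rtail_rdelta (hG.mem hx) hf]
    simp only [rtail_precompContraction, map_zsmul, Pi.add_apply, Pi.sub_apply, Pi.smul_apply, e1,
      ← hy_def, ← e6]
    have s1 : (((n - 1).negOnePow : ℤˣ) : ℤ) = - (n.negOnePow : ℤ) := by
      rw [Int.negOnePow_sub]; simp
    have s2 : (((n - 1 + i).negOnePow : ℤˣ) : ℤ) = - ((n.negOnePow : ℤ) * i.negOnePow) := by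
      rw [Int.negOnePow_add, Units.val_mul, s1]; ring
    rw [s1, s2]
    refine Eq.trans ?_ e3
    have q1 := negOnePow_mul_self n
    set e : ℤ := (n.negOnePow : ℤ)
    clear_value e
    rcases mul_self_eq_one_iff.mp q1 with he | he <;> rw [he] <;> module

/-- Homomorphisms from an acyclic module to the one-sided cochains that vanish on empty strings form
an acyclic complex: those cochains are a relatively injective module up to filtration by length. -/
theorem exists_primitive_of_acyclic (hQ : Q.Acyclic) {n j : ℤ} {F : CHom Q U}
    (hF : IsCHom n j F) (h0 : ∀ Y x, F Y x Y (.nil Y) = 0) (hd : chD n F = 0) :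
    ∃ G : CHom Q U, IsCHom (n - 1) j G ∧ (∀ Y x, G Y x Y (.nil Y) = 0) ∧ chD (n - 1) G = F := by
  obtain ⟨h, hh, hc⟩ := hQ.exists_contraction
  have key : ∃ G : CHom Q U, (IsCHom (n - 1) j G ∧ ∀ Y x, G Y x Y (.nil Y) = 0) ∧
      (chD (n - 1)).toAddMonoidHom G = F := by
    refine exists_of_complete_filtration (chD (n - 1)).toAddMonoidHom (lengthFiltration Q U)
      (lengthFiltration Q U) (fun G => IsCHom (n - 1) j G ∧ ∀ Y x, G Y x Y (.nil Y) = 0)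
      (fun F => IsCHom n j F ∧ chD n F = 0) ?_ ?_ ?_ ?_ ?_ ⟨hF, hd⟩
    · intro m F hF Y x W s hs
      simp only [LinearMap.toAddMonoidHom_coe, chD_apply, Pi.sub_apply, Pi.smul_apply]
      rw [rdelta_eq_zero_of_length (hF Y x) hs, hF Y _ W s hs]
      simp
    · intro F hF
      funext Y
      ext x W s
      exact hF s.length Y x W s le_rfl
    · intro ψ hψ hψH
      -- The sum of the `ψ i` is finite on every string, as `ψ i` vanishes in length at most `i`.
      let y : CHom Q U := fun Y => LinearMap.pi fun W => LinearMap.pi fun s =>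
        ∑ i ∈ Finset.range s.length, LinearMap.proj s ∘ₗ LinearMap.proj W ∘ₗ ψ i Y
      have hy : ∀ Y x W (s : Str C Y W),
          y Y x W s = ∑ i ∈ Finset.range s.length, ψ i Y x W s := fun Y x W s => by
        simp [y, LinearMap.sum_apply]
      refine ⟨y, ⟨⟨fun {Y i i' x} hx => ⟨fun W X V s t c f f' => ?_, fun {W s p q} hs => ?_⟩,
        fun {Y X} x g => ?_⟩, fun Y x => ?_⟩, fun m Y x W s hs => ?_⟩
      · simp only [hy, Str.length_append, Str.length]
        rw [Finset.smul_sum, ← Finset.sum_add_distrib]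
        exact Finset.sum_congr rfl fun m _ => (hψH m).1.isMultilinear x W X V s t c f f'
      · rw [hy]
        exact sum_mem fun m _ => ((hψH m).1.mem hx).2 hs
      · funext W s
        cases s with
        | nil => simp [hy, rract_nil, Str.length]
        | cons f s =>
          rw [rract_cons, hy, hy]
          refine Finset.sum_congr rfl fun m _ => ?_
          rw [(hψH m).1.act, rract_cons]
      · simp [hy, Str.length]
      · rw [Pi.sub_apply, LinearMap.sub_apply, Pi.sub_apply, Pi.sub_apply, hy, sub_eq_zero,
          Finset.sum_apply, LinearMap.sum_apply, Finset.sum_apply, Finset.sum_apply]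
        refine Finset.sum_subset (fun i hi => ?_) fun i _ hi => ?_
        · simp only [Finset.mem_range] at *
          omega
        · exact hψ i Y x W s (by simpa using hi)
    · rintro m F hFm ⟨hF, hd⟩
      have hG := hF.precompContraction hh
      have hGm : precompContraction h n F ∈ lengthFiltration Q U m := by
        intro Y x W s hs
        cases s with
        | nil => rfl
        | cons f s => rw [precompContraction_cons, hFm _ _ _ _ (by simpa [Str.length] using hs),
            smul_zero]
      have hDG := hG.chD
      rw [sub_add_cancel] at hDG
      have hDDG := chD_chD hG
      rw [sub_add_cancel] at hDDG
      refine ⟨precompContraction h n F, hGm, ⟨hG, fun _ _ => rfl⟩, ?_, hF.sub hDG, ?_⟩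
      · exact sub_chD_precompContraction_mem hh hc hF hd hFm
      · simp only [LinearMap.toAddMonoidHom_coe, map_sub, hd, hDDG, sub_zero]
    · intro Y x W s hs
      cases s with
      | nil => exact h0 Y x
      | cons => simp [Str.length] at hs
  obtain ⟨G, ⟨h1, h2⟩, h3⟩ := key
  exact ⟨G, h1, h2, h3⟩

end CoindHom

/-! ### Derived endomorphisms and one-sided cochains -/

section Chase

variable {k : Type u} [Field k] {C : BigradedDGCategory k} {U : C.Obj}

/-- The number of entries of a string before it leaves the object `U`. (It is only used for strings
that start at `U`.) -/
def Str.depth (U : C.Obj) : {Z X : C.Obj} → Str C Z X → ℕ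
  | _, _, .nil _ => 0
  | _, _, @Str.cons _ _ _ _ Y _ _ s => open Classical in if Y = U then s.depth U + 1 else 0

theorem Str.depth_cons_self {Z X : C.Obj} (g : C.Mor Z U) (s : Str C U X) :
    (Str.cons g s).depth U = s.depth U + 1 := by
  simp [Str.depth]

theorem Str.depth_cons_of_ne {Z Y X : C.Obj} (h : Y ≠ U) (g : C.Mor Z Y) (s : Str C Y X) :
    (Str.cons g s).depth U = 0 := by
  simp [Str.depth, h]

/-- The families that vanish on strings of depth less than `m`. -/
def depthFiltration (U V Z : C.Obj) (m : ℕ) : Submodule k (RFam C V Z) where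
  carrier := {χ | ∀ W (s : Str C Z W), s.depth U < m → χ W s = 0}
  add_mem' h1 h2 W s hs := by simp only [Pi.add_apply, h1 W s hs, h2 W s hs, add_zero]
  zero_mem' _ _ _ := rfl
  smul_mem' c χ h W s hs := by simp only [Pi.smul_apply, h W s hs, smul_zero]

/-- The family with value `v` on the empty string and `0` on nonempty strings. -/
def nilFam (U Z : C.Obj) : C.Mor U Z →ₗ[k] RFam C U Z where
  toFun v := fun _ s => match s with
    | .nil _ => v
    | .cons _ _ => 0
  map_add' v w := by funext W s; cases s <;> simp
  map_smul' c v := by funext W s; cases s <;> simp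

theorem nilFam_nil {Z : C.Obj} (v : C.Mor U Z) : nilFam U Z v Z (.nil Z) = v := rfl

theorem nilFam_cons {Z Y W : C.Obj} (v : C.Mor U Z) (g : C.Mor Z Y) (s : Str C Y W) :
    nilFam U Z v W (.cons g s) = 0 := rfl

theorem nilFam_mem {Z : C.Obj} {n j : ℤ} {v : C.Mor U Z} (hv : v ∈ pc k (C.Mor U Z) n j) :
    nilFam U Z v ∈ RCoch C U Z n j := by
  refine ⟨fun W X V s t c f f' => ?_, fun {W s p q} hs => ?_⟩
  · cases s <;> simp [Str.append, nilFam_cons]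
  · cases hs with
    | nil => rw [nilFam_nil, add_zero, add_zero]; exact hv
    | cons => exact zero_mem _

theorem rract_nilFam {Z Y : C.Obj} (v : C.Mor U Z) (g : C.Mor Z Y) :
    rract g (nilFam U Z v) = nilFam U Y (C.comp v g) := by
  funext W s
  cases s with
  | nil => rw [rract_nil, nilFam_nil, nilFam_nil]
  | cons f s => rw [rract_cons, nilFam_cons, nilFam_cons]

/-- Homomorphisms of bidegree `(n, j)` from a right dg module to the module of morphisms to `U`. -/
structure IsRHom (P : RMod C) (U : C.Obj) (n j : ℤ) (g : ∀ Y, P.carrier Y →ₗ[k] C.Mor U Y) :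
    Prop where
  mem : ∀ {Y} {i i' : ℤ} {x : P.carrier Y}, x ∈ pc k (P.carrier Y) i i' →
    g Y x ∈ pc k (C.Mor U Y) (n + i) (j + i')
  act : ∀ {Y X} (x : P.carrier Y) (f : C.Mor Y X), g X (P.act x f) = C.comp (g Y x) f

/-- The module `M` of morphisms to `U` with the part at `U` removed, in the presence of a K-projective
resolution `π : P → M` by which the endomorphisms of `U` compute the derived homomorphisms from `M`
to the module of all morphisms to `U`. The map `ι` embeds `M`, with the linear retraction `ρ`; its
image is a submodule since `U` has no morphisms to other objects (`mor_eq_zero`). The fields `π_inj`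
and `π_surj` say that `π` is a quasi-isomorphism, and `keller_inj` and `keller_surj` say that
`b ↦ (x ↦ b (π x))` is one. -/
structure KellerData (C : BigradedDGCategory k) (U : C.Obj) where
  M : RMod C
  ι : ∀ Y, M.carrier Y →ₗ[k] C.Mor U Y
  ι_hom : IsRHom M U 0 0 ι
  ι_dd : ∀ Y x, ι Y (dd k x) = dd k (ι Y x)
  ρ : ∀ Y, C.Mor U Y →ₗ[k] M.carrier Y
  ρ_mem : ∀ {Y i j x}, x ∈ pc k (C.Mor U Y) i j → ρ Y x ∈ pc k (M.carrier Y) i j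
  ρ_ι : ∀ Y x, ρ Y (ι Y x) = x
  ι_ρ : ∀ Y, Y ≠ U → ∀ x, ι Y (ρ Y x) = x
  M_eq_zero : ∀ x : M.carrier U, x = 0
  mor_eq_zero : ∀ Y, Y ≠ U → ∀ x : C.Mor Y U, x = 0
  P : RMod C
  π : ∀ Y, P.carrier Y →ₗ[k] M.carrier Y
  π_hom : RMod.IsHom P M 0 0 π
  π_dd : ∀ Y x, π Y (dd k x) = dd k (π Y x)
  π_inj : ∀ {Y i j} {x : P.carrier Y}, x ∈ pc k (P.carrier Y) i j → dd k x = 0 →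
    (∃ y ∈ pc k (M.carrier Y) (i - 1) j, dd k y = π Y x) →
      ∃ z ∈ pc k (P.carrier Y) (i - 1) j, dd k z = x
  π_surj : ∀ {Y i j} {y : M.carrier Y}, y ∈ pc k (M.carrier Y) i j → dd k y = 0 →
    ∃ x ∈ pc k (P.carrier Y) i j, dd k x = 0 ∧
      ∃ z ∈ pc k (M.carrier Y) (i - 1) j, dd k z = y - π Y x
  kProjective : P.KProjective
  keller_inj : ∀ {n j} {b : C.Mor U U}, b ∈ pc k (C.Mor U U) n j → dd k b = 0 →
    (∃ g, IsRHom P U (n - 1) j g ∧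
      ∀ Y x, homD _ _ (n - 1) (g Y) x = C.comp b (ι Y (π Y x))) →
      ∃ b' ∈ pc k (C.Mor U U) (n - 1) j, dd k b' = b
  keller_surj : ∀ {n j} {g : ∀ Y, P.carrier Y →ₗ[k] C.Mor U Y}, IsRHom P U n j g →
    (∀ Y, homD _ _ n (g Y) = 0) →
      ∃ b ∈ pc k (C.Mor U U) n j, dd k b = 0 ∧ ∃ g', IsRHom P U (n - 1) j g' ∧
        ∀ Y x, homD _ _ (n - 1) (g' Y) x = g Y x - C.comp b (ι Y (π Y x))

namespace KellerData

variable (S : KellerData C U)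

/-- The homomorphism `x ↦ χ x` given by a one-sided cochain at `U`. -/
def pull {χ : RFam C U U} (h : ∀ W, IsMultilinear (χ W)) : CHom S.M U :=
  fun Y => rractL h Y ∘ₗ S.ι Y

theorem pull_apply {χ : RFam C U U} (h : ∀ W, IsMultilinear (χ W)) {Y : C.Obj}
    (x : S.M.carrier Y) : S.pull h Y x = rract (S.ι Y x) χ := rfl

theorem ι_mem {Y : C.Obj} {i j : ℤ} {x : S.M.carrier Y} (hx : x ∈ pc k (S.M.carrier Y) i j) :
    S.ι Y x ∈ pc k (C.Mor U Y) i j := by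
  simpa using S.ι_hom.mem hx

theorem π_mem {Y : C.Obj} {i j : ℤ} {x : S.P.carrier Y} (hx : x ∈ pc k (S.P.carrier Y) i j) :
    S.π Y x ∈ pc k (S.M.carrier Y) i j := by
  simpa using S.π_hom.mem hx

theorem pull_hom {n j : ℤ} {χ : RFam C U U} (h : χ ∈ RCoch C U U n j) :
    IsCHom n j (S.pull h.1) where
  mem hx := rract_mem h (S.ι_mem hx)
  act x g := by rw [pull_apply, pull_apply, S.ι_hom.act, rract_rract]

theorem chD_pull {n j : ℤ} {χ : RFam C U U} (h : χ ∈ RCoch C U U n j) :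
    chD n (S.pull h.1) = S.pull (rdelta_mem h).1 := by
  funext Y
  ext x : 1
  rw [chD_apply, pull_apply, pull_apply, pull_apply, rdelta_rract h, S.ι_dd]
  abel

theorem pull_eq_zero {χ : RFam C U U} (h : ∀ W, IsMultilinear (χ W))
    (h1 : χ ∈ depthFiltration U U U 1) : S.pull h = 0 := by
  funext Y
  ext x : 1
  rw [pull_apply]
  by_cases hY : Y = U
  · subst hY
    rw [S.M_eq_zero x, map_zero]
    exact map_zero (rractL h Y)
  · funext W s
    cases s with
    | nil => rw [rract_nil, h1 _ (.nil U) (by simp [Str.depth]), map_zero]; rfl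
    | @cons _ V _ f s =>
      rw [rract_cons]
      by_cases hV : V = U
      · subst hV
        rw [S.mor_eq_zero Y hY f, map_zero]
        exact map_zero ((h W).headMap V s)
      · exact h1 _ _ (by simp [Str.depth_cons_of_ne hV])

theorem mem_depthFiltration_of_pull_eq_zero {χ : RFam C U U} (h : ∀ W, IsMultilinear (χ W))
    (hnil : χ U (.nil U) = 0) (h0 : S.pull h = 0) : χ ∈ depthFiltration U U U 1 := by
  intro W s hs
  cases s with
  | nil => exact hnil
  | @cons _ V _ x s =>
    by_cases hV : V = U
    · subst hV
      simp [Str.depth_cons_self] at hs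
    · have h1 := congrFun (congrFun (LinearMap.congr_fun (congrFun h0 V) (S.ρ V (sg k 1 x))) W)
        (.cons (C.one V) s)
      rw [pull_apply, rract_cons, S.ι_ρ V hV, sg_one_sg_one, C.comp_one] at h1
      exact h1

/-- The one-sided cochain at `U` given by a homomorphism. -/
def push (F : CHom S.M U) : RFam C U U := fun W s =>
  match s with
  | .nil _ => 0
  | @Str.cons _ _ _ _ V _ x s => F V (S.ρ V (sg k 1 x)) W (.cons (C.one V) s)

theorem push_mem {n j : ℤ} {F : CHom S.M U} (hF : IsCHom n j F) :
    S.push F ∈ RCoch C U U n j := by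
  refine ⟨fun W X V s t c f f' => ?_, fun {W s p q} hs => ?_⟩
  · cases s with
    | nil => simp [Str.append, push]
    | cons g s => exact ((hF.isMultilinear _ W).tail (C.one _)) X V s t c f f'
  · cases hs with
    | nil => exact zero_mem _
    | @cons _ _ _ x s i j' p q hx hs =>
      have := (hF.mem (S.ρ_mem (sg_mem k 1 hx))).2 (Str.HasDeg.cons (C.one_mem _) hs)
      rwa [show n + i + (0 - 1 + p) = n + (i - 1 + p) by ring,
        show j + j' + (0 + q) = j + (j' + q) by ring] at this

theorem pull_push {n j : ℤ} {F : CHom S.M U} (hF : IsCHom n j F)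
    (h0 : ∀ Y x, F Y x Y (.nil Y) = 0) : S.pull (S.push_mem hF).1 = F := by
  funext Y
  ext x W s
  rw [pull_apply]
  cases s with
  | nil => rw [rract_nil, h0]; exact LinearMap.map_zero₂ _ _
  | @cons _ V _ f s =>
    rw [rract_cons]
    change F V (S.ρ V (sg k 1 (C.comp (sg k 1 (S.ι Y x)) f))) W (.cons (C.one V) s) = _
    rw [sg_comp, sg_one_sg_one, ← S.ι_hom.act, S.ρ_ι, hF.act, rract_cons, sg_one_sg_one, C.comp_one]

theorem comp_π_hom {n j : ℤ} {F : CHom S.M U} (hF : IsCHom n j F) :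
    IsCHom (Q := S.P) n j (fun Y => F Y ∘ₗ S.π Y) where
  mem hx := hF.mem (S.π_mem hx)
  act x g := by simp only [LinearMap.comp_apply, S.π_hom.act, hF.act]

theorem chD_comp_π (n : ℤ) (F : CHom S.M U) :
    chD (Q := S.P) n (fun Y => F Y ∘ₗ S.π Y) = fun Y => chD n F Y ∘ₗ S.π Y := by
  funext Y
  ext x : 1
  simp only [chD_apply, LinearMap.comp_apply, S.π_dd]

/-- K-projectivity for homomorphisms with values in one-sided cochains. -/
theorem exists_chD_eq {n j : ℤ} {F : CHom S.P U} (hF : IsCHom n j F) (hd : chD n F = 0) :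
    ∃ G : CHom S.P U, IsCHom (n - 1) j G ∧ chD (n - 1) G = F := by
  obtain ⟨G, hG, hGF⟩ := S.kProjective (RMod.coind C U) (RMod.coind_acyclic U) (n := n) (j := j)
    (F := fun Y => (F Y).codRestrict _ hF.mem_iSup)
    ⟨fun hx => hF.mem hx, fun x g => Subtype.ext (hF.act x g)⟩
    (fun Y => by
      ext x : 1
      exact Subtype.ext (LinearMap.congr_fun (congrFun hd Y) x))
  refine ⟨fun Y => RMod.coindVal U Y ∘ₗ G Y, ⟨fun hx => hG.mem hx, fun x g => ?_⟩, ?_⟩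
  · simp only [LinearMap.comp_apply, hG.act, RMod.coindVal_act]
  · funext Y
    ext x : 1
    exact congrArg (RMod.coindVal U Y) (LinearMap.congr_fun (hGF Y) x)

/-- A one-sided cochain at `U` that is annihilated by the pullback to the resolution is a boundary
modulo strings of positive depth. -/
theorem exists_of_pull_eq {n j : ℤ} {χ : RFam C U U} (h : χ ∈ RCoch C U U n j)
    (hnil : χ U (.nil U) = 0) (hD : rdelta C U U χ ∈ depthFiltration U U U 1)
    {G : CHom S.P U} (hG : IsCHom (n - 1) j G) (hGnil : ∀ Y x, G Y x Y (.nil Y) = 0)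
    (hGD : chD (n - 1) G = fun Y => S.pull h.1 Y ∘ₗ S.π Y) :
    ∃ ψ ∈ RCoch C U U (n - 1) j, χ - rdelta C U U ψ ∈ depthFiltration U U U 1 := by
  let Q := RMod.cone S.π_hom S.π_dd
  have hQ : Q.Acyclic := RMod.cone_acyclic S.π_hom S.π_dd S.π_inj S.π_surj
  have hpull := S.pull_hom h
  have hpull0 : chD n (S.pull h.1) = 0 := by
    rw [S.chD_pull h]
    exact S.pull_eq_zero _ hD
  -- With this sign, `χ` and `G` together form a cocycle on the cone of `π`.
  let H : CHom Q U := fun Y => S.pull h.1 Y ∘ₗ LinearMap.snd k _ _ +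
    (n.negOnePow : ℤ) • (G Y ∘ₗ LinearMap.fst k _ _)
  have hH : ∀ Y (p : S.P.carrier Y) (x : S.M.carrier Y), H Y (p, x) =
      S.pull h.1 Y x + (n.negOnePow : ℤ) • G Y p := fun Y p x => rfl
  have hHhom : IsCHom n j H := by
    refine ⟨?_, ?_⟩
    · rintro Y i i' ⟨p, x⟩ ⟨hp, hx⟩
      rw [hH]
      refine add_mem (hpull.mem hx) (zsmul_mem ?_ _)
      have := hG.mem hp
      rwa [show n - 1 + (i + 1) = n + i by ring] at this
    · rintro Y X ⟨p, x⟩ g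
      change H X (S.P.act p g, S.M.act x g) = _
      rw [hH, hH, hpull.act, hG.act, map_add, map_zsmul]
  have hHD : chD n H = 0 := by
    funext Y
    refine LinearMap.ext ?_
    rintro ⟨p, x⟩
    have h1 : rdelta C U Y (S.pull h.1 Y x) - (n.negOnePow : ℤ) • S.pull h.1 Y (dd k x) = 0 :=
      LinearMap.congr_fun (congrFun hpull0 Y) x
    replace h1 := sub_eq_zero.1 h1
    have h2 : rdelta C U Y (G Y p) - ((n - 1).negOnePow : ℤ) • G Y (dd k p) =
        S.pull h.1 Y (S.π Y p) := LinearMap.congr_fun (congrFun hGD Y) p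
    change rdelta C U Y (H Y (p, x)) -
      (n.negOnePow : ℤ) • H Y (-dd k p, S.π Y p + dd k x) = 0
    rw [hH, hH]
    simp only [map_add, map_neg, map_zsmul, ← h2]
    rw [Int.negOnePow_sub] at *
    simp only [Units.val_mul, Int.negOnePow_one, Units.val_neg, Units.val_one] at *
    rw [h1]
    have q1 := negOnePow_mul_self n
    set e : ℤ := (n.negOnePow : ℤ)
    clear_value e
    rcases mul_self_eq_one_iff.mp q1 with he | he <;> rw [he] <;> module
  obtain ⟨E, hE, hEnil, hED⟩ := exists_primitive_of_acyclic hQ hHhom (fun Y x => by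
    obtain ⟨p, x⟩ := x
    rw [hH, Pi.add_apply, Pi.add_apply, Pi.smul_apply, Pi.smul_apply, hGnil, pull_apply, rract_nil,
      hnil]
    simp) hHD
  -- The restriction to `M` of a primitive on the cone is a primitive of the pullback of `χ`.
  let F : CHom S.M U := fun Y => E Y ∘ₗ LinearMap.inr k _ _
  have hF : IsCHom (n - 1) j F := by
    refine ⟨fun hx => hE.mem ⟨zero_mem _, hx⟩, fun {Y X} x g => ?_⟩
    have := hE.act (X := X) ((0, x) : S.P.carrier Y × S.M.carrier Y) g
    have e : Q.act ((0, x) : S.P.carrier Y × S.M.carrier Y) g =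
      ((0, S.M.act x g) : S.P.carrier X × S.M.carrier X) :=
      Prod.ext (LinearMap.map_zero₂ _ _) rfl
    rw [e] at this
    exact this
  have hFD : chD (n - 1) F = S.pull h.1 := by
    funext Y
    ext x : 1
    have := LinearMap.congr_fun (congrFun hED Y) ((0, x) : S.P.carrier Y × S.M.carrier Y)
    change rdelta C U Y (E Y (0, x)) -
      ((n - 1).negOnePow : ℤ) • E Y (-dd k 0, S.π Y 0 + dd k x) = H Y (0, x) at this
    rw [hH, map_zero, map_zero, map_zero, neg_zero, zero_add, smul_zero, add_zero] at this
    exact this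
  have hψ := S.push_mem hF
  have hDψ := rdelta_mem hψ
  rw [sub_add_cancel] at hDψ
  refine ⟨S.push F, hψ, S.mem_depthFiltration_of_pull_eq_zero (sub_mem h hDψ).1 ?_ ?_⟩
  · rw [Pi.sub_apply, Pi.sub_apply, rdelta_nil, hnil]
    simp [push]
  · have e := S.chD_pull hψ
    rw [S.pull_push hF fun Y x => hEnil Y _, hFD] at e
    funext Y
    ext x : 1
    have e' := LinearMap.congr_fun (congrFun e Y) x
    rw [pull_apply, pull_apply] at e'
    rw [pull_apply, map_sub, e', sub_self]
    rfl

/-- The one-sided cochains at `U` are acyclic modulo strings of positive depth: this is the Keller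
condition expressed by the bar resolution instead of a K-projective resolution. -/
theorem exists_sub_rdelta_mem (S : KellerData C U) {n j : ℤ} {χ : RFam C U U}
    (h : χ ∈ RCoch C U U n j)
    (hD : rdelta C U U χ ∈ depthFiltration U U U 1) :
    ∃ ψ ∈ RCoch C U U (n - 1) j, χ - rdelta C U U ψ ∈ depthFiltration U U U 1 := by
  have hb := RCoch.nil_mem h
  set b := χ U (.nil U) with hb_def
  have hbd : dd k b = 0 := by
    rw [hb_def, ← rdelta_nil]
    exact hD _ _ (by simp [Str.depth])
  have hpull := S.pull_hom h
  have hpull0 : chD n (S.pull h.1) = 0 := by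
    rw [S.chD_pull h]
    exact S.pull_eq_zero _ hD
  obtain ⟨G, hG, hGD⟩ := S.exists_chD_eq (S.comp_π_hom hpull) (by
    rw [S.chD_comp_π, hpull0]
    rfl)
  -- The values of `G` on empty strings show that `b` acts null-homotopically, so it is a boundary.
  let g : ∀ Y, S.P.carrier Y →ₗ[k] C.Mor U Y := fun Y =>
    LinearMap.proj (.nil Y) ∘ₗ LinearMap.proj Y ∘ₗ G Y
  have hg_apply : ∀ Y x, g Y x = G Y x Y (.nil Y) := fun Y x => rfl
  have hg : IsRHom S.P U (n - 1) j g :=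
    ⟨fun hx => RCoch.nil_mem (hG.mem hx), fun x f => by
      rw [hg_apply, hG.act, rract_nil]
      rfl⟩
  have hgD : ∀ Y x, homD _ _ (n - 1) (g Y) x = C.comp b (S.ι Y (S.π Y x)) := by
    intro Y x
    have := congrFun (congrFun (LinearMap.congr_fun (congrFun hGD Y) x) Y) (.nil Y)
    rw [chD_apply, LinearMap.comp_apply, pull_apply, rract_nil, Pi.sub_apply, Pi.sub_apply,
      rdelta_nil] at this
    exact this
  obtain ⟨b', hb', hdb'⟩ := S.keller_inj hb hbd ⟨g, hg, hgD⟩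
  have hmul : ∀ {m i : ℤ} {c : C.Mor U U}, c ∈ pc k (C.Mor U U) m i →
      IsRHom S.P U m i fun Y => C.comp c ∘ₗ S.ι Y ∘ₗ S.π Y := fun hc =>
    ⟨fun hx => C.comp_mem hc (S.ι_mem (S.π_mem hx)), fun x f => by
      simp only [LinearMap.comp_apply, S.π_hom.act, S.ι_hom.act, C.assoc]⟩
  have hmulD : ∀ {m i : ℤ} {c : C.Mor U U}, c ∈ pc k (C.Mor U U) m i → ∀ Y x,
      homD _ _ m (C.comp c ∘ₗ S.ι Y ∘ₗ S.π Y) x = C.comp (dd k c) (S.ι Y (S.π Y x)) := by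
    intro m i c hc Y x
    rw [homD_apply]
    simp only [LinearMap.comp_apply, S.π_dd, S.ι_dd, C.leibniz]
    rw [sg_of_mem k 1 hc, one_mul, map_zsmul, LinearMap.smul_apply, add_sub_cancel_right]
  -- They need not be given by the primitive `b'`, but they differ from it by a cocycle, which is given
  -- by some `b''` up to a homotopy `g'`.
  obtain ⟨b'', hb'', hdb'', g', hg', hgD'⟩ := S.keller_surj (n := n - 1) (j := j)
    (g := fun Y => g Y - C.comp b' ∘ₗ S.ι Y ∘ₗ S.π Y)
    ⟨fun hx => sub_mem (hg.mem hx) ((hmul hb').mem hx), fun x f => by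
      have := (hmul hb').act x f
      simp only [LinearMap.sub_apply] at this ⊢
      rw [this, hg.act, map_sub, LinearMap.sub_apply]⟩
    (fun Y => by
      ext x : 1
      rw [map_sub, LinearMap.sub_apply, hmulD hb', hgD, hdb', sub_self, LinearMap.zero_apply])
  -- After subtraction of the boundaries of `b' + b''` from `χ` and of `g'` from `G`, both vanish on
  -- empty strings.
  have hb1 := add_mem hb' hb''
  have hb1d : dd k (b' + b'') = b := by rw [map_add, hdb', hdb'', add_zero]
  have h0 := nilFam_mem hb1
  have hDh0 := rdelta_mem h0
  rw [sub_add_cancel] at hDh0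
  let G' : CHom S.P U := fun Y => nilFam U Y ∘ₗ g' Y
  have hG' : IsCHom (n - 1 - 1) j G' :=
    ⟨fun hx => nilFam_mem (hg'.mem hx), fun x f => by
      simp only [G', LinearMap.comp_apply]
      rw [hg'.act, rract_nilFam]⟩
  have hDG' := hG'.chD
  rw [sub_add_cancel] at hDG'
  have hDDG' := chD_chD hG'
  rw [sub_add_cancel] at hDDG'
  have h1 : χ - rdelta C U U (nilFam U U (b' + b'')) ∈ RCoch C U U n j := sub_mem h hDh0
  obtain ⟨ψ, hψ, hψ'⟩ := S.exists_of_pull_eq h1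
    (by
      rw [Pi.sub_apply, Pi.sub_apply, rdelta_nil, nilFam_nil, hb1d, sub_self])
    (by
      rw [map_sub, rdelta_rdelta h0, sub_zero]
      exact hD)
    (G := G - chD (n - 1 - 1) G' - fun Y => S.pull h0.1 Y ∘ₗ S.π Y)
    ((hG.sub hDG').sub (S.comp_π_hom (S.pull_hom h0)))
    (fun Y x => by
      have e1 := hgD' Y x
      rw [homD_apply, LinearMap.sub_apply, hg_apply] at e1
      simp only [LinearMap.comp_apply] at e1
      simp only [Pi.sub_apply, LinearMap.sub_apply, chD_apply, rdelta_nil, Pi.smul_apply,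
        LinearMap.comp_apply, pull_apply, rract_nil, nilFam_nil, G', e1]
      simp only [map_add, LinearMap.add_apply]
      abel)
    (by
      rw [map_sub, map_sub, hGD, hDDG', S.chD_comp_π, S.chD_pull h0, sub_zero]
      funext Y
      ext x : 1
      simp only [Pi.sub_apply, LinearMap.sub_apply, LinearMap.comp_apply, pull_apply, map_sub])
  refine ⟨nilFam U U (b' + b'') + ψ, add_mem h0 hψ, ?_⟩
  rw [map_add, ← sub_sub]
  exact hψ'

end KellerData

end Chase

/-! ### Contraction of the graded pieces of the filtration by depth -/

section Support

variable {k : Type u} [Field k] {C : BigradedDGCategory k} {U : C.Obj}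

/-- The differential of one-sided cochains preserves the filtration by depth if no nonzero morphism
leads back to `U` (composition along such a morphism would increase the depth). -/
theorem rdelta_mem_depthFiltration (hU : ∀ Y, Y ≠ U → ∀ x : C.Mor Y U, x = 0) (m : ℕ) :
    ∀ {n j : ℤ} {χ : RFam C U U}, χ ∈ RCoch C U U n j → χ ∈ depthFiltration U U U m →
      rdelta C U U χ ∈ depthFiltration U U U m := by
  induction m with
  | zero => intro n j χ _ _ W s hs; exact absurd hs (Nat.not_lt_zero _)
  | succ m ih =>
    intro n j χ h hm W s hs
    cases s with
    | nil =>
      rw [rdelta_nil, hm _ _ (by simp [Str.depth]), map_zero]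
    | @cons _ Y _ g s =>
      have : ((rdelta_mem h).1 W).headMap Y s = 0 := by
        refine ext_pc k fun i j' g hg => ?_
        change rtail g (rdelta C U U χ) W s = 0
        rw [rtail_rdelta h hg]
        simp only [Pi.add_apply, Pi.smul_apply]
        by_cases hY : Y = U
        · subst hY
          rw [Str.depth_cons_self] at hs
          have h1 : ∀ g : C.Mor Y Y, rtail g χ ∈ depthFiltration Y Y Y m := fun g V t ht =>
            hm _ (.cons g t) (by rw [Str.depth_cons_self]; omega)
          rw [ih (rtail_mem h hg) (h1 g) W s (by omega), h1 _ W s (by omega)]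
          have h2 : rract g χ W s = 0 := by
            cases s with
            | nil => rw [rract_nil, hm _ _ (by simp [Str.depth]), LinearMap.map_zero₂]
            | @cons _ V _ f s =>
              rw [rract_cons]
              refine hm _ _ ?_
              have : (Str.cons (C.comp (sg k 1 g) f) s).depth Y = (Str.cons f s).depth Y := rfl
              omega
          rw [h2]
          simp
        · have h1 : ∀ g : C.Mor U Y, rtail g χ = 0 := fun g => by
            funext V t
            exact hm _ (.cons g t) (by rw [Str.depth_cons_of_ne hY]; omega)
          have h2 : rract g χ W s = 0 := by
            cases s with
            | nil => rw [rract_nil, hm _ _ (by simp [Str.depth]), LinearMap.map_zero₂]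
            | @cons _ V _ f s =>
              rw [rract_cons]
              by_cases hV : V = U
              · subst hV
                rw [hU Y hY f, map_zero]
                exact map_zero ((h.1 W).headMap V s)
              · exact hm _ _ (by rw [Str.depth_cons_of_ne hV]; omega)
          rw [h1, h1, h2, map_zero]
          simp
      exact LinearMap.congr_fun this g

/-- Application of operators `H Y` to a family with its first entry, of target `Y`, held fixed. -/
def applyTail (H : ∀ Y, RFam C U Y →ₗ[k] RFam C U Y) (Z : C.Obj) : RFam C U Z →ₗ[k] RFam C U Z where
  toFun θ := fun W s => match s with
    | .nil _ => 0
    | @Str.cons _ _ _ _ Y _ g s => H Y (rtail g θ) W s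
  map_add' θ θ' := by funext W s; cases s <;> simp
  map_smul' c θ := by funext W s; cases s <;> simp

theorem applyTail_cons (H : ∀ Y, RFam C U Y →ₗ[k] RFam C U Y) {Z Y W : C.Obj} (θ : RFam C U Z)
    (g : C.Mor Z Y) (s : Str C Y W) : applyTail H Z θ W (.cons g s) = H Y (rtail g θ) W s := rfl

theorem applyTail_mem {H : ∀ Y, RFam C U Y →ₗ[k] RFam C U Y}
    (hH : ∀ {Y n j} {θ : RFam C U Y}, θ ∈ RCoch C U Y n j → H Y θ ∈ RCoch C U Y (n - 1) j)
    {Z : C.Obj} {n j : ℤ} {θ : RFam C U Z} (h : θ ∈ RCoch C U Z n j) :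
    applyTail H Z θ ∈ RCoch C U Z (n - 1) j := by
  refine ⟨fun W X V s t c f f' => ?_, fun {W s p q} hs => ?_⟩
  · cases s with
    | nil =>
      have := map_add (H V ∘ₗ rtailL h.1 V) (c • f) f'
      rw [map_smul] at this
      exact congrFun (congrFun this W) t
    | @cons _ Y _ g s =>
      have hg : H Y (rtail g θ) ∈ ⨆ e : ℤ × ℤ, RCoch C U Y e.1 e.2 :=
        mem_of_forall_pc (H Y ∘ₗ rtailL h.1 Y) _ (fun i j' x hx =>
          (le_iSup (fun e : ℤ × ℤ => RCoch C U Y e.1 e.2) (_, _)) (hH (rtail_mem h hx))) g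
      exact RMod.isMultilinear_of_mem_iSup hg W X V s t c f f'
  · cases hs with
    | nil => exact zero_mem _
    | @cons _ _ _ x s i j' p q hx hs =>
      have := (hH (rtail_mem h hx)).2 hs
      rwa [show n + (i - 1) - 1 + p = n - 1 + (i - 1 + p) by ring,
        show j + j' + q = j + (j' + q) by ring] at this

/-- Contractions of the graded pieces of the filtration by depth: as the pieces are the spaces of
multilinear maps from powers of the endomorphisms of `U` to the piece of depth `0`, a contraction
of the latter is applied to the remaining entries. -/
theorem KellerData.exists_depth_contraction (S : KellerData C U) (m : ℕ) :
    ∃ H : ∀ Y, RFam C U Y →ₗ[k] RFam C U Y, (∀ Y, Y ≠ U → H Y = 0) ∧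
      (∀ {Y n j} {θ : RFam C U Y}, θ ∈ RCoch C U Y n j → H Y θ ∈ RCoch C U Y (n - 1) j) ∧
      (∀ θ, H U θ ∈ depthFiltration U U U m) ∧
      (∀ {n j} {θ : RFam C U U}, θ ∈ RCoch C U U n j → θ ∈ depthFiltration U U U (m + 1) →
        H U θ = 0) ∧
      ∀ {n j} {θ : RFam C U U}, θ ∈ RCoch C U U n j → θ ∈ depthFiltration U U U m →
        θ - rdelta C U U (H U θ) - H U (rdelta C U U θ) ∈ depthFiltration U U U (m + 1) := by
  classical
  induction m with
  | zero =>
    obtain ⟨H, h1, h2, h3⟩ := exists_contraction_mod (RCoch.iSupIndep C U U) (rdelta C U U)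
      (depthFiltration U U U 1) rdelta_mem rdelta_rdelta
      (rdelta_mem_depthFiltration S.mor_eq_zero 1) S.exists_sub_rdelta_mem
    obtain ⟨H', hH', hH'0⟩ : ∃ H' : ∀ Y, RFam C U Y →ₗ[k] RFam C U Y, H' U = H ∧
        ∀ Y, Y ≠ U → H' Y = 0 :=
      ⟨Function.update 0 U H, Function.update_self .., fun Y hY => Function.update_of_ne hY ..⟩
    refine ⟨H', hH'0, fun {Y n j θ} h => ?_, fun θ W s hs => absurd hs (Nat.not_lt_zero _), ?_, ?_⟩
    · by_cases hY : Y = U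
      · subst hY
        rw [hH']
        exact h1 h
      · rw [hH'0 Y hY]
        exact zero_mem _
    · rw [hH']
      exact h2
    · rw [hH']
      exact fun h _ => h3 h
  | succ m ih =>
    obtain ⟨H, hH0, hH, hHF, hHR, hHD⟩ := ih
    have hF : ∀ θ, applyTail H U θ ∈ depthFiltration U U U (m + 1) := by
      intro θ W s hs
      cases s with
      | nil => rfl
      | @cons _ Y _ g s =>
        rw [applyTail_cons]
        by_cases hY : Y = U
        · subst hY
          rw [Str.depth_cons_self] at hs
          exact hHF _ W s (by omega)
        · rw [hH0 Y hY]; rfl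
    refine ⟨fun Z => if Z = U then applyTail H Z else 0, fun Y hY => if_neg hY,
      fun {Y n j θ} h => ?_, fun θ => ?_, fun {n j θ} h hR => ?_, fun {n j θ} h hR => ?_⟩
    · dsimp only
      split_ifs
      · exact applyTail_mem hH h
      · exact zero_mem _
    · simp only [if_true]
      exact hF θ
    · simp only [if_true]
      funext W s
      cases s with
      | nil => rfl
      | @cons _ Y _ g s =>
        by_cases hY : Y = U
        · subst hY
          have : H Y ∘ₗ rtailL h.1 Y = 0 := ext_pc k fun i j' g hg =>
            hHR (rtail_mem h hg) fun V t ht =>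
              hR V (.cons g t) (by rw [Str.depth_cons_self]; omega)
          exact congrFun (congrFun (LinearMap.congr_fun this g) W) s
        · rw [applyTail_cons, hH0 Y hY]; rfl
    · simp only [if_true]
      have hHθ := applyTail_mem hH h
      have hDH := rdelta_mem hHθ
      rw [sub_add_cancel] at hDH
      have hD := rdelta_mem h
      have hHD' := applyTail_mem hH hD
      rw [add_sub_cancel_right] at hHD'
      have hE := sub_mem (sub_mem h hDH) hHD'
      have hEF : θ - rdelta C U U (applyTail H U θ) - applyTail H U (rdelta C U U θ) ∈
          depthFiltration U U U (m + 1) :=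
        sub_mem (sub_mem hR (rdelta_mem_depthFiltration S.mor_eq_zero _ hHθ (hF θ))) (hF _)
      intro W s hs
      -- Only the strings of depth exactly `m + 1` matter; on these the recursion for the differential
      -- reduces the claim to the contraction `H` of the piece of depth `m`.
      rcases Nat.lt_succ_iff_lt_or_eq.1 hs with hs | hs
      · exact hEF W s hs
      cases s with
      | nil => simp [Str.depth] at hs
      | @cons _ Y _ g s =>
        by_cases hY : Y = U
        swap
        · rw [Str.depth_cons_of_ne hY] at hs
          omega
        subst hY
        rw [Str.depth_cons_self] at hs
        have : (hE.1 W).headMap Y s = 0 := by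
          refine ext_pc k fun i j' g hg => ?_
          change rtail g (θ - rdelta C Y Y (applyTail H Y θ) -
            applyTail H Y (rdelta C Y Y θ)) W s = 0
          have hθg := rtail_mem h hg
          have hθgF : rtail g θ ∈ depthFiltration Y Y Y m := fun V t ht =>
            hR V (.cons g t) (by rw [Str.depth_cons_self]; omega)
          have e0 := hHD hθg hθgF W s (by omega)
          have ract_mem : ∀ {θ' : RFam C Y Y}, θ' ∈ depthFiltration Y Y Y (m + 1) →
              rract g θ' ∈ depthFiltration Y Y Y (m + 1) := by
            intro θ' hθ' V t ht
            cases t with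
            | nil => rw [rract_nil, hθ' _ _ (by simp [Str.depth]), LinearMap.map_zero₂]
            | @cons _ X _ f t =>
              rw [rract_cons]
              exact hθ' _ _ ht
          have e1 : H Y (rract g θ) = 0 := hHR (rract_mem h hg) (ract_mem hR)
          have e2 := ract_mem (hF θ) W s (by omega)
          have e3 : ∀ g : C.Mor Y Y, rtail g (applyTail H Y θ) = H Y (rtail g θ) := fun g => rfl
          have e4 : rtail g (applyTail H Y (rdelta C Y Y θ)) = H Y (rtail g (rdelta C Y Y θ)) := rfl
          rw [map_sub, map_sub, e4, rtail_rdelta h hg, rtail_rdelta hHθ hg, e3, e3, map_add,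
            map_add, map_zsmul, map_zsmul, e1, Int.negOnePow_sub]
          simp only [Pi.sub_apply, Pi.add_apply, Pi.smul_apply, e2] at e0 ⊢
          rw [sub_sub, sub_eq_zero] at e0
          rw [show rtail g θ W s = _ from e0]
          simp
        exact LinearMap.congr_fun this g

/-! ### Hochschild cocycles supported at an object -/

theorem lmul_eq_zero_of_depth {n : ℤ} {φ : Fam C} {m : ℕ} (h : φ U ∈ depthFiltration U U U m)
    (h0 : ∀ Z, Z ≠ U → φ Z = 0) {W : C.Obj} (s : Str C U W) (hs : s.depth U < m + 1) :
    lmul n (fun Y => φ Y W) s = 0 := by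
  cases s with
  | nil => rfl
  | @cons _ Y _ g s =>
    rw [lmul_cons]
    by_cases hY : Y = U
    · subst hY
      rw [Str.depth_cons_self] at hs
      rw [h W s (by omega), map_zero]
    · rw [h0 Y hY]
      exact map_zero _

theorem delta_eq_rdelta_sub {n j : ℤ} {φ : Fam C} (h : φ ∈ Hoch C n j) {W : C.Obj}
    (s : Str C U W) : delta n φ U W s =
      rdelta C U U (φ U) W s - (n.negOnePow : ℤ) • lmul n (fun Y => φ Y W) s := by
  have hU : φ U ∈ RCoch C U U n j := ⟨fun W => h.1 U W, fun hs => h.2 hs⟩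
  rw [rdelta_apply hU, delta]
  module

theorem delta_eq_zero_of_ne (hU : ∀ Y, Y ≠ U → ∀ x : C.Mor Y U, x = 0) (n : ℤ) {φ : Fam C}
    (h0 : ∀ Z, Z ≠ U → φ Z = 0) {Z : C.Obj} (hZ : Z ≠ U) : delta n φ Z = 0 := by
  funext W s
  have h1 : φ Z W = fun _ => 0 := congrFun (h0 Z hZ) W
  have h2 : lmul n (fun Y => φ Y W) s = 0 := by
    cases s with
    | nil => rfl
    | @cons _ Y _ g s =>
      rw [lmul_cons]
      by_cases hY : Y = U
      · subst hY
        rw [hU Z hZ g, map_zero, LinearMap.map_zero₂]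
      · rw [h0 Y hY]
        exact map_zero _
  have h3 : inner (φ Z W) s = 0 := by
    rw [h1]
    exact inner_map (0 : C.Mor Z W →+ C.Mor Z W) s 0
  have h4 : rmul (fun W t => sg k 1 (φ Z W t)) s = 0 := by
    have := rmul_smul s (0 : k) fun W t => sg k 1 (φ Z W t)
    rw [zero_smul] at this
    rw [h0 Z hZ] at this ⊢
    simpa using this
  rw [delta, h2, h3, h4, h1]
  simp

theorem Str.depth_append_cons {Z Y W X : C.Obj} (s : Str C Z Y) (g g' : C.Mor Y W)
    (t : Str C W X) : (s.append (.cons g t)).depth U = (s.append (.cons g' t)).depth U := by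
  induction s with
  | nil => rfl
  | cons f s ih => simp only [Str.append, Str.depth]; rw [ih g g']

/-- Cocycles that vanish on strings not starting at `U` are boundaries of such cochains. -/
theorem KellerData.exists_delta_eq (S : KellerData C U) {n j : ℤ} {φ : Fam C}
    (h : φ ∈ Hoch C n j) (hδ : delta n φ = 0) (h0 : ∀ Z, Z ≠ U → φ Z = 0) :
    ∃ ψ : Fam C, (ψ ∈ Hoch C (n - 1) j ∧ ∀ Z, Z ≠ U → ψ Z = 0) ∧ delta (n - 1) ψ = φ := by
  classical
  let F : ℕ → AddSubgroup (Fam C) := fun m =>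
    { carrier := {φ | φ U ∈ depthFiltration U U U m ∧ ∀ Z, Z ≠ U → φ Z = 0}
      add_mem' := fun h h' => ⟨add_mem h.1 h'.1, fun Z hZ => by
        rw [Pi.add_apply, h.2 Z hZ, h'.2 Z hZ, add_zero]⟩
      zero_mem' := ⟨zero_mem _, fun Z _ => rfl⟩
      neg_mem' := fun h => ⟨neg_mem h.1, fun Z hZ => by rw [Pi.neg_apply, h.2 Z hZ, neg_zero]⟩ }
  have hRU : ∀ {n j : ℤ} {φ : Fam C}, φ ∈ Hoch C n j → φ U ∈ RCoch C U U n j := fun h =>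
    ⟨fun W => h.1 U W, fun hs => h.2 hs⟩
  suffices H : ∃ ψ : {ψ : Fam C // ψ ∈ Hoch C (n - 1) j}, (∀ Z, Z ≠ U → ψ.1 Z = 0) ∧
      ((deltaL C (n - 1)) ∘ₗ (Hoch C (n - 1) j).subtype).toAddMonoidHom ψ = φ by
    obtain ⟨ψ, hψ, hψδ⟩ := H
    exact ⟨ψ.1, ⟨ψ.2, hψ⟩, hψδ⟩
  refine exists_of_complete_filtration
    (V := {ψ : Fam C // ψ ∈ Hoch C (n - 1) j}) (V' := Fam C)
    (((deltaL C (n - 1)) ∘ₗ (Hoch C (n - 1) j).subtype).toAddMonoidHom)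
    (fun m => (F m).comap (Hoch C (n - 1) j).subtype.toAddMonoidHom) F
    (fun ψ => ∀ Z, Z ≠ U → ψ.1 Z = 0) (fun φ => φ ∈ Hoch C n j ∧ delta n φ = 0) ?_ ?_ ?_ ?_
    (x := φ) ⟨fun W s hs => absurd hs (Nat.not_lt_zero _), h0⟩ ⟨h, hδ⟩
  · rintro m ψ ⟨h1, h2⟩
    refine ⟨fun W s hs => ?_, fun Z hZ => delta_eq_zero_of_ne S.mor_eq_zero _ h2 hZ⟩
    refine (delta_eq_rdelta_sub ψ.2 s).trans ?_
    rw [rdelta_mem_depthFiltration S.mor_eq_zero m (hRU ψ.2) h1 W s hs]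
    rw [show lmul (n - 1) (fun Y => ψ.1 Y W) s = 0 from lmul_eq_zero_of_depth h1 h2 s (by omega)]
    simp
  · intro φ hφ
    funext Z W s
    by_cases hZ : Z = U
    · subst hZ
      exact (hφ (s.depth Z + 1)).1 W s (Nat.lt_succ_self _)
    · rw [(hφ 0).2 Z hZ]
      rfl
  · intro ψ hψ hψ0
    -- The infinite sum of the `ψ i` is finite on every string, as `ψ i` vanishes in depth less than `i`.
    let y : Fam C := fun Z X s => ∑ i ∈ Finset.range (s.depth U + 1), (ψ i).1 Z X s
    have hy : y ∈ Hoch C (n - 1) j := by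
      refine ⟨fun Z X Y W s t c g g' => ?_, fun {Z X s p q} hs =>
        sum_mem fun i _ => (ψ i).2.2 hs⟩
      simp only [y]
      rw [Str.depth_append_cons s (c • g + g') g t, Str.depth_append_cons s g' g t,
        Finset.smul_sum, ← Finset.sum_add_distrib]
      exact Finset.sum_congr rfl fun i _ => (ψ i).2.1 Z X Y W s t c g g'
    have hyU : ∀ Z, Z ≠ U → y Z = 0 := fun Z hZ => by
      funext X s
      exact Finset.sum_eq_zero fun i _ => by rw [hψ0 i Z hZ]; rfl
    refine ⟨⟨y, hy⟩, hyU, fun m => ?_⟩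
    have hsub : ∀ Z X s, ((⟨y, hy⟩ - ∑ i ∈ Finset.range m, ψ i :
        {ψ : Fam C // ψ ∈ Hoch C (n - 1) j}) : Fam C) Z X s =
        y Z X s - ∑ i ∈ Finset.range m, (ψ i).1 Z X s := by
      intro Z X s
      rw [AddSubgroupClass.coe_sub, AddSubmonoidClass.coe_finsetSum]
      simp only [Pi.sub_apply, Finset.sum_apply]
    refine ⟨fun W s hs => ?_, fun Z hZ => ?_⟩
    · refine (hsub U W s).trans (sub_eq_zero.2 ?_)
      refine Finset.sum_subset (Finset.range_subset_range.2 hs) fun i _ hi => ?_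
      exact (hψ i).1 W s (by simpa using hi)
    · funext W s
      refine (hsub Z W s).trans ?_
      rw [hyU Z hZ, Finset.sum_eq_zero fun i _ => by rw [hψ0 i Z hZ]; rfl]
      exact sub_zero _
  · rintro m φ ⟨h1, h2⟩ ⟨h3, h4⟩
    obtain ⟨H, -, hH, hHF, hHR, hHD⟩ := S.exists_depth_contraction m
    -- Left multiplication by the first entry raises the depth, so on the graded pieces the Hochschild
    -- differential is the differential of one-sided cochains.
    have hD : rdelta C U U (φ U) ∈ depthFiltration U U U (m + 1) := by
      intro W s hs
      have := delta_eq_rdelta_sub h3 s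
      rw [h4, lmul_eq_zero_of_depth h1 h2 s hs, smul_zero, sub_zero] at this
      exact this.symm
    have hψ := hH (hRU h3)
    obtain ⟨y, hyU, hy0⟩ : ∃ y : Fam C, y U = H U (φ U) ∧ ∀ Z, Z ≠ U → y Z = 0 :=
      ⟨Function.update 0 U (H U (φ U)), Function.update_self .., fun Z hZ =>
        Function.update_of_ne hZ ..⟩
    have hy : y ∈ Hoch C (n - 1) j := by
      refine ⟨fun Z X => ?_, fun {Z X s p q} hs => ?_⟩
      · by_cases hZ : Z = U
        · subst hZ
          rw [hyU]
          exact hψ.1 X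
        · rw [hy0 Z hZ]
          intro Y W s t c g g'
          simp
      · by_cases hZ : Z = U
        · subst hZ
          rw [hyU]
          exact hψ.2 hs
        · rw [hy0 Z hZ]
          exact zero_mem _
    have hyF : y U ∈ depthFiltration U U U m := by rw [hyU]; exact hHF _
    have hδy := delta_mem hy
    rw [sub_add_cancel] at hδy
    have hδδ := delta_delta hy
    rw [sub_add_cancel] at hδδ
    refine ⟨⟨y, hy⟩, ⟨hyF, hy0⟩, hy0, ⟨fun W s hs => ?_, fun Z hZ => ?_⟩, sub_mem h3 hδy, ?_⟩
    · have e1 := hHD (hRU h3) h1 W s hs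
      rw [hHR (rdelta_mem (hRU h3)) hD] at e1
      have e2 := delta_eq_rdelta_sub hy s
      rw [lmul_eq_zero_of_depth hyF hy0 s hs, smul_zero, sub_zero, hyU] at e2
      change φ U W s - delta (n - 1) y U W s = 0
      rw [e2]
      simpa using e1
    · change φ Z - delta (n - 1) y Z = 0
      rw [h2 Z hZ, delta_eq_zero_of_ne S.mor_eq_zero _ hy0 hZ, sub_zero]
    · have := map_sub (deltaL C n) φ (delta (n - 1) y)
      refine this.trans ?_
      change delta n φ - delta n (delta (n - 1) y) = 0
      rw [h4, hδδ, sub_zero]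

end Support

/-! ### Parity components -/

section Parity

variable (k : Type u) [Field k] {M : Type u} [AddCommGroup M] [Module k M] [BigradedComplex k M]

/-- The projection to the part of even cohomological degree. -/
def evenPart : M →ₗ[k] M :=
  (decomp k M).toLinearMap ∘ₗ
    (DirectSum.lmap fun e : ℤ × ℤ => open Classical in
      if Even e.1 then (LinearMap.id : pc k M e.1 e.2 →ₗ[k] pc k M e.1 e.2) else 0) ∘ₗ
    (decomp k M).symm.toLinearMap

/-- The projection to the part of odd cohomological degree. -/
def oddPart : M →ₗ[k] M := LinearMap.id - evenPart k

theorem evenPart_of_even {i j : ℤ} {x : M} (h : x ∈ pc k M i j) (hi : Even i) :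
    evenPart k x = x := by
  have h0 : ∀ y : pc k M i j, decomp k M
      (DirectSum.lof k (ℤ × ℤ) (fun e : ℤ × ℤ => pc k M e.1 e.2) (i, j) y) = y := fun y =>
    DirectSum.coeLinearMap_lof (fun e : ℤ × ℤ => pc k M e.1 e.2) (i, j) y
  have h1 : (decomp k M).symm x
      = DirectSum.lof k (ℤ × ℤ) (fun e : ℤ × ℤ => pc k M e.1 e.2) (i, j) ⟨x, h⟩ := by
    rw [LinearEquiv.symm_apply_eq, h0]
  simp only [evenPart, LinearMap.comp_apply, LinearEquiv.coe_coe]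
  rw [h1, DirectSum.lmap_lof, h0, if_pos hi]
  rfl

theorem evenPart_of_odd {i j : ℤ} {x : M} (h : x ∈ pc k M i j) (hi : ¬ Even i) :
    evenPart k x = 0 := by
  have h0 : ∀ y : pc k M i j, decomp k M
      (DirectSum.lof k (ℤ × ℤ) (fun e : ℤ × ℤ => pc k M e.1 e.2) (i, j) y) = y := fun y =>
    DirectSum.coeLinearMap_lof (fun e : ℤ × ℤ => pc k M e.1 e.2) (i, j) y
  have h1 : (decomp k M).symm x
      = DirectSum.lof k (ℤ × ℤ) (fun e : ℤ × ℤ => pc k M e.1 e.2) (i, j) ⟨x, h⟩ := by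
    rw [LinearEquiv.symm_apply_eq, h0]
  simp only [evenPart, LinearMap.comp_apply, LinearEquiv.coe_coe]
  rw [h1, DirectSum.lmap_lof, h0, if_neg hi]
  rfl

theorem oddPart_apply (x : M) : oddPart k x = x - evenPart k x := rfl

theorem evenPart_add_oddPart (x : M) : evenPart k x + oddPart k x = x := by
  rw [oddPart_apply, add_sub_cancel]

theorem evenPart_mem {i j : ℤ} {x : M} (h : x ∈ pc k M i j) : evenPart k x ∈ pc k M i j := by
  by_cases hi : Even i
  · rwa [evenPart_of_even k h hi]
  · rw [evenPart_of_odd k h hi]; exact zero_mem _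

theorem oddPart_mem {i j : ℤ} {x : M} (h : x ∈ pc k M i j) : oddPart k x ∈ pc k M i j :=
  sub_mem h (evenPart_mem k h)

theorem evenPart_evenPart (x : M) : evenPart k (evenPart k x) = evenPart k x := by
  have : evenPart k ∘ₗ evenPart k = (evenPart k : M →ₗ[k] M) := by
    refine ext_pc k fun i j x h => ?_
    rw [LinearMap.comp_apply]
    by_cases hi : Even i
    · simp only [evenPart_of_even k h hi]
    · simp only [evenPart_of_odd k h hi, map_zero]
  exact LinearMap.congr_fun this x

theorem oddPart_evenPart (x : M) : oddPart k (evenPart k x) = 0 := by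
  rw [oddPart_apply, evenPart_evenPart, sub_self]

theorem evenPart_oddPart (x : M) : evenPart k (oddPart k x) = 0 := by
  rw [oddPart_apply, map_sub, evenPart_evenPart, sub_self]

theorem oddPart_oddPart (x : M) : oddPart k (oddPart k x) = oddPart k x := by
  rw [oddPart_apply k (oddPart k x), evenPart_oddPart, sub_zero]

theorem sg_evenPart (n : ℤ) (x : M) : sg k n (evenPart k x) = evenPart k x := by
  have : sg k n ∘ₗ evenPart k = (evenPart k : M →ₗ[k] M) := by
    refine ext_pc k fun i j x h => ?_
    rw [LinearMap.comp_apply, sg_of_mem k n (evenPart_mem k h)]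
    by_cases hi : Even i
    · rw [Int.negOnePow_even _ (hi.mul_left n)]; simp
    · simp only [evenPart_of_odd k h hi, smul_zero]
  exact LinearMap.congr_fun this x

theorem sg_oddPart (n : ℤ) (x : M) : sg k n (oddPart k x) = (n.negOnePow : ℤ) • oddPart k x := by
  have : sg k n ∘ₗ oddPart k = (n.negOnePow : ℤ) • (oddPart k : M →ₗ[k] M) := by
    refine ext_pc k fun i j x h => ?_
    rw [LinearMap.comp_apply, LinearMap.smul_apply, sg_of_mem k n (oddPart_mem k h)]
    by_cases hi : Even i
    · rw [oddPart_apply, evenPart_of_even k h hi, sub_self, smul_zero, smul_zero]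
    · congr 2
      rw [Int.negOnePow_eq_iff, show n * i - n = n * (i - 1) by ring]
      exact ((Int.not_even_iff_odd.1 hi).sub_odd odd_one).mul_left n
  exact LinearMap.congr_fun this x

theorem evenPart_sg (n : ℤ) (x : M) : evenPart k (sg k n x) = evenPart k x := by
  conv_lhs => rw [← evenPart_add_oddPart k x]
  rw [map_add, map_add, sg_evenPart, sg_oddPart, map_zsmul, evenPart_evenPart, evenPart_oddPart,
    smul_zero, add_zero]

theorem oddPart_sg (n : ℤ) (x : M) : oddPart k (sg k n x) = (n.negOnePow : ℤ) • oddPart k x := by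
  conv_lhs => rw [← evenPart_add_oddPart k x]
  rw [map_add, map_add, sg_evenPart, sg_oddPart, map_zsmul, oddPart_evenPart, oddPart_oddPart,
    zero_add]

theorem sg_one_eq (x : M) : sg k 1 x = evenPart k x - oddPart k x := by
  conv_lhs => rw [← evenPart_add_oddPart k x]
  rw [map_add, sg_evenPart, sg_oddPart]
  simp [sub_eq_add_neg]

theorem evenPart_dd (x : M) : evenPart k (dd k x) = dd k (oddPart k x) := by
  have : evenPart k ∘ₗ dd k = (dd k ∘ₗ oddPart k : M →ₗ[k] M) := by
    refine ext_pc k fun i j x h => ?_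
    rw [LinearMap.comp_apply, LinearMap.comp_apply, oddPart_apply]
    by_cases hi : Even i
    · rw [evenPart_of_even k h hi, sub_self, map_zero,
        evenPart_of_odd k (dd_mem k h) (by rwa [Int.even_add_one, not_not])]
    · rw [evenPart_of_odd k h hi, sub_zero,
        evenPart_of_even k (dd_mem k h) (by rwa [Int.even_add_one])]
  exact LinearMap.congr_fun this x

theorem oddPart_dd (x : M) : oddPart k (dd k x) = dd k (evenPart k x) := by
  rw [oddPart_apply, evenPart_dd, oddPart_apply, map_sub, sub_sub_cancel]

end Parity

section OppositeCategory

variable {k : Type u} [Field k] {C : BigradedDGCategory k}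

theorem evenPart_comp {Z Y X : C.Obj} (g : C.Mor Z Y) (f : C.Mor Y X) :
    evenPart k (C.comp g f) = C.comp (evenPart k g) (evenPart k f) +
      C.comp (oddPart k g) (oddPart k f) := by
  have : C.comp.compr₂ (evenPart k) = (C.comp.compl₁₂ (evenPart k) (evenPart k) +
      C.comp.compl₁₂ (oddPart k) (oddPart k) : C.Mor Z Y →ₗ[k] C.Mor Y X →ₗ[k] C.Mor Z X) := by
    refine ext_pc k fun i j x hx => ext_pc k fun i' j' y hy => ?_
    simp only [LinearMap.compr₂_apply, LinearMap.compl₁₂_apply, LinearMap.add_apply, oddPart_apply]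
    have hxy := C.comp_mem hx hy
    by_cases hi : Even i <;> by_cases hi' : Even i'
    · rw [evenPart_of_even k hxy (hi.add hi'), evenPart_of_even k hx hi, evenPart_of_even k hy hi']
      simp
    · rw [evenPart_of_odd k hxy (by simp [Int.even_add, hi, hi']), evenPart_of_even k hx hi,
        evenPart_of_odd k hy hi']
      simp
    · rw [evenPart_of_odd k hxy (by simp [Int.even_add, hi, hi']), evenPart_of_odd k hx hi,
        evenPart_of_even k hy hi']
      simp
    · rw [evenPart_of_even k hxy (by simp [Int.even_add, hi, hi']), evenPart_of_odd k hx hi,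
        evenPart_of_odd k hy hi']
      simp
  exact LinearMap.congr_fun (LinearMap.congr_fun this g) f

theorem oddPart_comp {Z Y X : C.Obj} (g : C.Mor Z Y) (f : C.Mor Y X) :
    oddPart k (C.comp g f) = C.comp (evenPart k g) (oddPart k f) +
      C.comp (oddPart k g) (evenPart k f) := by
  rw [oddPart_apply, evenPart_comp]
  simp only [oddPart_apply, map_sub, LinearMap.sub_apply]
  abel

variable (C) in
/-- The composition `(-1) ^ (|g| |f|) f g` of the opposite category. -/
def opComp (Z Y X : C.Obj) : C.Mor Y Z →ₗ[k] C.Mor X Y →ₗ[k] C.Mor X Z :=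
  (C.comp (Z := X) (Y := Y) (X := Z)).flip ∘ₗ evenPart k +
    (C.comp (Z := X) (Y := Y) (X := Z) ∘ₗ sg k 1).flip ∘ₗ oddPart k

theorem opComp_apply {Z Y X : C.Obj} (g : C.Mor Y Z) (f : C.Mor X Y) :
    opComp C Z Y X g f = C.comp f (evenPart k g) + C.comp (sg k 1 f) (oddPart k g) := rfl

theorem opComp_apply' {Z Y X : C.Obj} (g : C.Mor Y Z) (f : C.Mor X Y) :
    opComp C Z Y X g f = C.comp (evenPart k f) g + C.comp (oddPart k f) (sg k 1 g) := by
  have e1 : C.comp f (evenPart k g) =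
      C.comp (evenPart k f) (evenPart k g) + C.comp (oddPart k f) (evenPart k g) := by
    rw [← LinearMap.add_apply, ← map_add, evenPart_add_oddPart]
  have e2 : C.comp (evenPart k f) g =
      C.comp (evenPart k f) (evenPart k g) + C.comp (evenPart k f) (oddPart k g) := by
    rw [← map_add, evenPart_add_oddPart]
  rw [opComp_apply, sg_one_eq, sg_one_eq, e1, e2]
  simp only [map_sub, LinearMap.sub_apply]
  abel

variable (C) in
/-- The opposite of a bigraded dg category. -/
abbrev BigradedDGCategory.op : BigradedDGCategory k where
  Obj := C.Obj
  Mor Y X := C.Mor X Y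
  acg Y X := C.acg X Y
  mod Y X := C.mod X Y
  cx Y X := C.cx X Y
  one := C.one
  comp {Z Y X} := opComp C Z Y X
  one_comp {Y X} f := by
    rw [opComp_apply, oddPart_apply, evenPart_of_even k (C.one_mem Y) Even.zero, sub_self, map_zero,
      C.comp_one, add_zero]
  comp_one {Y X} f := by
    rw [opComp_apply, sg_one, C.one_comp, C.one_comp, evenPart_add_oddPart]
  assoc {W Z Y X} h g f := by
    simp only [opComp_apply, map_add, LinearMap.add_apply, evenPart_comp, oddPart_comp, sg_comp,
      evenPart_evenPart, evenPart_oddPart, oddPart_evenPart, oddPart_oddPart, evenPart_sg,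
      oddPart_sg, sg_evenPart, sg_oddPart, sg_one_sg_one, map_zero,
      map_zsmul, LinearMap.smul_apply, C.assoc, Int.negOnePow_one, Units.val_neg, Units.val_one]
    module
  one_mem := C.one_mem
  comp_mem {Z Y X i j i' j' g f} hg hf := by
    rw [opComp_apply, add_comm i, add_comm j]
    exact add_mem (C.comp_mem hf (evenPart_mem k hg))
      (C.comp_mem (sg_mem k 1 hf) (oddPart_mem k hg))
  leibniz {Z Y X} g f := by
    simp only [opComp_apply, map_add, C.leibniz, evenPart_dd, oddPart_dd, evenPart_sg, oddPart_sg,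
      dd_sg_one, sg_one_sg_one, map_neg, LinearMap.neg_apply, map_zsmul, Int.negOnePow_one,
      Units.val_neg, Units.val_one]
    module

variable (C) in
/-- The canonical isomorphism of a bigraded dg category with its double opposite. -/
def toOpOp : FullFunctor C C.op.op where
  obj X := X
  map Y X := LinearEquiv.refl k (C.Mor Y X)
  map_one _ := rfl
  map_comp {Z Y X} g f := by
    change C.comp g f = opComp C.op Z Y X g f
    rw [opComp_apply]
    change C.comp g f = opComp C X Y Z f (evenPart k g) + opComp C X Y Z (sg k 1 f) (oddPart k g)
    rw [opComp_apply, opComp_apply, sg_evenPart, evenPart_sg, oddPart_sg, sg_oddPart]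
    nth_rewrite 1 [← evenPart_add_oddPart k g]
    nth_rewrite 1 [← evenPart_add_oddPart k f]
    simp
  map_d _ := rfl
  map_mem := Iff.rfl

end OppositeCategory

/-! ### Reversal of cochains -/

section Reversal

variable {k : Type u} [Field k] {C : BigradedDGCategory k}

theorem Str.HasDeg.snoc {Z Y X : C.Obj} {s : Str C Z Y} {p q : ℤ} (hs : s.HasDeg p q) {i j : ℤ}
    {x : C.Mor Y X} (hx : x ∈ pc k (C.Mor Y X) i j) :
    (GradedKeller.snoc s x).HasDeg (p + (i - 1)) (q + j) := by
  induction hs with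
  | nil =>
    have := Str.HasDeg.cons hx (.nil X)
    rwa [add_zero, add_zero, ← zero_add (i - 1), ← zero_add j] at this
  | cons hg _ ih =>
    have := Str.HasDeg.cons hg (ih hx)
    rwa [← add_assoc, ← add_assoc] at this

theorem Str.HasDeg.twist {Z X : C.Obj} {s : Str C Z X} {p q : ℤ} (hs : s.HasDeg p q) :
    (GradedKeller.twist s).HasDeg p q := by
  induction hs with
  | nil => exact .nil _
  | cons hg _ ih => exact .cons (sg_mem k 1 hg) ih

theorem twist_append {Z Y X : C.Obj} (s : Str C Z Y) (t : Str C Y X) :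
    twist (s.append t) = (twist s).append (twist t) := by
  induction s with
  | nil => rfl
  | cons g s ih => simp only [Str.append, twist]; rw [ih]

theorem twist_snoc {Z Y X : C.Obj} (s : Str C Z Y) (x : C.Mor Y X) :
    twist (snoc s x) = snoc (twist s) (sg k 1 x) :=
  twist_append s _

theorem lsign_snoc {Z Y X : C.Obj} (s : Str C Z Y) (x : C.Mor Y X) :
    lsign (snoc s x) = - lsign s := by
  induction s with
  | nil => rfl
  | cons g s ih =>
    change - lsign (snoc s x) = - - lsign s
    rw [ih]

theorem lsign_append_cons {Z Y W X : C.Obj} (s : Str C Z Y) (g g' : C.Mor Y W) (t : Str C W X) :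
    lsign (s.append (.cons g t)) = lsign (s.append (.cons g' t)) := by
  induction s with
  | nil => rfl
  | cons f s ih => simp only [Str.append, lsign]; rw [ih g g']

theorem append_assoc {Z Y X W : C.Obj} (s : Str C Z Y) (t : Str C Y X) (r : Str C X W) :
    (s.append t).append r = s.append (t.append r) := by
  induction s with
  | nil => rfl
  | cons g s ih => simp only [Str.append]; rw [ih]

theorem snoc_append_cons {Z Y X W V : C.Obj} (s : Str C Z Y) (g : C.Mor Y X) (t : Str C X W)
    (x : C.Mor W V) : snoc (s.append (.cons g t)) x = s.append (.cons g (snoc t x)) :=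
  append_assoc s _ _

section Linear

variable {N : Type u} [AddCommGroup N] [Module k N]

theorem IsMultilinear.snoc {Z Y X : C.Obj} {φ : Str C Z X → N} (h : IsMultilinear φ)
    (x : C.Mor Y X) : IsMultilinear fun s => φ (GradedKeller.snoc s x) := by
  intro V W s t c g g'
  simp only [snoc_append_cons]
  exact h V W s (GradedKeller.snoc t x) c g g'

/-- The function `x ↦ φ (t, x)` as a linear map. -/
def IsMultilinear.lastMap {Z X : C.Obj} {φ : Str C Z X → N} (h : IsMultilinear φ)
    (Y : C.Obj) (t : Str C Z Y) : C.Mor Y X →ₗ[k] N where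
  toFun x := φ (GradedKeller.snoc t x)
  map_add' x y := by simpa [GradedKeller.snoc] using h Y X t (.nil X) 1 x y
  map_smul' c x := by
    have h0 : φ (GradedKeller.snoc t (0 : C.Mor Y X)) = 0 := by
      simpa [GradedKeller.snoc] using h Y X t (.nil X) 1 0 0
    have := h Y X t (.nil X) c x 0
    rw [add_zero] at this
    exact this.trans (by rw [show φ (t.append (.cons 0 (.nil X))) = 0 from h0, add_zero]; rfl)

theorem IsMultilinear.add {Z X : C.Obj} {φ ψ : Str C Z X → N} (h : IsMultilinear φ)
    (h' : IsMultilinear ψ) : IsMultilinear fun s => φ s + ψ s := by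
  intro Y W s t c g g'
  simp only []
  rw [h Y W s t, h' Y W s t]
  module

theorem IsMultilinear.sign_twist {Z X : C.Obj} {φ : Str C Z X → N} (h : IsMultilinear φ) :
    IsMultilinear fun s => lsign s • φ (twist s) := by
  intro Y W s t c g g'
  simp only [twist_append, twist, map_add, map_smul]
  rw [h Y W (twist s) (twist t), lsign_append_cons s (c • g + g') g, lsign_append_cons s g' g]
  module

end Linear

/-- The function `t ↦ (-1) ^ ((|g| - 1) e) φ (t, g)`, where `e` is the sum of the degrees
`|xᵢ| - 1` of the entries of `t`. -/
def signedSnoc {N : Type u} [AddCommGroup N] {Z Y X : C.Obj} (φ : Str C Z X → N) (g : C.Mor Y X) :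
    Str C Z Y → N :=
  fun t => φ (snoc t (oddPart k g)) + lsign t • φ (snoc (twist t) (evenPart k g))

/-- The function `t ↦ (-1) ^ ((|g| - 1) e) φ (g, t)`, where `e` is the sum of the degrees
`|xᵢ| - 1` of the entries of `t`. -/
def signedCons {N : Type u} [AddCommGroup N] {Z Y X : C.Obj} (φ : Str C Z X → N) (g : C.Mor Z Y) :
    Str C Y X → N :=
  fun t => φ (.cons (oddPart k g) t) + lsign t • φ (.cons (evenPart k g) (twist t))

/-- Reversal of strings:
`reverse φ (x₁, …, xₚ) = (-1) ^ (p + ∑ i < j, (|xᵢ| - 1) (|xⱼ| - 1)) φ (xₚ, …, x₁)`. -/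
def reverse {N : Type u} [AddCommGroup N] {X : C.Obj} :
    {Z : C.Obj} → (Str C X Z → N) → Str C.op Z X → N
  | _, φ, .nil _ => φ (.nil X)
  | Z, φ, @Str.cons _ _ _ _ Y _ g s =>
    - reverse (signedSnoc (Z := X) (Y := Y) (X := Z) φ g) s

section Basic

variable {N N' : Type u} [AddCommGroup N] [AddCommGroup N']

theorem reverse_cons {Z Y X : C.Obj} (φ : Str C X Z → N) (g : C.Mor Y Z) (s : Str C.op Y X) :
    reverse φ (@Str.cons _ _ C.op Z Y X g s) = - reverse (signedSnoc φ g) s := rfl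

theorem reverse_map (f : N →+ N') {Z X : C.op.Obj} (s : Str C.op Z X) : ∀ φ : Str C X Z → N,
    reverse (fun t => f (φ t)) s = f (reverse φ s) := by
  induction s with
  | nil => intro φ; rfl
  | @cons Z Y X g s ih =>
    intro φ
    rw [reverse_cons, reverse_cons, map_neg, ← ih]
    congr 2
    funext t
    simp only [signedSnoc, map_add, map_zsmul]

theorem reverse_add {Z X : C.op.Obj} (s : Str C.op Z X) : ∀ φ ψ : Str C X Z → N,
    reverse (fun t => φ t + ψ t) s = reverse φ s + reverse ψ s := by
  induction s with
  | nil => intro φ ψ; rfl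
  | @cons Z Y X g s ih =>
    intro φ ψ
    rw [reverse_cons, reverse_cons, reverse_cons, ← neg_add, ← ih]
    congr 2
    funext t
    simp only [signedSnoc, smul_add]
    abel

theorem reverse_neg {Z X : C.op.Obj} (s : Str C.op Z X) (φ : Str C X Z → N) :
    reverse (fun t => - φ t) s = - reverse φ s :=
  reverse_map (-AddMonoidHom.id N) s φ

theorem reverse_sub {Z X : C.op.Obj} (s : Str C.op Z X) (φ ψ : Str C X Z → N) :
    reverse (fun t => φ t - ψ t) s = reverse φ s - reverse ψ s := by
  simp only [sub_eq_add_neg, reverse_add, reverse_neg]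

theorem reverse_zsmul {Z X : C.op.Obj} (s : Str C.op Z X) (c : ℤ) (φ : Str C X Z → N) :
    reverse (fun t => c • φ t) s = c • reverse φ s :=
  reverse_map (zsmulAddGroupHom c : N →+ N) s φ

theorem reverse_zero {Z X : C.op.Obj} (s : Str C.op Z X) :
    reverse (fun _ => (0 : N)) s = 0 :=
  reverse_map (0 : N →+ N) s fun _ => 0

theorem signedSnoc_sign_twist {Z Y X : C.Obj} (φ : Str C Z X → N) (g : C.Mor Y X) (t : Str C Z Y)
    (h : ∀ r : Str C Z Y, φ (snoc r (-oddPart k g)) = - φ (snoc r (oddPart k g))) :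
    signedSnoc (fun t => lsign t • φ (twist t)) g t =
      - (lsign t • signedSnoc φ (sg k 1 g) (twist t)) := by
  simp only [signedSnoc, lsign_snoc, twist_snoc, lsign_twist, twist_twist, sg_oddPart, sg_evenPart,
    evenPart_sg, oddPart_sg, Int.negOnePow_one, Units.val_neg, Units.val_one, neg_smul, one_smul,
    smul_add, smul_neg, h, smul_smul]
  abel

/-- The term of `inner φ (x₁, …, xₚ, x)` in which the last two entries are composed. -/
def lastMerge {Z Y X : C.Obj} (φ : Str C Z X → N) (x : C.Mor Y X) : Str C Z Y → N := fun t =>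
  inner φ (snoc t x) - inner (fun s => φ (snoc s x)) t - lsign t • φ (snoc (twist t) (dd k x))

theorem lastMerge_nil {Y X : C.Obj} (φ : Str C Y X → N) (x : C.Mor Y X) :
    lastMerge φ x (.nil Y) = 0 := by
  simp [lastMerge, snoc, Str.append, inner, merge, lsign, twist]

theorem lastMerge_snoc {Z V Y X : C.Obj} (φ : Str C Z X → N) (x : C.Mor Y X) (s : Str C Z V)
    (y : C.Mor V Y) :
    lastMerge φ x (snoc s y) = lsign s • φ (snoc (twist s) (C.comp (sg k 1 y) x)) := by
  rw [lastMerge, inner_snoc_snoc]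
  abel

theorem inner_snoc {Z Y X : C.Obj} (φ : Str C Z X → N) (x : C.Mor Y X) (t : Str C Z Y) :
    inner φ (snoc t x) = inner (fun s => φ (snoc s x)) t +
      lsign t • φ (snoc (twist t) (dd k x)) + lastMerge φ x t := by
  rw [lastMerge]
  abel

end Basic

section Linear

variable {N : Type u} [AddCommGroup N] [Module k N]

theorem signedSnoc_isMultilinear {Z Y X : C.Obj} {φ : Str C Z X → N} (h : IsMultilinear φ)
    (g : C.Mor Y X) : IsMultilinear (signedSnoc φ g) :=
  (h.snoc _).add (h.snoc _).sign_twist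

/-- `signedSnoc` as a linear map in the morphism. -/
def signedSnocL {Z X : C.Obj} {φ : Str C Z X → N} (h : IsMultilinear φ) (Y : C.Obj)
    (t : Str C Z Y) : C.Mor Y X →ₗ[k] N :=
  h.lastMap Y t ∘ₗ oddPart k + lsign t • (h.lastMap Y (twist t) ∘ₗ evenPart k)

theorem signedSnocL_apply {Z Y X : C.Obj} {φ : Str C Z X → N} (h : IsMultilinear φ) (g : C.Mor Y X)
    (t : Str C Z Y) : signedSnocL h Y t g = signedSnoc φ g t := rfl

theorem reverse_smul {Z X : C.op.Obj} (s : Str C.op Z X) (c : k) (φ : Str C X Z → N) :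
    reverse (fun t => c • φ t) s = c • reverse φ s :=
  reverse_map (DistribSMul.toAddMonoidHom N c) s φ

theorem reverse_isMultilinear {Z X : C.op.Obj} {φ : Str C X Z → N} (h : IsMultilinear φ) :
    IsMultilinear (reverse φ) := by
  intro Y W s t c g g'
  induction s with
  | nil Z =>
    simp only [Str.append]
    rw [reverse_cons, reverse_cons, reverse_cons]
    have e : signedSnoc φ (c • g + g') = fun t => c • signedSnoc φ g t + signedSnoc φ g' t := by
      funext t
      simp only [← signedSnocL_apply h, map_add, map_smul]
    rw [show signedSnoc φ (c • g + g' : C.Mor W Z) = _ from e, reverse_add, reverse_smul]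
    module
  | cons f s ih =>
    simp only [Str.append]
    rw [reverse_cons, reverse_cons, reverse_cons, ih (signedSnoc_isMultilinear h f)]
    module

theorem reverse_mem {M : Type u} [AddCommGroup M] [Module k M] [BigradedComplex k M]
    {Z X : C.op.Obj} {s : Str C.op Z X} {p q : ℤ} (hs : s.HasDeg p q) :
    ∀ {n j : ℤ} {φ : Str C X Z → M},
      (∀ {t : Str C X Z} {p q : ℤ}, t.HasDeg p q → φ t ∈ pc k M (n + p) (j + q)) →
      reverse φ s ∈ pc k M (n + p) (j + q) := by
  induction hs with
  | nil => intro n j φ h; exact h (.nil _)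
  | @cons Z Y X g s i j' p q hg hs ih =>
    intro n j φ h
    rw [reverse_cons]
    refine neg_mem ?_
    have := @ih (n + (i - 1)) (j + j') (signedSnoc φ g) (by
      intro t p q ht
      refine add_mem ?_ (zsmul_mem ?_ _)
      · have := h (ht.snoc (oddPart_mem k hg))
        rwa [show n + (p + (i - 1)) = n + (i - 1) + p by ring,
          show j + (q + j') = j + j' + q by ring] at this
      · have := h (ht.twist.snoc (evenPart_mem k hg))
        rwa [show n + (p + (i - 1)) = n + (i - 1) + p by ring,
          show j + (q + j') = j + j' + q by ring] at this)
    rwa [show n + (i - 1) + p = n + (i - 1 + p) by ring,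
      show j + j' + q = j + (j' + q) by ring] at this

/-- Reversal is compatible with the operators that alternate signs. -/
theorem reverse_sign_twist {Z X : C.op.Obj} (s : Str C.op Z X) : ∀ {φ : Str C X Z → N},
    IsMultilinear φ →
      reverse (fun t => lsign t • φ (twist t)) s = lsign s • reverse φ (twist s) := by
  induction s with
  | nil => intro φ _; rfl
  | @cons Z Y X g s ih =>
    intro φ h
    simp only [twist, lsign]
    rw [reverse_cons, reverse_cons]
    have e : signedSnoc (fun t => lsign t • φ (twist t)) g =
        fun t => -(lsign t • signedSnoc φ (sg k 1 g) (twist t)) := by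
      funext t
      exact signedSnoc_sign_twist φ g t fun r => map_neg (h.lastMap Y r) _
    rw [show signedSnoc (fun t => lsign t • φ (twist t)) (g : C.Mor Y Z) = _ from e, reverse_neg,
      ih (signedSnoc_isMultilinear h _)]
    simp

/-- The recursion for reversal with respect to the last entry. -/
theorem reverse_snoc {Z Y : C.op.Obj} (s : Str C.op Z Y) : ∀ {X : C.Obj} (g : C.Mor X Y)
    {φ : Str C X Z → N}, IsMultilinear φ →
      reverse φ (snoc (C := C.op) (X := X) s g) = - reverse (signedCons φ g) s := by
  induction s with
  | nil => intro X g φ _; rfl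
  | @cons Z Y W h s ih =>
    intro X g φ hφ
    change reverse φ (@Str.cons _ _ C.op Z Y X h (snoc (C := C.op) s g)) = _
    rw [reverse_cons, ih g (signedSnoc_isMultilinear hφ h), reverse_cons]
    congr 3
    funext t
    have e1 : ∀ (x : C.Mor X W) (r : Str C W Y) (y : C.Mor Y Z),
        snoc (.cons x r) y = .cons x (snoc r y) := fun _ _ _ => rfl
    have e2 : ∀ (x : C.Mor X W) (r : Str C W Y), φ (snoc (.cons (-x) r) (evenPart k h)) =
        - φ (snoc (.cons x r) (evenPart k h)) := fun x r =>
      map_neg (hφ.headMap W (snoc r (evenPart k h))) x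
    have e3 : ∀ (x : C.Mor X W) (r : Str C W Y), φ (snoc (.cons x r) (-oddPart k h)) =
        - φ (snoc (.cons x r) (oddPart k h)) := fun x r => map_neg (hφ.lastMap Y (.cons x r)) _
    simp only [signedCons, signedSnoc, ← e1, lsign, lsign_snoc, twist, twist_snoc, lsign_twist,
      twist_twist, sg_oddPart, sg_evenPart, Int.negOnePow_one, Units.val_neg, Units.val_one,
      neg_smul, one_smul, e2, e3, smul_add, smul_neg, smul_smul, lsign_mul]
    abel

theorem inner_sign_twist {Z X : C.Obj} (s : Str C Z X) : ∀ {φ : Str C Z X → N}, IsMultilinear φ →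
    inner (fun t => lsign t • φ (twist t)) s = - (lsign s • inner φ (twist s)) := by
  induction s with
  | nil => intro φ _; simp [inner, twist]
  | @cons Z Y X g s ih =>
    intro φ h
    have hneg : ∀ (W : C.Obj) (f : C.Mor Z W) (t : Str C W X), φ (.cons (-f) t) = - φ (.cons f t) :=
      fun W f t => map_neg (h.headMap W t) f
    simp only [twist]
    rw [inner_cons, inner_cons]
    have e1 : (fun s' => lsign (.cons (sg k 1 g) s') • φ (twist (.cons (sg k 1 g) s'))) =
        fun s' => -(lsign s' • φ (.cons g (twist s'))) := by
      funext s'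
      simp only [lsign, twist, sg_one_sg_one, neg_smul]
    have e2 : merge (fun t => lsign t • φ (twist t)) g s =
        lsign s • merge φ (sg k 1 g) (twist s) := by
      cases s with
      | nil => simp [merge, twist]
      | cons f s => simp only [merge, twist, lsign, sg_comp, sg_one_sg_one]
    rw [e1, e2, inner_neg, ih (h.tail g), sg_one_sg_one]
    simp only [lsign, twist, dd_sg_one, hneg]
    module

/-- Reversal commutes with the inner part of the differential. -/
theorem inner_reverse {Z X : C.op.Obj} (s : Str C.op Z X) : ∀ {φ : Str C X Z → N}, IsMultilinear φ →
    inner (reverse φ) s = reverse (inner φ) s := by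
  induction s with
  | nil => intro φ _; rfl
  | @cons Z Y X g s ih =>
    intro φ h
    rw [inner_cons, reverse_cons]
    let g' : C.Mor Y Z := g
    let m : Str C X Y → N := fun t => lastMerge φ (oddPart k g') t +
      lsign t • lastMerge φ (evenPart k g') (twist t)
    have e1 : signedSnoc (inner φ) g' = fun t =>
        signedSnoc φ (dd k g') t - inner (signedSnoc φ (sg k 1 g')) t + m t := by
      funext t
      have e2 : signedSnoc φ (sg k 1 g') = fun t => (fun s => lsign s •
          (fun r => φ (snoc r (evenPart k g'))) (twist s)) t - φ (snoc t (oddPart k g')) := by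
        funext t
        have := map_neg (h.lastMap Y t) (oddPart k g')
        simp only [signedSnoc, evenPart_sg, oddPart_sg, Int.negOnePow_one, Units.val_neg,
          Units.val_one, neg_smul, one_smul]
        rw [show φ (snoc t (-oddPart k g')) = - φ (snoc t (oddPart k g')) from this]
        abel
      rw [e2, inner_sub, inner_sign_twist t (h.snoc _)]
      simp only [signedSnoc, inner_snoc, evenPart_dd, oddPart_dd, m, smul_add, smul_smul,
        lsign_twist, lsign_mul, twist_twist, one_smul]
      abel
    have e3 : merge (reverse φ) g s = - reverse m s := by
      cases s with
      | nil =>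
        change (0 : N) = - m (Str.nil (C := C) Y)
        simp only [m, twist, lastMerge_nil]
        simp
      | @cons _ V _ f s =>
        let f' : C.Mor V Y := f
        change reverse φ (@Str.cons _ _ C.op Z V X (opComp C Z Y V (sg k 1 g') f') s) =
          - reverse m (@Str.cons _ _ C.op Y V X f s)
        rw [reverse_cons, reverse_cons, neg_neg, ← reverse_neg]
        congr 1
        funext t
        change - signedSnoc φ (opComp C Z Y V (sg k 1 g') f') t = signedSnoc m f' t
        have e4 : ∀ (r : Str C X V) (x : C.Mor V Z), φ (snoc r (-x)) = - φ (snoc r x) :=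
          fun r x => map_neg (h.lastMap V r) x
        have e5 : ∀ (r : Str C X V) (x y : C.Mor V Z),
            φ (snoc r (x + y)) = φ (snoc r x) + φ (snoc r y) :=
          fun r x y => map_add (h.lastMap V r) x y
        rw [opComp_apply]
        simp only [signedSnoc, m, lastMerge_snoc, twist_snoc, lsign_snoc, map_add, evenPart_comp,
          oddPart_comp, evenPart_sg, oddPart_sg, evenPart_evenPart, evenPart_oddPart,
          oddPart_evenPart, oddPart_oddPart, sg_evenPart, sg_oddPart, twist_twist, lsign_twist,
          Int.negOnePow_one, Units.val_neg, Units.val_one, neg_smul, one_smul, e4, e5, map_neg,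
          LinearMap.neg_apply, map_zero, smul_add, smul_neg, neg_neg, add_zero, zero_add]
        rcases mul_self_eq_one_iff.1 (lsign_mul t) with ht | ht <;> simp only [ht] <;> module
    have e6 := ih (signedSnoc_isMultilinear h (sg k 1 g'))
    have e7 : (fun s' => reverse φ (@Str.cons _ _ C.op Z Y X (sg k 1 g) s')) =
        fun s' => - reverse (signedSnoc φ (sg k 1 g')) s' := rfl
    rw [e7, inner_neg, e6, e3]
    refine Eq.trans ?_ (reverse_cons (inner φ) g' s).symm
    rw [e1, reverse_add s (fun t => signedSnoc φ (dd k g') t - inner (signedSnoc φ (sg k 1 g')) t) m,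
      reverse_sub]
    change - reverse (signedSnoc φ (dd k g')) s + _ - _ = _
    abel

/-- Reversal is an involution. -/
theorem reverse_reverse {Z X : C.Obj} (s : Str C Z X) : ∀ {φ : Str C Z X → N}, IsMultilinear φ →
    reverse (C := C.op) (reverse φ) ((toOpOp C).str s) = φ s := by
  induction s with
  | nil => intro φ _; rfl
  | @cons Z Y X g s ih =>
    intro φ h
    change reverse (C := C.op) (reverse φ) (@Str.cons _ _ C.op.op Z Y X g ((toOpOp C).str s)) = _
    refine Eq.trans ?_ (ih (h.tail g))
    refine (reverse_cons (C := C.op) (reverse φ) g _).trans ?_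
    refine (reverse_neg (C := C.op) ((toOpOp C).str s) (signedSnoc (reverse φ) g)).symm.trans ?_
    congr 1
    funext t
    have e1 : signedCons φ (oddPart k g) = fun r => φ (.cons (oddPart k g) r) := by
      funext r
      have h0 : φ (.cons (0 : C.Mor Z Y) (twist r)) = 0 := map_zero (h.headMap Y (twist r))
      simp only [signedCons, oddPart_oddPart, evenPart_oddPart, h0, smul_zero, add_zero]
    have e2 : signedCons φ (evenPart k g) = fun r => lsign r • φ (.cons (evenPart k g) (twist r)) := by
      funext r
      have h0 : φ (.cons (0 : C.Mor Z Y) r) = 0 := map_zero (h.headMap Y r)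
      simp only [signedCons, oddPart_evenPart, evenPart_evenPart, h0, zero_add]
    have e3 : reverse φ (snoc (C := C.op) (X := Z) t (oddPart k g)) =
        - reverse (fun r => φ (.cons (oddPart k g) r)) t := by
      refine (reverse_snoc t (oddPart k g) h).trans ?_
      rw [← e1]
      rfl
    have e4 : lsign t • reverse φ (snoc (C := C.op) (X := Z) (twist t) (evenPart k g)) =
        - reverse (fun r => φ (.cons (evenPart k g) r)) t := by
      have e5 : reverse φ (snoc (C := C.op) (X := Z) (twist t) (evenPart k g)) =
          - (lsign t • reverse (fun r => φ (.cons (evenPart k g) r)) t) := by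
        refine (reverse_snoc (twist t) (evenPart k g) h).trans ?_
        refine (congrArg (fun ψ => - reverse ψ (twist t)) e2).trans ?_
        have := reverse_sign_twist (twist t) (h.tail (evenPart k g))
        rw [lsign_twist, twist_twist] at this
        exact congrArg Neg.neg this
      rw [e5, smul_neg, smul_smul, lsign_mul, one_smul]
    change -(reverse φ (snoc (C := C.op) (X := Z) t (oddPart k g)) + lsign t •
      reverse φ (snoc (C := C.op) (X := Z) (twist t) (evenPart k g))) = _
    rw [e3, e4, ← neg_add, neg_neg]
    refine (reverse_add t _ _).symm.trans ?_
    congr 1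
    funext r
    have := map_add (h.headMap Y r) (oddPart k g) (evenPart k g)
    rw [add_comm (oddPart k g), evenPart_add_oddPart] at this
    exact this.symm

end Linear

variable (C) in
/-- Reversal of Hochschild cochains. -/
def opFam (φ : Fam C) : Fam C.op := fun Z X => reverse (φ X Z)

theorem opFam_mem {n j : ℤ} {φ : Fam C} (h : φ ∈ Hoch C n j) : opFam C φ ∈ Hoch C.op n j :=
  ⟨fun Z X => reverse_isMultilinear (h.1 X Z), fun hs => reverse_mem hs fun ht => h.2 ht⟩

/-- Reversal interchanges the two boundary terms. -/
theorem reverse_rmul {n j : ℤ} {φ : Fam C} (h : φ ∈ Hoch C n j) {Z X : C.op.Obj}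
    (s : Str C.op Z X) : reverse (rmul (C := C) (U := X) (Z := X) (X := Z) fun W t => sg k 1 (φ X W t)) s =
      -((n.negOnePow : ℤ) • lmul (C := C.op) n (Z := Z) (X := X) (fun W => opFam C φ W X) s) := by
  cases s with
  | nil =>
    change (0 : C.Mor Z Z) = -((n.negOnePow : ℤ) • (0 : C.Mor Z Z))
    simp
  | @cons _ Y _ g s =>
    let g' : C.Mor Y Z := g
    have e1 : signedSnoc (rmul (C := C) (U := X) (Z := X) (X := Z) fun W t => sg k 1 (φ X W t)) g' = fun t =>
        ((C.comp (Z := X)).flip (oddPart k g') ∘ₗ sg k 1 +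
          (n.negOnePow : ℤ) • (C.comp (Z := X)).flip (evenPart k g')).toAddMonoidHom (φ X Y t) := by
      funext t
      have hp : lsign t • sg k 1 (φ X Y (twist t)) = (n.negOnePow : ℤ) • φ X Y t :=
        RCoch.parity (C := C) (U := X) (Z := X) (χ := φ X) ⟨fun W => h.1 X W, fun hs => h.2 hs⟩ t
      simp only [signedSnoc, rmul_snoc]
      rw [← LinearMap.smul_apply, ← map_zsmul, hp]
      simp
    refine (reverse_cons _ g' s).trans ?_
    rw [e1, reverse_map]
    change _ = -((n.negOnePow : ℤ) • opComp C Z Y X (sg k n g') (reverse (φ X Y) s))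
    rw [opComp_apply, evenPart_sg, oddPart_sg]
    simp only [map_zsmul, smul_add, smul_smul, negOnePow_mul_self]
    simp
    abel

theorem reverse_lmul {n j : ℤ} {φ : Fam C} (h : φ ∈ Hoch C n j) {Z X : C.op.Obj}
    (s : Str C.op Z X) : (n.negOnePow : ℤ) • reverse (lmul (C := C) n (Z := X) (X := Z) fun W => φ W Z) s =
      - rmul (C := C.op) (U := Z) (Z := Z) (X := X) (fun W t => sg k 1 (opFam C φ Z W t)) s := by
  refine snoc_cases (C := C.op) s (P := fun X s =>
    (n.negOnePow : ℤ) • reverse (lmul (C := C) n (Z := X) (X := Z) fun W => φ W Z) s =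
      - rmul (C := C.op) (U := Z) (Z := Z) (X := X) (fun W t => sg k 1 (opFam C φ Z W t)) s) ?_ ?_
  · change (n.negOnePow : ℤ) • (0 : C.Mor Z Z) = - (0 : C.Mor Z Z)
    simp
  · intro Y X s g
    let g' : C.Mor X Y := g
    rw [rmul_snoc]
    have e1 : signedCons (lmul (C := C) n (Z := X) (X := Z) fun W => φ W Z) g' = fun t =>
        ((n.negOnePow : ℤ) • C.comp (X := Z) (oddPart k g') +
          (n.negOnePow : ℤ) • (C.comp (X := Z) (evenPart k g') ∘ₗ sg k 1)).toAddMonoidHom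
            (φ Y Z t) := by
      funext t
      have hp : lsign t • φ Y Z (twist t) = (n.negOnePow : ℤ) • sg k 1 (φ Y Z t) := by
        have := sg_cochain t (h.1 Y Z) h.2
        rw [this, smul_smul, ← mul_assoc, negOnePow_mul_self, one_mul]
      simp only [signedCons, lmul_cons, sg_oddPart, sg_evenPart]
      rw [← map_zsmul (C.comp (evenPart k g')), hp]
      simp
    have e2 : reverse (lmul (C := C) n (Z := X) (X := Z) fun W => φ W Z) (snoc (C := C.op) s g') = _ :=
      reverse_snoc s g' (lmul_isMultilinear n fun W => h.1 W Z)
    refine (congrArg ((n.negOnePow : ℤ) • ·) e2).trans ?_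
    rw [e1, reverse_map]
    change _ = - opComp C Z Y X (sg k 1 (reverse (φ Y Z) s)) g'
    rw [opComp_apply', sg_one_sg_one]
    simp only [LinearMap.toAddMonoidHom_coe, LinearMap.add_apply, LinearMap.smul_apply,
      LinearMap.comp_apply, smul_neg, smul_add, smul_smul, negOnePow_mul_self, one_smul]
    abel

theorem opFam_delta {n j : ℤ} {φ : Fam C} (h : φ ∈ Hoch C n j) :
    opFam C (delta n φ) = delta n (opFam C φ) := by
  funext Z X s
  have e : opFam C (delta n φ) Z X s = reverse (fun t => dd k (φ X Z t)) s +
      reverse (rmul (C := C) (U := X) (Z := X) (X := Z) fun W t => sg k 1 (φ X W t)) s +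
      ((n.negOnePow : ℤ) • reverse (inner (φ X Z)) s -
        (n.negOnePow : ℤ) • reverse (lmul (C := C) n (Z := X) (X := Z) fun W => φ W Z) s) := by
    rw [← smul_sub, ← reverse_sub, ← reverse_zsmul, ← reverse_add, ← reverse_add]
    rfl
  rw [e, reverse_rmul h, reverse_lmul h, ← inner_reverse s (h.1 X Z)]
  have hd : reverse (fun t => dd k (φ X Z t)) s = dd k (reverse (φ X Z) s) :=
    reverse_map (dd k).toAddMonoidHom s (φ X Z)
  rw [hd]
  change _ = dd k (M := C.Mor X Z) (reverse (φ X Z) s) + rmul (C := C.op) (U := Z) (Z := Z) (X := X) (fun W t => sg k 1 (opFam C φ Z W t)) s +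
    (n.negOnePow : ℤ) • (inner (reverse (φ X Z)) s - lmul (C := C.op) n (Z := Z) (X := X) (fun W => opFam C φ W X) s)
  rw [smul_sub]
  abel

theorem pull_opFam_opFam {n j : ℤ} {φ : Fam C} (h : φ ∈ Hoch C n j) :
    (toOpOp C).pull (opFam C.op (opFam C φ)) = φ := by
  funext Z X s
  exact reverse_reverse (C := C) (N := C.Mor Z X) s (h.1 Z X)

/-- The left-handed form of the vanishing of cocycles supported at an object. -/
theorem KellerData.exists_delta_eq_op {U : C.Obj} (S : KellerData C.op U) {n j : ℤ} {φ : Fam C}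
    (h : φ ∈ Hoch C n j) (hδ : delta n φ = 0) (h0 : ∀ Z X, X ≠ U → φ Z X = 0) :
    ∃ ψ : Fam C, (ψ ∈ Hoch C (n - 1) j ∧ ∀ Z X, X ≠ U → ψ Z X = 0) ∧ delta (n - 1) ψ = φ := by
  obtain ⟨ψ, ⟨hψ, hψ0⟩, hψδ⟩ := S.exists_delta_eq (opFam_mem h)
    (by rw [← opFam_delta h, hδ]; funext Z X s; exact reverse_zero s)
    (fun Z hZ => by
      funext X s
      change reverse (φ X Z) s = 0
      rw [h0 X Z hZ]
      exact reverse_zero s)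
  refine ⟨(toOpOp C).pull (opFam C.op ψ), ⟨(toOpOp C).pull_mem (opFam_mem hψ), ?_⟩, ?_⟩
  · intro Z X hX
    funext s
    change reverse (C := C.op) (ψ X Z) ((toOpOp C).str s) = 0
    rw [hψ0 X hX]
    exact reverse_zero (C := C.op) ((toOpOp C).str s)
  · rw [← FullFunctor.pull_delta, ← opFam_delta hψ, hψδ, pull_opFam_opFam h]

end Reversal

/-! ### Modules over the two-object category -/

section Pairs

variable {k : Type u} [Field k] (Ma Mb : Type u) [AddCommGroup Ma] [Module k Ma]
  [BigradedComplex k Ma] [AddCommGroup Mb] [Module k Mb] [BigradedComplex k Mb]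

/-- A pair of types as a family over the two objects. -/
def pairCarrier (Ma Mb : Type u) : KellerObj.{u} → Type u
  | .a => Ma
  | .b => Mb

instance pairAcg : ∀ Y, AddCommGroup (pairCarrier Ma Mb Y)
  | .a => inferInstanceAs (AddCommGroup Ma)
  | .b => inferInstanceAs (AddCommGroup Mb)

instance pairMod : ∀ Y, Module k (pairCarrier Ma Mb Y)
  | .a => inferInstanceAs (Module k Ma)
  | .b => inferInstanceAs (Module k Mb)

instance pairCx : ∀ Y, BigradedComplex k (pairCarrier Ma Mb Y)
  | .a => inferInstanceAs (BigradedComplex k Ma)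
  | .b => inferInstanceAs (BigradedComplex k Mb)

end Pairs

section Ground

variable {k : Type u} [Field k] {A B : BigradedDGAlgebra k}

theorem lact_ground (P : BigradedDGBimodule (ground k) A) (c : (ground k).carrier) (x : P.carrier) :
    P.lact c x = scalar c • x := by
  have : c = scalar c • (1 : (ground k).carrier) := (mul_one (M := k) c).symm
  conv_lhs => rw [this, map_smul, LinearMap.smul_apply, P.one_lact]

theorem ract_ground (P : BigradedDGBimodule B (ground k)) (x : P.carrier) (c : (ground k).carrier) :
    P.ract x c = scalar c • x := by
  have : c = scalar c • (1 : (ground k).carrier) := (mul_one (M := k) c).symm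
  conv_lhs => rw [this, map_smul, P.ract_one]

theorem strand_acyclic_iff (M : Type u) [AddCommGroup M] [Module k M] [BigradedComplex k M] :
    (∀ j, (strand k M j).Acyclic) ↔ ∀ {i j : ℤ} {x : M}, x ∈ pc k M i j → dd k x = 0 →
      ∃ y ∈ pc k M (i - 1) j, dd k y = x := by
  refine ⟨fun h i j x => ?_, fun h j => ?_⟩
  · exact (subCx_acyclic_iff.1 (h j)) i x
  · exact subCx_acyclic_iff.2 fun i x => h

end Ground

section Right

variable {k : Type u} [Field k] {A B : BigradedDGAlgebra k} (K : BigradedDGBimodule B A)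

/-- The action of morphisms on the extension by zero of a right `A`-module. -/
def rightExtAct (P : BigradedDGBimodule (ground k) A) : ∀ Y X : KellerObj,
    pairCarrier P.carrier PUnit Y →ₗ[k] kellerMor K Y X →ₗ[k] pairCarrier P.carrier PUnit X
  | .a, .a => P.ract
  | .b, .a => 0
  | _, .b => 0

/-- The extension by zero of a right dg `A`-module to a right dg module over `cat (A, B, K)`. -/
def rightExt (P : BigradedDGBimodule (ground k) A) : RMod (cat K) where
  carrier := pairCarrier P.carrier PUnit
  acg := pairAcg P.carrier PUnit
  mod := pairMod P.carrier PUnit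
  cx := pairCx P.carrier PUnit
  act {Y X} := rightExtAct K P Y X
  act_one {X} x := by
    cases X
    · exact P.ract_one x
    · rfl
  act_act {Z Y X} x g f := by
    cases Z <;> cases Y <;> cases X <;>
      first
      | exact (P.ract_mul x g f).symm
      | rfl
      | exact LinearMap.map_zero₂ P.ract f
      | exact (map_zero (P.ract x)).symm
  act_mem {Y X i j i' j' x g} hx hg := by
    cases Y <;> cases X <;>
      first
      | exact P.ract_mem hx hg
      | exact zero_mem _
  leibniz {Y X} x g := by
    cases Y <;> cases X <;>
      first
      | exact P.leibniz_ract x g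
      | rfl
      | exact (map_zero _).trans (add_zero _).symm

/-- The object `a` of `cat (A, B, K)`. -/
def objA : (cat K).Obj := KellerObj.a

/-- The object `b` of `cat (A, B, K)`. -/
def objB : (cat K).Obj := KellerObj.b

/-- The value at `a` of a right dg module over `cat (A, B, K)`. -/
def rightRes (N : RMod (cat K)) : BigradedDGBimodule (ground k) A where
  carrier := N.carrier (objA K)
  acg := N.acg (objA K)
  mod := N.mod (objA K)
  cx := N.cx (objA K)
  lact := LinearMap.lsmul k (N.carrier (objA K)) ∘ₗ scalar
  ract := N.act (Y := (objA K)) (X := (objA K))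
  one_lact x := by simp [scalar_one]
  mul_lact b b' x := by simp [scalar_mul, mul_smul, smul_comm (scalar b) (scalar b')]
  ract_one := N.act_one (X := (objA K))
  ract_mul x a a' := (N.act_act (Z := (objA K)) (Y := (objA K)) (X := (objA K)) x a a').symm
  lact_ract b x a :=
    LinearMap.map_smul₂ (N.act (Y := (objA K)) (X := (objA K))) (scalar b) x a
  lact_mem := by
    intro i j i' j' b x hb hx
    rcases ground_mem k hb with ⟨rfl, rfl⟩ | rfl
    · rw [zero_add, zero_add]
      exact Submodule.smul_mem _ (scalar b) hx
    · simp
  ract_mem := N.act_mem (Y := (objA K)) (X := (objA K))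
  leibniz_lact b x := by simp [ground_dd, ground_sg]
  leibniz_ract := N.leibniz (Y := (objA K)) (X := (objA K))

theorem mem_homs_right {P Q : BigradedDGBimodule (ground k) A} {n j : ℤ}
    {f : P.carrier →ₗ[k] Q.carrier}
    (h1 : ∀ {p q : ℤ} {x : P.carrier}, x ∈ pc k P.carrier p q → f x ∈ pc k Q.carrier (n + p) (j + q))
    (h2 : ∀ x a, f (P.ract x a) = Q.ract (f x) a) : f ∈ homs P Q n j :=
  ⟨h1, h2, fun b x => by rw [lact_ground, lact_ground, map_smul, ground_sg]⟩

theorem rightExt_kProjective {P : BigradedDGBimodule (ground k) A} (hP : IsKProjective P) :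
    (rightExt K P).KProjective := by
  intro N hN n j F hF hd
  have hac : ∀ j, (strand k (rightRes K N).carrier j).Acyclic :=
    (strand_acyclic_iff (rightRes K N).carrier).2 fun hx h0 => hN (Y := (objA K)) hx h0
  obtain ⟨G, hG, hGF⟩ := (subCx_acyclic_iff.1 (hP (rightRes K N) hac j)) n (F (objA K))
    (mem_homs_right (P := P) (Q := rightRes K N) (hF.mem (Y := (objA K)))
      (hF.act (Y := (objA K)) (X := (objA K)))) (hd (objA K))
  refine ⟨fun | .a => G | .b => 0, ⟨fun {Y} => ?_, fun {Y X} => ?_⟩, fun Y => ?_⟩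
  · cases Y
    · exact hG.1
    · exact fun _ => zero_mem _
  · cases Y <;> cases X
    · exact hG.2.1
    · intro x g
      exact (map_zero (N.act (Y := (objA K)) (X := (objB K)) (G x))).symm
    · intro x g
      exact (map_zero G).trans (LinearMap.map_zero₂ (N.act (Y := (objB K)) (X := (objA K))) g).symm
    · intro x g
      exact (LinearMap.map_zero₂ (N.act (Y := (objB K)) (X := (objB K))) g).symm
  · cases Y
    · exact hGF
    · have h0 : F (objB K) = 0 := LinearMap.ext fun _ => map_zero (F (objB K))
      exact (map_zero (homD (k := k) PUnit.{u + 1} (N.carrier (objB K)) (n - 1))).trans h0.symm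

/-- The graded Keller condition for the left action of `B`, as a statement on the morphisms to `b`
in `cat (A, B, K)`. -/
def rightKellerData (R : KProjectiveResolution K.toRight) (hR : ∀ j, QuasiIso (leftAction K R j)) :
    KellerData (cat K) (objB K) where
  M := rightExt K K.toRight
  ι := fun
    | .a => (LinearMap.id : K.carrier →ₗ[k] K.carrier)
    | .b => (0 : PUnit.{u + 1} →ₗ[k] B.carrier)
  ι_hom := by
    refine ⟨fun {Y} => ?_, fun {Y X} => ?_⟩
    · cases Y
      · intro i i' x hx
        rw [zero_add, zero_add]
        exact hx
      · exact fun _ => zero_mem _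
    · cases Y <;> cases X
      · exact fun _ _ => rfl
      · exact fun x _ => (map_zero (kellerComp K .b .a .b x)).symm
      · exact fun _ f => (LinearMap.map_zero₂ K.lact f).symm
      · exact fun _ f => (LinearMap.map_zero₂ (LinearMap.mul k B.carrier) f).symm
  ι_dd Y x := by
    cases Y
    · rfl
    · exact (map_zero (dd k (M := B.carrier))).symm
  ρ := fun
    | .a => (LinearMap.id : K.carrier →ₗ[k] K.carrier)
    | .b => (0 : B.carrier →ₗ[k] PUnit.{u + 1})
  ρ_mem {Y i j x} hx := by
    cases Y
    · exact hx
    · exact zero_mem _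
  ρ_ι Y x := by cases Y <;> rfl
  ι_ρ Y hY x := by
    cases Y
    · rfl
    · exact absurd rfl hY
  M_eq_zero _ := rfl
  mor_eq_zero Y hY x := by
    cases Y
    · rfl
    · exact absurd rfl hY
  P := rightExt K R.P
  π := fun
    | .a => R.π.toLin
    | .b => (0 : PUnit.{u + 1} →ₗ[k] PUnit.{u + 1})
  π_hom := by
    refine ⟨fun {Y} => ?_, fun {Y X} => ?_⟩
    · cases Y
      · intro i i' x hx
        rw [zero_add, zero_add]
        exact R.π.map_mem hx
      · exact fun _ => zero_mem _
    · cases Y <;> cases X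
      · exact R.π.map_ract
      · exact fun _ _ => rfl
      · exact fun _ _ => map_zero R.π.toLin
      · exact fun _ _ => rfl
  π_dd Y x := by
    cases Y
    · exact R.π.map_d x
    · rfl
  π_inj {Y i j x} hx h0 h := by
    cases Y
    · exact ((subCxMap_quasiIso_iff _ _ _).1 (R.quasiIso j) i).1 x hx h0 h
    · exact ⟨PUnit.unit, trivial, rfl⟩
  π_surj {Y i j y} hy h0 := by
    cases Y
    · exact ((subCxMap_quasiIso_iff _ _ _).1 (R.quasiIso j) i).2 y hy h0
    · exact ⟨PUnit.unit, trivial, rfl, PUnit.unit, trivial, rfl⟩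
  kProjective := rightExt_kProjective K R.kProjective
  keller_inj {n j b} hb h0 h := by
    obtain ⟨g, hg, hgd⟩ := h
    exact ((subCxMap_quasiIso_iff _ _ _).1 (hR j) n).1 b hb h0
      ⟨g (objA K), mem_homs_right (hg.mem (Y := objA K)) (hg.act (Y := objA K) (X := objA K)),
        LinearMap.ext (hgd (objA K))⟩
  keller_surj {n j g} hg h0 := by
    obtain ⟨b, hb, hb0, f, hf, hfd⟩ := ((subCxMap_quasiIso_iff _ _ _).1 (hR j) n).2 (g (objA K))
      (mem_homs_right (hg.mem (Y := objA K)) (hg.act (Y := objA K) (X := objA K))) (h0 (objA K))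
    refine ⟨b, hb, hb0, fun | .a => f | .b => (0 : PUnit.{u + 1} →ₗ[k] B.carrier),
      ⟨fun {Y} => ?_, fun {Y X} => ?_⟩, fun Y x => ?_⟩
    · cases Y
      · exact hf.1
      · exact fun _ => zero_mem _
    · cases Y <;> cases X
      · exact hf.2.1
      · exact fun x _ => (map_zero (kellerComp K .b .a .b (f x))).symm
      · exact fun _ g => (map_zero f).trans (LinearMap.map_zero₂ K.lact g).symm
      · exact fun _ f => (LinearMap.map_zero₂ (LinearMap.mul k B.carrier) f).symm
    · cases Y
      · exact LinearMap.congr_fun hfd x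
      · have h1 := map_zero (g (objB K))
        have h2 := LinearMap.congr_fun
          (map_zero (homD (k := k) PUnit.{u + 1} B.carrier (n - 1))) x
        refine Eq.trans h2 ?_
        refine Eq.trans ?_ (congrArg₂ (fun x y : B.carrier => x - y) h1.symm (mul_zero (M₀ := B.carrier) b).symm)
        exact (sub_zero (0 : B.carrier)).symm

end Right

/-! ### Left modules as modules over the opposite category -/

section SignFlip

variable {k : Type u} [Field k] {L M N : Type u} [AddCommGroup L] [Module k L]
  [BigradedComplex k L] [AddCommGroup M] [Module k M] [BigradedComplex k M]
  [AddCommGroup N] [Module k N]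

/-- The bilinear map `(b, x) ↦ (-1) ^ (|b| |x|) f (b, x)`. -/
def signFlip (f : L →ₗ[k] M →ₗ[k] N) : L →ₗ[k] M →ₗ[k] N :=
  f ∘ₗ evenPart k + (f ∘ₗ oddPart k).compl₂ (sg k 1)

theorem signFlip_apply (f : L →ₗ[k] M →ₗ[k] N) (b : L) (x : M) :
    signFlip f b x = f (evenPart k b) x + f (oddPart k b) (sg k 1 x) := rfl

theorem signFlip_signFlip (f : L →ₗ[k] M →ₗ[k] N) : signFlip (signFlip f) = f := by
  ext b x
  rw [signFlip_apply, signFlip_apply, signFlip_apply, evenPart_evenPart, oddPart_evenPart,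
    evenPart_oddPart, oddPart_oddPart, sg_one_sg_one, map_zero, LinearMap.zero_apply, add_zero,
    zero_add, ← LinearMap.add_apply, ← map_add,
    evenPart_add_oddPart]

theorem signFlip_of_mem (f : L →ₗ[k] M →ₗ[k] N) {i j : ℤ} {b : L} (hb : b ∈ pc k L i j) (x : M) :
    signFlip f b x = f b (sg k i x) := by
  rw [signFlip_apply, oddPart_apply]
  by_cases hi : Even i
  · rw [evenPart_of_even k hb hi, sg_even k hi, sub_self, map_zero, LinearMap.zero_apply, add_zero]
  · have h1 : sg k i x = sg k 1 x := by
      rw [show i = (i - 1) + 1 by ring, ← sg_sg,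
        sg_even k ((Int.not_even_iff_odd.1 hi).sub_odd odd_one)]
    rw [evenPart_of_odd k hb hi, sub_zero, map_zero, LinearMap.zero_apply, zero_add, h1]

theorem signFlip_one (f : L →ₗ[k] M →ₗ[k] N) {b : L} (hb : b ∈ pc k L 0 0) (x : M) :
    signFlip f b x = f b x := by
  rw [signFlip_of_mem f hb, sg_even k Even.zero]

end SignFlip

section Left

variable {k : Type u} [Field k] {A B : BigradedDGAlgebra k}

theorem evenPart_mul (x y : B.carrier) : evenPart k (x * y) =
    evenPart k x * evenPart k y + oddPart k x * oddPart k y :=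
  evenPart_comp (C := oneObject B) (Z := PUnit.unit) (Y := PUnit.unit) (X := PUnit.unit) x y

theorem oddPart_mul (x y : B.carrier) : oddPart k (x * y) =
    evenPart k x * oddPart k y + oddPart k x * evenPart k y :=
  oddPart_comp (C := oneObject B) (Z := PUnit.unit) (Y := PUnit.unit) (X := PUnit.unit) x y

theorem signFlip_lact_mul (P : BigradedDGBimodule B (ground k)) (g f : B.carrier) (x : P.carrier) :
    signFlip P.lact f (signFlip P.lact g x) =
      signFlip P.lact (f * evenPart k g + sg k 1 f * oddPart k g) x := by
  simp only [signFlip_apply, map_add, evenPart_mul, oddPart_mul, evenPart_sg, oddPart_sg,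
    evenPart_evenPart, evenPart_oddPart, oddPart_evenPart, oddPart_oddPart, mul_zero, zero_add,
    add_zero, P.mul_lact, LinearMap.add_apply, sg_lact, sg_evenPart, sg_oddPart, sg_one_sg_one,
    map_zsmul, LinearMap.smul_apply, Int.negOnePow_one, Units.val_neg, Units.val_one, smul_mul_assoc]
  abel

theorem dd_signFlip_lact (P : BigradedDGBimodule B (ground k)) (g : B.carrier) (x : P.carrier) :
    dd k (signFlip P.lact g x) =
      signFlip P.lact g (dd k x) + signFlip P.lact (dd k g) (sg k 1 x) := by
  have h : dd k (sg k 1 x) = - sg k 1 (dd k x) := by rw [dd_sg]; simp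
  simp only [signFlip_apply, map_add, P.leibniz_lact, evenPart_dd, oddPart_dd, sg_evenPart,
    sg_oddPart, h, sg_one_sg_one, Int.negOnePow_one, Units.val_neg, Units.val_one, neg_smul,
    one_smul, map_neg, LinearMap.neg_apply, neg_neg]
  abel

theorem signFlip_lact_mem (P : BigradedDGBimodule B (ground k)) {i j i' j' : ℤ} {g : B.carrier}
    {x : P.carrier} (hx : x ∈ pc k P.carrier i j) (hg : g ∈ pc k B.carrier i' j') :
    signFlip P.lact g x ∈ pc k P.carrier (i + i') (j + j') := by
  rw [signFlip_of_mem P.lact hg, add_comm i, add_comm j]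
  exact P.lact_mem hg (sg_mem k i' hx)

variable (K : BigradedDGBimodule B A)

/-- The action of morphisms on the extension by zero of a left `B`-module. -/
def leftExtAct (P : BigradedDGBimodule B (ground k)) : ∀ Y X : KellerObj,
    pairCarrier PUnit P.carrier Y →ₗ[k] kellerMor K X Y →ₗ[k] pairCarrier PUnit P.carrier X
  | .b, .b => (signFlip P.lact).flip
  | .a, .b => 0
  | _, .a => 0

/-- The extension by zero of a left dg `B`-module to a right dg module over the opposite of
`cat (A, B, K)`. -/
def leftExt (P : BigradedDGBimodule B (ground k)) : RMod (cat K).op where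
  carrier := pairCarrier PUnit P.carrier
  acg := pairAcg PUnit P.carrier
  mod := pairMod PUnit P.carrier
  cx := pairCx PUnit P.carrier
  act {Y X} := leftExtAct K P Y X
  act_one {X} x := by
    cases X
    · rfl
    · exact (signFlip_one P.lact B.one_mem x).trans (P.one_lact x)
  act_act {Z Y X} x g f := by
    cases Z <;> cases Y <;> cases X <;>
      first
      | exact signFlip_lact_mul P g f x
      | rfl
      | exact LinearMap.map_zero₂ (signFlip P.lact).flip f
      | exact (map_zero ((signFlip P.lact).flip x)).symm
      | exact ((congrArg ((signFlip P.lact).flip x) (add_zero (0 : B.carrier))).trans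
          (map_zero ((signFlip P.lact).flip x))).symm
  act_mem {Y X i j i' j' x g} hx hg := by
    cases Y <;> cases X <;>
      first
      | exact signFlip_lact_mem P hx hg
      | exact zero_mem _
  leibniz {Y X} x g := by
    cases Y <;> cases X <;>
      first
      | exact dd_signFlip_lact P g x
      | rfl
      | exact (map_zero _).trans (add_zero _).symm

/-- The action of the endomorphisms of `b` on the value at `b` of a right dg module over the opposite
of `cat (A, B, K)`. -/
def endAct (N : RMod (cat K).op) :
    N.carrier (objB K) →ₗ[k] B.carrier →ₗ[k] N.carrier (objB K) :=
  N.act (Y := objB K) (X := objB K)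

theorem endAct_endAct (N : RMod (cat K).op) (x : N.carrier (objB K)) (g f : B.carrier) :
    endAct K N (endAct K N x g) f =
      endAct K N x (f * evenPart k g + sg k 1 f * oddPart k g) :=
  N.act_act (Z := objB K) (Y := objB K) (X := objB K) x g f

theorem sg_endAct (N : RMod (cat K).op) (n : ℤ) (x : N.carrier (objB K)) (g : B.carrier) :
    sg k n (endAct K N x g) = endAct K N (sg k n x) (sg k n g) :=
  N.sg_act n (Y := objB K) (X := objB K) x g

theorem dd_endAct (N : RMod (cat K).op) (x : N.carrier (objB K)) (g : B.carrier) :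
    dd k (endAct K N x g) = endAct K N (dd k x) g + endAct K N (sg k 1 x) (dd k g) :=
  N.leibniz (Y := objB K) (X := objB K) x g

theorem leftRes_mul (N : RMod (cat K).op) (b b' : B.carrier) (x : N.carrier (objB K)) :
    signFlip (endAct K N).flip (b * b') x =
      signFlip (endAct K N).flip b (signFlip (endAct K N).flip b' x) := by
  simp only [signFlip_apply, LinearMap.flip_apply, map_add, LinearMap.add_apply, sg_endAct,
    endAct_endAct, evenPart_mul, oddPart_mul, evenPart_evenPart, evenPart_oddPart,
    oddPart_evenPart, oddPart_oddPart, mul_zero, add_zero, zero_add, sg_evenPart, sg_oddPart,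
    sg_one_sg_one, Int.negOnePow_one, Units.val_neg, Units.val_one, neg_mul, neg_smul, one_smul,
    map_neg, neg_neg]
  abel

theorem leftRes_leibniz (N : RMod (cat K).op) (b : B.carrier) (x : N.carrier (objB K)) :
    dd k (signFlip (endAct K N).flip b x) = signFlip (endAct K N).flip (dd k b) x +
      signFlip (endAct K N).flip (sg k 1 b) (dd k x) := by
  have h : dd k (sg k 1 x) = - sg k 1 (dd k x) := by rw [dd_sg]; simp
  simp only [signFlip_apply, LinearMap.flip_apply, map_add, dd_endAct, evenPart_dd, oddPart_dd,
    evenPart_sg, oddPart_sg, h, sg_one_sg_one, map_neg, LinearMap.neg_apply, Int.negOnePow_one,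
    Units.val_neg, Units.val_one, neg_smul, one_smul]
  abel

/-- The value at `b` of a right dg module over the opposite of `cat (A, B, K)`. -/
def leftRes (N : RMod (cat K).op) : BigradedDGBimodule B (ground k) where
  carrier := N.carrier (objB K)
  acg := N.acg (objB K)
  mod := N.mod (objB K)
  cx := N.cx (objB K)
  lact := signFlip (endAct K N).flip
  ract := (LinearMap.lsmul k (N.carrier (objB K)) ∘ₗ scalar).flip
  one_lact x := (signFlip_one (endAct K N).flip B.one_mem x).trans (N.act_one (X := objB K) x)
  mul_lact := leftRes_mul K N
  ract_one x := by simp [scalar_one]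
  ract_mul x a a' := by simp [scalar_mul, mul_smul, smul_comm (scalar a) (scalar a')]
  lact_ract b x a := (map_smul (signFlip (endAct K N).flip b) (scalar a) x).symm
  lact_mem {i j i' j' b x} hb hx := by
    rw [signFlip_of_mem _ hb, add_comm i, add_comm j]
    exact N.act_mem (Y := objB K) (X := objB K) (sg_mem k i hx) hb
  ract_mem := by
    intro i j i' j' x a hx ha
    rcases ground_mem k ha with ⟨rfl, rfl⟩ | rfl
    · rw [add_zero, add_zero]
      exact Submodule.smul_mem _ (scalar a) hx
    · simp
  leibniz_lact := leftRes_leibniz K N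
  leibniz_ract x a := by simp [ground_dd]

theorem sg_one_apply_of_degree {M N : Type u} [AddCommGroup M] [Module k M] [BigradedComplex k M]
    [AddCommGroup N] [Module k N] [BigradedComplex k N] {n j : ℤ} {f : M →ₗ[k] N}
    (h : ∀ {p q : ℤ} {x : M}, x ∈ pc k M p q → f x ∈ pc k N (n + p) (j + q)) (x : M) :
    sg k 1 (f x) = (n.negOnePow : ℤ) • f (sg k 1 x) := by
  have : sg k 1 ∘ₗ f = (n.negOnePow : ℤ) • (f ∘ₗ sg k 1) := by
    refine ext_pc k fun p q x hx => ?_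
    simp only [LinearMap.comp_apply, LinearMap.smul_apply]
    rw [sg_of_mem k 1 (h hx), sg_of_mem k 1 hx, map_zsmul, smul_smul, one_mul, one_mul,
      Int.negOnePow_add, Units.val_mul]
  exact LinearMap.congr_fun this x

/-- The sign rule for homomorphisms of left modules is the unsigned rule for right modules over the
opposite algebra. -/
theorem map_signFlip_iff {L M N : Type u} [AddCommGroup L] [Module k L] [BigradedComplex k L]
    [AddCommGroup M] [Module k M] [BigradedComplex k M]
    [AddCommGroup N] [Module k N] [BigradedComplex k N] {n j : ℤ} {f : M →ₗ[k] N}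
    (h : ∀ {p q : ℤ} {x : M}, x ∈ pc k M p q → f x ∈ pc k N (n + p) (j + q))
    {u : L →ₗ[k] M →ₗ[k] M} {v : L →ₗ[k] N →ₗ[k] N} :
    (∀ b x, f (signFlip u b x) = signFlip v b (f x)) ↔ ∀ b x, f (u b x) = v (sg k n b) (f x) := by
  have hs := sg_one_apply_of_degree h
  have e : ∀ b : L, sg k n b = evenPart k b + (n.negOnePow : ℤ) • oddPart k b := fun b => by
    conv_lhs => rw [← evenPart_add_oddPart k b, map_add, sg_evenPart, sg_oddPart]
  constructor
  · intro H b x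
    have h1 := H (evenPart k b) x
    have h2 := H (oddPart k b) (sg k 1 x)
    simp only [signFlip_apply, evenPart_evenPart, oddPart_evenPart, evenPart_oddPart,
      oddPart_oddPart, map_zero, LinearMap.zero_apply, add_zero, zero_add, sg_one_sg_one, hs,
      map_zsmul, smul_zero] at h1 h2
    conv_lhs => rw [← evenPart_add_oddPart k b, map_add, LinearMap.add_apply, map_add, h1, h2]
    rw [e, map_add, LinearMap.add_apply, map_zsmul, LinearMap.smul_apply]
  · intro H b x
    rw [signFlip_apply, signFlip_apply, map_add, H, H, sg_evenPart, sg_oddPart, hs, map_zsmul,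
      map_zsmul, LinearMap.smul_apply]

theorem mem_homs_left {P Q : BigradedDGBimodule B (ground k)} {n j : ℤ}
    {f : P.carrier →ₗ[k] Q.carrier}
    (h1 : ∀ {p q : ℤ} {x : P.carrier}, x ∈ pc k P.carrier p q → f x ∈ pc k Q.carrier (n + p) (j + q))
    (h2 : ∀ b x, f (signFlip P.lact b x) = signFlip Q.lact b (f x)) : f ∈ homs P Q n j :=
  ⟨h1, fun x b => by rw [ract_ground, ract_ground, map_smul], (map_signFlip_iff h1).1 h2⟩

theorem leftExt_kProjective {P : BigradedDGBimodule B (ground k)} (hP : IsKProjective P) :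
    (leftExt K P).KProjective := by
  intro N hN n j F hF hd
  have hac : ∀ j, (strand k (leftRes K N).carrier j).Acyclic :=
    (strand_acyclic_iff (leftRes K N).carrier).2 fun hx h0 => hN (Y := objB K) hx h0
  have hflip : ∀ (b : B.carrier) (y : N.carrier (objB K)),
      signFlip (leftRes K N).lact b y = endAct K N y b := fun b y =>
    LinearMap.congr_fun (LinearMap.congr_fun (signFlip_signFlip (endAct K N).flip) b) y
  obtain ⟨G, hG, hGF⟩ := (subCx_acyclic_iff.1 (hP (leftRes K N) hac j)) n (F (objB K))
    (mem_homs_left (P := P) (Q := leftRes K N) (hF.mem (Y := objB K))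
      fun b x => (hF.act (Y := objB K) (X := objB K) x b).trans (hflip b _).symm) (hd (objB K))
  refine ⟨fun | .a => 0 | .b => G, ⟨fun {Y} => ?_, fun {Y X} => ?_⟩, fun Y => ?_⟩
  · cases Y
    · exact fun _ => zero_mem _
    · exact hG.1
  · cases Y <;> cases X
    · intro x g
      exact (LinearMap.map_zero₂ (N.act (Y := objA K) (X := objA K)) g).symm
    · intro x g
      exact (map_zero G).trans (LinearMap.map_zero₂ (N.act (Y := objA K) (X := objB K)) g).symm
    · intro x g
      exact (map_zero (N.act (Y := objB K) (X := objA K) (G x))).symm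
    · exact fun x b => ((map_signFlip_iff hG.1).2 hG.2.2 b x).trans (hflip b (G x))
  · cases Y
    · have h0 : F (objA K) = 0 := LinearMap.ext fun _ => map_zero (F (objA K))
      exact (map_zero (homD (k := k) PUnit.{u + 1} (N.carrier (objA K)) (n - 1))).trans h0.symm
    · exact hGF

theorem map_signFlip_lact {P Q : BigradedDGBimodule B (ground k)} (f : BimoduleHom P Q)
    (b : B.carrier) (x : P.carrier) :
    f.toLin (signFlip P.lact b x) = signFlip Q.lact b (f.toLin x) := by
  have hf : ∀ {p q : ℤ} {x : P.carrier}, x ∈ pc k P.carrier p q →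
      f.toLin x ∈ pc k Q.carrier (0 + p) (0 + q) := fun hx => by
    rw [zero_add, zero_add]
    exact f.map_mem hx
  refine (map_signFlip_iff hf).2 (fun c y => ?_) b x
  rw [sg_even k Even.zero]
  exact f.map_lact c y

theorem opComp_lact (x : K.carrier) (b : B.carrier) :
    opComp (cat K) (objA K) (objB K) (objB K) x b = signFlip K.lact b x :=
  opComp_apply' (C := cat K) (Z := objA K) (Y := objB K) (X := objB K) x b

theorem opComp_ract {n j : ℤ} {a : A.carrier} (ha : a ∈ pc k A.carrier n j) (x : K.carrier) :
    opComp (cat K) (objA K) (objA K) (objB K) a x = K.ract (sg k n x) a :=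
  signFlip_of_mem K.ract.flip ha x

/-- The graded Keller condition for the right action of `A`, as a statement on the morphisms from
`a` in `cat (A, B, K)`. -/
def leftKellerData (R : KProjectiveResolution K.toLeft) (hR : ∀ j, QuasiIso (rightAction K R j)) :
    KellerData (cat K).op (objA K) where
  M := leftExt K K.toLeft
  ι := fun
    | .a => (0 : PUnit.{u + 1} →ₗ[k] A.carrier)
    | .b => (LinearMap.id : K.carrier →ₗ[k] K.carrier)
  ι_hom := by
    refine ⟨fun {Y} => ?_, fun {Y X} => ?_⟩
    · cases Y
      · exact fun _ => zero_mem _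
      · intro i i' x hx
        rw [zero_add, zero_add]
        exact hx
    · cases Y <;> cases X
      · exact fun _ f => (LinearMap.map_zero₂ ((cat K).op.comp (Z := objA K) (Y := objA K)
          (X := objA K)) f).symm
      · exact fun _ f => (LinearMap.map_zero₂ ((cat K).op.comp (Z := objA K) (Y := objA K)
          (X := objB K)) f).symm
      · exact fun x _ => (map_zero ((cat K).op.comp (Z := objA K) (Y := objB K)
          (X := objA K) x)).symm
      · exact fun x f => (opComp_apply' (C := cat K) (Z := objA K) (Y := objB K)
          (X := objB K) x f).symm
  ι_dd Y x := by
    cases Y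
    · exact (map_zero (dd k (M := A.carrier))).symm
    · rfl
  ρ := fun
    | .a => (0 : A.carrier →ₗ[k] PUnit.{u + 1})
    | .b => (LinearMap.id : K.carrier →ₗ[k] K.carrier)
  ρ_mem {Y i j x} hx := by
    cases Y
    · exact zero_mem _
    · exact hx
  ρ_ι Y x := by cases Y <;> rfl
  ι_ρ Y hY x := by
    cases Y
    · exact absurd rfl hY
    · rfl
  M_eq_zero _ := rfl
  mor_eq_zero Y hY x := by
    cases Y
    · exact absurd rfl hY
    · rfl
  P := leftExt K R.P
  π := fun
    | .a => (0 : PUnit.{u + 1} →ₗ[k] PUnit.{u + 1})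
    | .b => R.π.toLin
  π_hom := by
    refine ⟨fun {Y} => ?_, fun {Y X} => ?_⟩
    · cases Y
      · exact fun _ => zero_mem _
      · intro i i' x hx
        rw [zero_add, zero_add]
        exact R.π.map_mem hx
    · cases Y <;> cases X
      · exact fun _ _ => rfl
      · exact fun _ _ => map_zero R.π.toLin
      · exact fun _ _ => rfl
      · exact fun x b => map_signFlip_lact R.π b x
  π_dd Y x := by
    cases Y
    · rfl
    · exact R.π.map_d x
  π_inj {Y i j x} hx h0 h := by
    cases Y
    · exact ⟨PUnit.unit, trivial, rfl⟩
    · exact ((subCxMap_quasiIso_iff _ _ _).1 (R.quasiIso j) i).1 x hx h0 h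
  π_surj {Y i j y} hy h0 := by
    cases Y
    · exact ⟨PUnit.unit, trivial, rfl, PUnit.unit, trivial, rfl⟩
    · exact ((subCxMap_quasiIso_iff _ _ _).1 (R.quasiIso j) i).2 y hy h0
  kProjective := leftExt_kProjective K R.kProjective
  keller_inj {n j b} hb h0 h := by
    obtain ⟨g, hg, hgd⟩ := h
    exact ((subCxMap_quasiIso_iff _ _ _).1 (hR j) n).1 b hb h0
      ⟨g (objB K), mem_homs_left (P := R.P) (Q := K.toLeft) (hg.mem (Y := objB K))
        (fun b x => (hg.act (Y := objB K) (X := objB K) x b).trans (opComp_lact K _ b)),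
        LinearMap.ext fun x => (hgd (objB K) x).trans (opComp_ract K hb _)⟩
  keller_surj {n j g} hg h0 := by
    obtain ⟨b, hb, hb0, f, hf, hfd⟩ := ((subCxMap_quasiIso_iff _ _ _).1 (hR j) n).2 (g (objB K))
      (mem_homs_left (P := R.P) (Q := K.toLeft) (hg.mem (Y := objB K))
        (fun b x => (hg.act (Y := objB K) (X := objB K) x b).trans (opComp_lact K _ b)))
      (h0 (objB K))
    refine ⟨b, hb, hb0, fun | .a => (0 : PUnit.{u + 1} →ₗ[k] A.carrier) | .b => f,
      ⟨fun {Y} => ?_, fun {Y X} => ?_⟩, fun Y x => ?_⟩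
    · cases Y
      · exact fun _ => zero_mem _
      · exact hf.1
    · cases Y <;> cases X
      · exact fun _ f => (LinearMap.map_zero₂ ((cat K).op.comp (Z := objA K) (Y := objA K)
          (X := objA K)) f).symm
      · exact fun _ g => (map_zero f).trans (LinearMap.map_zero₂ ((cat K).op.comp (Z := objA K)
          (Y := objA K) (X := objB K)) g).symm
      · exact fun x _ => (map_zero ((cat K).op.comp (Z := objA K) (Y := objB K)
          (X := objA K) (f x))).symm
      · exact fun x b => ((map_signFlip_iff hf.1).2 hf.2.2 b x).trans (opComp_lact K (f x) b).symm
    · cases Y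
      · have h1 := map_zero (g (objA K))
        have h2 := LinearMap.congr_fun
          (map_zero (homD (k := k) PUnit.{u + 1} A.carrier (n - 1))) x
        refine Eq.trans h2 ?_
        refine Eq.trans ?_ (congrArg₂ (fun x y : A.carrier => x - y) h1.symm
          (map_zero ((cat K).op.comp (Z := objA K) (Y := objA K) (X := objA K) b)).symm)
        exact (sub_zero (0 : A.carrier)).symm
      · refine (LinearMap.congr_fun hfd x).trans ?_
        exact congrArg (fun y : K.carrier => (show K.carrier from g (objB K) x) - y) (opComp_ract K hb _).symm

end Left

/-! ### Restriction to a full subcategory -/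

section Restriction

/-- Choosing the components of an element of a direct sum. -/
theorem exists_directSum {ι : Type*} {M : ι → Type*} [∀ j, AddCommMonoid (M j)]
    {P : ∀ j, M j → Prop} (h : ∀ j, ∃ m, P j m) (s : Finset ι) (h0 : ∀ j, j ∉ s → P j 0) :
    ∃ x : DirectSum ι M, ∀ j, P j (x j) := by
  classical
  choose m hm using h
  refine ⟨DirectSum.mk M s fun j => m j, fun j => ?_⟩
  by_cases hj : j ∈ s
  · rw [DirectSum.mk_apply_of_mem hj]
    exact hm j
  · rw [DirectSum.mk_apply_of_notMem hj]
    exact h0 j hj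

variable {k : Type u} [Field k] {C D : BigradedDGCategory k}

theorem delta_zero (n : ℤ) : delta n (0 : Fam C) = 0 := map_zero (deltaL C n)

theorem delta_sub (n : ℤ) (φ ψ : Fam C) : delta n (φ - ψ) = delta n φ - delta n ψ :=
  map_sub (deltaL C n) φ ψ

theorem delta_add (n : ℤ) (φ ψ : Fam C) : delta n (φ + ψ) = delta n φ + delta n ψ :=
  map_add (deltaL C n) φ ψ

theorem hochGr_d (n : ℤ) (x : DirectSum ℤ fun j => Hoch C n j) :
    (HochGr C).d n (n + 1) x =
      DirectSum.lmap (fun j => (deltaL C n).restrict fun _ h => delta_mem (j := j) h) x := by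
  simp only [HochGr, CochainComplex.of_d]
  rfl

theorem hochGr_d_eq_zero_iff (n : ℤ) (x : DirectSum ℤ fun j => Hoch C n j) :
    (HochGr C).d n (n + 1) x = 0 ↔ ∀ j, delta n (x j : Fam C) = 0 := by
  rw [hochGr_d]
  constructor
  · intro h j
    exact congrArg (fun y : DirectSum ℤ fun j => Hoch C (n + 1) j => (y j : Fam C)) h
  · intro h
    refine DFinsupp.ext fun j => Subtype.ext ?_
    exact h j

theorem hochGr_exists_d_eq_iff (n : ℤ) (x : DirectSum ℤ fun j => Hoch C n j) :
    (∃ z, (HochGr C).d (n - 1) n z = x) ↔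
      ∀ j, ∃ ψ ∈ Hoch C (n - 1) j, delta (n - 1) ψ = (x j : Fam C) := by
  classical
  obtain ⟨m, rfl⟩ : ∃ m, n = m + 1 := ⟨n - 1, by ring⟩
  have hm : m + 1 - 1 = m := by ring
  rw [hm]
  constructor
  · rintro ⟨z, hz⟩ j
    refine ⟨((show DirectSum ℤ fun j => Hoch C m j from z) j : Fam C), Subtype.prop _, ?_⟩
    exact congrArg (fun y : DirectSum ℤ fun j => Hoch C (m + 1) j => (y j : Fam C))
      ((hochGr_d m z).symm.trans hz)
  · intro h
    obtain ⟨z, hz⟩ := exists_directSum (M := fun j => Hoch C m j)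
      (P := fun j ψ => delta m (ψ : Fam C) = (x j : Fam C))
      (fun j => let ⟨ψ, h1, h2⟩ := h j; ⟨⟨ψ, h1⟩, h2⟩) (DFinsupp.support x) fun j hj => by
        rw [DFinsupp.notMem_support_iff.1 hj]
        exact delta_zero m
    exact ⟨z, (hochGr_d m z).trans (DFinsupp.ext fun j => Subtype.ext (hz j))⟩

/-- Restriction to a full subcategory is a quasi-isomorphism when it is surjective on cochains with
acyclic kernel. -/
theorem FullFunctor.proj_quasiIso (F : FullFunctor C D)
    (hs : ∀ {n j : ℤ} {φ : Fam C}, φ ∈ Hoch C n j → ∃ φ' ∈ Hoch D n j, F.pull φ' = φ)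
    (hk : ∀ {n j : ℤ} {φ : Fam D}, φ ∈ Hoch D n j → delta n φ = 0 → F.pull φ = 0 →
      ∃ ψ ∈ Hoch D (n - 1) j, F.pull ψ = 0 ∧ delta (n - 1) ψ = φ) : QuasiIso F.proj := by
  classical
  have lift : ∀ {n j : ℤ} {φ : Fam D} {y : Fam C}, φ ∈ Hoch D n j → delta n φ = 0 →
      y ∈ Hoch C (n - 1) j → delta (n - 1) y = F.pull φ →
        ∃ ψ ∈ Hoch D (n - 1) j, delta (n - 1) ψ = φ := by
    intro n j φ y hφ h0 hy h
    -- A lift `y'` of the primitive has the correct boundary up to the kernel of the restriction.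
    obtain ⟨y', hy', rfl⟩ := hs hy
    have hd := delta_mem hy'
    have hdd := delta_delta hy'
    rw [sub_add_cancel] at hd hdd
    obtain ⟨ψ, hψ, -, h1⟩ := hk (sub_mem hφ hd) (by rw [delta_sub, h0, hdd, sub_zero])
      (by rw [map_sub, F.pull_delta, h, sub_self])
    exact ⟨ψ + y', add_mem hψ hy', by rw [delta_add, h1, sub_add_cancel]⟩
  have lift' : ∀ {n j : ℤ} {y : Fam C}, y ∈ Hoch C n j → delta n y = 0 →
      ∃ φ : Hoch D n j, delta n (φ : Fam D) = 0 ∧ F.pull φ = y := by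
    intro n j y hy h0
    -- A lift `y'` of the cocycle has a boundary in the kernel, by which it can be corrected.
    obtain ⟨y', hy', rfl⟩ := hs hy
    obtain ⟨ψ, hψ, h1, h2⟩ := hk (delta_mem hy') (delta_delta hy')
      (by rw [F.pull_delta, h0])
    rw [add_sub_cancel_right] at hψ h2
    exact ⟨⟨y' - ψ, sub_mem hy' hψ⟩, by rw [delta_sub, h2, sub_self],
      by rw [map_sub, h1, sub_zero]⟩
  rw [cochain_quasiIso_iff]
  intro n
  constructor
  · intro x hx hy
    refine (hochGr_exists_d_eq_iff n x).2 fun j => ?_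
    obtain ⟨y, hy, h⟩ := (hochGr_exists_d_eq_iff n _).1 hy j
    exact lift (Subtype.prop _) ((hochGr_d_eq_zero_iff n x).1 hx j) hy h
  · intro y hy
    have hy := (hochGr_d_eq_zero_iff n y).1 hy
    let y' : DirectSum ℤ fun j => Hoch C n j := y
    obtain ⟨x, hx⟩ := exists_directSum (M := fun j => Hoch D n j)
      (P := fun j φ => delta n (φ : Fam D) = 0 ∧
        F.pull (φ : Fam D) = (y' j : Fam C))
      (fun j => lift' (Subtype.prop _) (hy j))
      (DFinsupp.support y') fun j hj => by
        rw [DFinsupp.notMem_support_iff.1 hj]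
        exact ⟨delta_zero n, map_zero F.pull⟩
    refine ⟨x, (hochGr_d_eq_zero_iff n x).2 fun j => (hx j).1, ?_⟩
    refine (hochGr_exists_d_eq_iff n _).2 fun j => ⟨0, zero_mem _, ?_⟩
    rw [delta_zero]
    exact ((sub_eq_zero (a := (y' j : Fam C))).2
      (hx j).2.symm).symm

end Restriction

section OneObject

variable {k : Type u} [Field k] {A : BigradedDGAlgebra k} {C : BigradedDGCategory k}

/-! ### Extension by zero and the projections -/

/-- The string of elements of `A` obtained by applying maps from the morphisms of `C` to `A`. -/
def retractStr (ret : ∀ Z X, C.Mor Z X →ₗ[k] A.carrier) :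
    {Z X : C.Obj} → Str C Z X → Str (oneObject A) PUnit.unit PUnit.unit
  | _, _, .nil _ => .nil (C := oneObject A) PUnit.unit
  | _, _, .cons g s =>
    .cons (C := oneObject A) (Y := PUnit.unit) (ret _ _ g) (retractStr ret s)

theorem retractStr_append (ret : ∀ Z X, C.Mor Z X →ₗ[k] A.carrier) {Z Y X : C.Obj}
    (s : Str C Z Y) (t : Str C Y X) :
    retractStr ret (s.append t) = (retractStr ret s).append (retractStr ret t) := by
  induction s with
  | nil => rfl
  | cons g s ih => exact congrArg (Str.cons (C := oneObject A) _) (ih t)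

/-- Cochains on a full subcategory with one object extend, by zero. -/
theorem FullFunctor.exists_pull_eq (F : FullFunctor (oneObject A) C)
    (ret : ∀ Z X, C.Mor Z X →ₗ[k] A.carrier) (inc : ∀ Z X, A.carrier →ₗ[k] C.Mor Z X)
    (ret_mem : ∀ {Z X i j g}, g ∈ pc k (C.Mor Z X) i j → ret Z X g ∈ pc k A.carrier i j)
    (inc_mem : ∀ {Z X i j a}, a ∈ pc k A.carrier i j → inc Z X a ∈ pc k (C.Mor Z X) i j)
    (ret_map : ∀ a, ret _ _ (F.map PUnit.unit PUnit.unit a) = a)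
    (inc_map : ∀ a, inc _ _ a = F.map PUnit.unit PUnit.unit a)
    {n j : ℤ} {φ : Fam (oneObject A)} (h : φ ∈ Hoch (oneObject A) n j) :
    ∃ φ' ∈ Hoch C n j, F.pull φ' = φ := by
  refine ⟨fun Z X s => inc Z X (φ PUnit.unit PUnit.unit (retractStr ret s)),
    ⟨fun Z X Y W s t c g g' => ?_, fun {Z X s p q} hs => inc_mem (h.2 ?_)⟩, ?_⟩
  · have := h.1 PUnit.unit PUnit.unit PUnit.unit PUnit.unit (retractStr ret s) (retractStr ret t) c
      (ret Y W g) (ret Y W g')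
    simp only [retractStr_append, retractStr, map_add, map_smul]
    refine (congrArg (inc Z X) this).trans ?_
    exact (map_add (inc Z X) _ _).trans (congrArg (· + _) (map_smul (inc Z X) _ _))
  · induction hs with
    | nil => exact .nil (C := oneObject A) PUnit.unit
    | cons hg _ ih => exact .cons (C := oneObject A) (ret_mem hg) ih
  · have hstr : ∀ {Z X : (oneObject A).Obj} (s : Str (oneObject A) Z X),
        retractStr ret (F.str s) = s := by
      intro Z X s
      induction s with
      | nil => rfl
      | cons g s ih =>
        exact congrArg₂ (Str.cons (C := oneObject A)) (ret_map g) ih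
    funext Z X s
    change (F.map Z X).symm (inc _ _ (φ _ _ (retractStr ret (F.str s)))) = φ Z X s
    rw [hstr]
    exact (congrArg (F.map Z X).symm (inc_map _)).trans ((F.map Z X).symm_apply_apply _)

end OneObject

section Vanishing

variable {k : Type u} [Field k] {C : BigradedDGCategory k}

/-- All multilinear functions vanish on the string. -/
def Vanishes {Z X : C.Obj} (s : Str C Z X) : Prop :=
  ∀ (N : Type u) [AddCommGroup N] [Module k N] (φ : Str C Z X → N), IsMultilinear φ → φ s = 0

theorem Vanishes.cons {Z Y X : C.Obj} {s : Str C Y X} (h : Vanishes s) (g : C.Mor Z Y) :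
    Vanishes (.cons g s) := fun N _ _ _ hφ => h N _ (hφ.tail g)

theorem vanishes_cons_zero {Z Y X : C.Obj} {g : C.Mor Z Y} (hg : g = 0) (s : Str C Y X) :
    Vanishes (.cons g s) := fun N _ _ _ hφ => by
  subst hg
  exact map_zero (hφ.headMap Y s)

variable {A B : BigradedDGAlgebra k} (K : BigradedDGBimodule B A)

/-- The strings of morphisms in `cat (A, B, K)` from an object to itself are strings of elements of
`A` or of `B`, up to strings with a zero entry; all strings to `a` from `b` have a zero entry. -/
def StrShape : {Z X : (cat K).Obj} → Str (cat K) Z X → Prop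
  | .a, .a, s => (∃ t, (inclA K).str (Z := PUnit.unit) (X := PUnit.unit) t = s) ∨ Vanishes s
  | .b, .b, s => (∃ t, (inclB K).str (Z := PUnit.unit) (X := PUnit.unit) t = s) ∨ Vanishes s
  | .a, .b, s => Vanishes s
  | .b, .a, _ => True

theorem strShape {Z X : (cat K).Obj} (s : Str (cat K) Z X) : StrShape K s := by
  induction s with
  | nil X =>
    cases X
    · exact Or.inl ⟨.nil (C := oneObject A) PUnit.unit, rfl⟩
    · exact Or.inl ⟨.nil (C := oneObject B) PUnit.unit, rfl⟩
  | @cons Z Y X g s ih =>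
    cases Z <;> cases Y <;> cases X
    · rcases ih with ⟨t, rfl⟩ | h
      · exact Or.inl ⟨.cons (C := oneObject A) (Y := PUnit.unit) g t, rfl⟩
      · exact Or.inr (h.cons g)
    · exact Vanishes.cons ih g
    · exact Or.inr (vanishes_cons_zero rfl s)
    · exact vanishes_cons_zero rfl s
    · trivial
    · exact Or.inr (Vanishes.cons ih g)
    · trivial
    · rcases ih with ⟨t, rfl⟩ | h
      · exact Or.inl ⟨.cons (C := oneObject B) (Y := PUnit.unit) g t, rfl⟩
      · exact Or.inr (h.cons g)

theorem eq_zero_of_pull_inclA {n j : ℤ} {φ : Fam (cat K)} (h : φ ∈ Hoch (cat K) n j)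
    (h0 : (inclA K).pull φ = 0) (Z : (cat K).Obj) (hZ : Z ≠ objB K) : φ Z = 0 := by
  funext X s
  cases Z with
  | b => exact absurd rfl hZ
  | a =>
    cases X with
    | b => rfl
    | a =>
      rcases strShape K s with ⟨t, rfl⟩ | hs
      · exact congrFun (congrFun (congrFun h0 PUnit.unit) PUnit.unit) t
      · exact hs ((cat K).Mor (objA K) (objA K)) _ (h.1 _ _)

theorem eq_zero_of_pull_inclB {n j : ℤ} {φ : Fam (cat K)} (h : φ ∈ Hoch (cat K) n j)
    (h0 : (inclB K).pull φ = 0) (Z X : (cat K).Obj) (hX : X ≠ objA K) : φ Z X = 0 := by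
  funext s
  cases X with
  | a => exact absurd rfl hX
  | b =>
    cases Z with
    | a => rfl
    | b =>
      rcases strShape K s with ⟨t, rfl⟩ | hs
      · exact congrFun (congrFun (congrFun h0 PUnit.unit) PUnit.unit) t
      · exact hs ((cat K).Mor (objB K) (objB K)) _ (h.1 _ _)

theorem exists_pull_inclA {n j : ℤ} {φ : Fam (oneObject A)} (h : φ ∈ Hoch (oneObject A) n j) :
    ∃ φ' ∈ Hoch (cat K) n j, (inclA K).pull φ' = φ := by
  refine (inclA K).exists_pull_eq
    (fun
      | .a, .a => (LinearMap.id : A.carrier →ₗ[k] A.carrier)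
      | .b, .b => (0 : B.carrier →ₗ[k] A.carrier)
      | .b, .a => (0 : K.carrier →ₗ[k] A.carrier)
      | .a, .b => (0 : PUnit.{u + 1} →ₗ[k] A.carrier))
    (fun
      | .a, .a => (LinearMap.id : A.carrier →ₗ[k] A.carrier)
      | .b, .b => (0 : A.carrier →ₗ[k] B.carrier)
      | .b, .a => (0 : A.carrier →ₗ[k] K.carrier)
      | .a, .b => (0 : A.carrier →ₗ[k] PUnit.{u + 1}))
    (fun {Z X i j g} hg => ?_) (fun {Z X i j g} hg => ?_) (fun _ => rfl) (fun _ => rfl) h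
  · cases Z <;> cases X
    · exact hg
    all_goals exact zero_mem _
  · cases Z <;> cases X
    · exact hg
    all_goals exact zero_mem _

theorem exists_pull_inclB {n j : ℤ} {φ : Fam (oneObject B)} (h : φ ∈ Hoch (oneObject B) n j) :
    ∃ φ' ∈ Hoch (cat K) n j, (inclB K).pull φ' = φ := by
  refine (inclB K).exists_pull_eq
    (fun
      | .a, .a => (0 : A.carrier →ₗ[k] B.carrier)
      | .b, .b => (LinearMap.id : B.carrier →ₗ[k] B.carrier)
      | .b, .a => (0 : K.carrier →ₗ[k] B.carrier)
      | .a, .b => (0 : PUnit.{u + 1} →ₗ[k] B.carrier))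
    (fun
      | .a, .a => (0 : B.carrier →ₗ[k] A.carrier)
      | .b, .b => (LinearMap.id : B.carrier →ₗ[k] B.carrier)
      | .b, .a => (0 : B.carrier →ₗ[k] K.carrier)
      | .a, .b => (0 : B.carrier →ₗ[k] PUnit.{u + 1}))
    (fun {Z X i j g} hg => ?_) (fun {Z X i j g} hg => ?_) (fun _ => rfl) (fun _ => rfl) h
  · cases Z <;> cases X
    case b.b => exact hg
    all_goals exact zero_mem _
  · cases Z <;> cases X
    case b.b => exact hg
    all_goals exact zero_mem _

theorem projA_quasiIso (R : KProjectiveResolution K.toRight)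
    (hR : ∀ j, QuasiIso (leftAction K R j)) : QuasiIso (projA K) := by
  refine (inclA K).proj_quasiIso (exists_pull_inclA K) fun {n j φ} h hδ h0 => ?_
  obtain ⟨ψ, ⟨h1, h2⟩, h3⟩ := (rightKellerData K R hR).exists_delta_eq h hδ
    (eq_zero_of_pull_inclA K h h0)
  refine ⟨ψ, h1, ?_, h3⟩
  funext Z X s
  have h4 : ψ (objA K) = 0 := h2 _ (by rintro ⟨⟩)
  exact congrFun (congrFun h4 (objA K)) _

theorem projB_quasiIso (R : KProjectiveResolution K.toLeft)
    (hR : ∀ j, QuasiIso (rightAction K R j)) : QuasiIso (projB K) := by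
  refine (inclB K).proj_quasiIso (exists_pull_inclB K) fun {n j φ} h hδ h0 => ?_
  obtain ⟨ψ, ⟨h1, h2⟩, h3⟩ := KellerData.exists_delta_eq_op (C := cat K) (U := objA K)
    (leftKellerData K R hR) h hδ
    (eq_zero_of_pull_inclB K h h0)
  refine ⟨ψ, h1, ?_, h3⟩
  funext Z X s
  have h4 : ψ (objB K) (objB K) = 0 := h2 _ _ (by rintro ⟨⟩)
  exact congrFun h4 _

end Vanishing

end GradedKeller

end

theorem theorem4p2 {k : Type*} [Field k] (A B : GradedKeller.BigradedDGAlgebra k)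
    (K : GradedKeller.BigradedDGBimodule B A) (hK : GradedKeller.GradedKellerCondition A B K) :
    QuasiIso (GradedKeller.projA K) ∧ QuasiIso (GradedKeller.projB K) := by
  obtain ⟨⟨R, hR⟩, R', hR'⟩ := hK
  exact ⟨GradedKeller.projA_quasiIso K R hR, GradedKeller.projB_quasiIso K R' hR'⟩
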